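/- Consider random access machines with unit-cost instructions (copying, increment, subtraction, comparison with zero, indirect addressing) that have access to the rank oracles of two matroids $\mathcal M_1=(V,\mathcal I_1)$ and $\mathcal M_2=(V,\mathcal I_2)$ on a common ground set $V=\{0,\dots,n-1\}$: given the indicator vector of a set $X\subseteq V$ stored in memory as an array of length $n$, the $i$-th oracle returns $\mathrm{rank}_i(X)=\max\{|Y| : Y\subseteq X,\ Y\in\mathcal I_i\}$ in time $T_i$. Put $\mathcal T_{\mathsf{rank}}=T_1+T_2$ and assume $\mathcal T_{\mathsf{rank}}\ge n$ (the time of an oracle call includes reading its $n$-entry input). Let $r$ be the size of a largest common independent set, i.e. of a largest set in $\mathcal I_1\cap\mathcal I_2$. Then there are two fixed programs and absolute constants, independent of $n$, of the matroids, of $T_1,T_2$ and of $\epsilon$, such that: (1) Given $n$, the first program always halts with a set $S\in\mathcal I_1\cap\mathcal I_2$ with $|S|=r$, and for $n\ge 2$ its total running time is $O\bigl(n\sqrt{\max(r,1)}\,\log n\cdot \mathcal T_{\mathsf{rank}}\bigr)$. (2) Given $n$ and a rational number $\epsilon\in(0,1]$ as a fraction $p/q$ of integers, the second program always halts with a set $S\in\mathcal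 I_1\cap\mathcal I_2$ with $|S|\ge(1-\epsilon)r$, and for $n\ge 2$ its total running time is $O\bigl(n\,\epsilon^{-1}\log n\cdot \mathcal T_{\mathsf{rank}}\bigr)$. -/

import Mathlib

namespace RankOracle

/-- Memory of the machine: registers `reg 0, reg 1, …` and arrays `arr 0, arr 1, …`, all of whose
cells hold natural numbers. A program mentions only finitely many registers and arrays. -/
structure Store where
  reg : ℕ → ℕ
  arr : ℕ → ℕ → ℕ

/-- `reg x := v`. -/
def Store.setReg (s : Store) (x v : ℕ) : Store :=
  { s with reg := Function.update s.reg x v }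

/-- `arr a [i] := v`. -/
def Store.setArr (s : Store) (a i v : ℕ) : Store :=
  { s with arr := Function.update s.arr a (Function.update (s.arr a) i v) }

/-- The subset of the ground set `{0, …, n - 1}` whose indicator vector is stored in the first `n`
cells of array `a`: the elements `v` with `arr a [v] ≠ 0`. -/
def Store.set (s : Store) (n a : ℕ) : Set (Fin n) :=
  {v | s.arr a v ≠ 0}

/-- The initial memory: the input list in registers `0, 1, 2, …`, and zero everywhere else. -/
def Store.init (input : List ℕ) : Store where
  reg := fun x => input.getD x 0
  arr := fun _ _ => 0

/-- Programs of a random access machine with two rank oracles. The only arithmetic operations are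
increment and truncated subtraction, so that an instruction increases the largest stored number by
at most one: a run of length polynomial in its inputs handles only words of logarithmic length. -/
inductive Program where
  /-- `reg x := c` for a constant `c` -/
  | const (x c : ℕ)
  /-- `reg x := reg y` -/
  | copy (x y : ℕ)
  /-- `reg x := reg y + 1` -/
  | succ (x y : ℕ)
  /-- `reg x := max (reg y - reg z) 0` -/
  | sub (x y z : ℕ)
  /-- `reg x := arr a [reg i]` -/
  | load (x a i : ℕ)
  /-- `arr a [reg i] := reg x` -/
  | store (a i x : ℕ)
  /-- `reg x := rank₁ (the set stored in array a)` -/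
  | rankFst (x a : ℕ)
  /-- `reg x := rank₂ (the set stored in array a)` -/
  | rankSnd (x a : ℕ)
  /-- `P; Q` -/
  | seq (P Q : Program)
  /-- if `reg x ≠ 0` then `P` else `Q` -/
  | ite (x : ℕ) (P Q : Program)
  /-- while `reg x ≠ 0` do `P` -/
  | loop (x : ℕ) (P : Program)

/-- The rank of the set `X` in the matroid `M`: the size of a largest independent subset of `X`.
It is finite as the ground set is. -/
noncomputable def rank {n : ℕ} (M : Matroid (Fin n)) (X : Set (Fin n)) : ℕ :=
  (M.eRk X).toNat

/-- `Runs M₁ M₂ T₁ T₂ P s s' t`: with rank oracles for `M₁` and `M₂` whose answers take time `T₁`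
and `T₂`, the program `P` started in memory `s` halts in memory `s'` after exactly `t` time units.
Every instruction and every test takes one unit, and an oracle call takes the time of the oracle in
addition. A program that does not halt has no run. -/
inductive Runs {n : ℕ} (M₁ M₂ : Matroid (Fin n)) (T₁ T₂ : ℕ) :
    Program → Store → Store → ℕ → Prop where
  | const (s : Store) (x c : ℕ) :
      Runs M₁ M₂ T₁ T₂ (.const x c) s (s.setReg x c) 1
  | copy (s : Store) (x y : ℕ) :
      Runs M₁ M₂ T₁ T₂ (.copy x y) s (s.setReg x (s.reg y)) 1
  | succ (s : Store) (x y : ℕ) :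
      Runs M₁ M₂ T₁ T₂ (.succ x y) s (s.setReg x (s.reg y + 1)) 1
  | sub (s : Store) (x y z : ℕ) :
      Runs M₁ M₂ T₁ T₂ (.sub x y z) s (s.setReg x (s.reg y - s.reg z)) 1
  | load (s : Store) (x a i : ℕ) :
      Runs M₁ M₂ T₁ T₂ (.load x a i) s (s.setReg x (s.arr a (s.reg i))) 1
  | store (s : Store) (a i x : ℕ) :
      Runs M₁ M₂ T₁ T₂ (.store a i x) s (s.setArr a (s.reg i) (s.reg x)) 1
  | rankFst (s : Store) (x a : ℕ) :
      Runs M₁ M₂ T₁ T₂ (.rankFst x a) s (s.setReg x (rank M₁ (s.set n a))) (T₁ + 1)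
  | rankSnd (s : Store) (x a : ℕ) :
      Runs M₁ M₂ T₁ T₂ (.rankSnd x a) s (s.setReg x (rank M₂ (s.set n a))) (T₂ + 1)
  | seq {P Q : Program} {s s' s'' : Store} {t t' : ℕ}
      (hP : Runs M₁ M₂ T₁ T₂ P s s' t) (hQ : Runs M₁ M₂ T₁ T₂ Q s' s'' t') :
      Runs M₁ M₂ T₁ T₂ (.seq P Q) s s'' (t + t')
  | ite_true {x : ℕ} {P Q : Program} {s s' : Store} {t : ℕ} (hx : s.reg x ≠ 0)
      (hP : Runs M₁ M₂ T₁ T₂ P s s' t) :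
      Runs M₁ M₂ T₁ T₂ (.ite x P Q) s s' (t + 1)
  | ite_false {x : ℕ} {P Q : Program} {s s' : Store} {t : ℕ} (hx : s.reg x = 0)
      (hQ : Runs M₁ M₂ T₁ T₂ Q s s' t) :
      Runs M₁ M₂ T₁ T₂ (.ite x P Q) s s' (t + 1)
  | loop_true {x : ℕ} {P : Program} {s s' s'' : Store} {t t' : ℕ} (hx : s.reg x ≠ 0)
      (hP : Runs M₁ M₂ T₁ T₂ P s s' t) (hL : Runs M₁ M₂ T₁ T₂ (.loop x P) s' s'' t') :
      Runs M₁ M₂ T₁ T₂ (.loop x P) s s'' (t + t' + 1)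
  | loop_false {x : ℕ} {P : Program} {s : Store} (hx : s.reg x = 0) :
      Runs M₁ M₂ T₁ T₂ (.loop x P) s s 1

/-- The machine is deterministic: memory and time at the end of a run are determined. -/
theorem Runs.unique {n : ℕ} {M₁ M₂ : Matroid (Fin n)} {T₁ T₂ : ℕ} {P : Program}
    {s s₁ s₂ : Store} {t₁ t₂ : ℕ} (h₁ : Runs M₁ M₂ T₁ T₂ P s s₁ t₁)
    (h₂ : Runs M₁ M₂ T₁ T₂ P s s₂ t₂) : s₁ = s₂ ∧ t₁ = t₂ := by
  induction h₁ generalizing s₂ t₂ with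
  | seq _ _ ihP ihQ =>
    cases h₂ with
    | seq hP hQ =>
      obtain ⟨rfl, rfl⟩ := ihP hP
      obtain ⟨rfl, rfl⟩ := ihQ hQ
      exact ⟨rfl, rfl⟩
  | ite_true hx _ ih =>
    cases h₂ with
    | ite_true _ h =>
      obtain ⟨rfl, rfl⟩ := ih h
      exact ⟨rfl, rfl⟩
    | ite_false hx' _ => exact absurd hx' hx
  | ite_false hx _ ih =>
    cases h₂ with
    | ite_true hx' _ => exact absurd hx hx'
    | ite_false _ h =>
      obtain ⟨rfl, rfl⟩ := ih h
      exact ⟨rfl, rfl⟩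
  | loop_true hx _ _ ihP ihL =>
    cases h₂ with
    | loop_true _ hP hL =>
      obtain ⟨rfl, rfl⟩ := ihP hP
      obtain ⟨rfl, rfl⟩ := ihL hL
      exact ⟨rfl, rfl⟩
    | loop_false hx' => exact absurd hx' hx
  | loop_false hx =>
    cases h₂ with
    | loop_true hx' _ _ => exact absurd hx hx'
    | loop_false _ => exact ⟨rfl, rfl⟩
  | _ => cases h₂; exact ⟨rfl, rfl⟩

/-- `X` is independent in both matroids. -/
def CommonIndep {n : ℕ} (M₁ M₂ : Matroid (Fin n)) (X : Set (Fin n)) : Prop :=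
  M₁.Indep X ∧ M₂.Indep X

/-- `r` is the size of a largest common independent set. -/
def IsMaxCommonSize {n : ℕ} (M₁ M₂ : Matroid (Fin n)) (r : ℕ) : Prop :=
  IsGreatest {k : ℕ | ∃ X : Set (Fin n), CommonIndep M₁ M₂ X ∧ X.ncard = k} r

end RankOracle

/-! The algorithms keep a base `I₁` of `M₁` and a set `I₂ ⊆ I₁` independent in `M₂`; `I₂` is the
current common independent set and the members of `I₁ \ I₂` are called unmatched. In the exchange
graph there is an arc `v → f` if `v ∉ I₂` can replace `f ∈ I₂` in `M₂`, and an arc `h → g` if `h ∈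
I₁` can be replaced by `g ∉ I₁` in `M₁`; the sinks are the elements outside the `M₂`-closure of
`I₂`. A shortest path from an unmatched element to a sink enlarges `I₂`.

As in push-relabel methods for flows, labels `p` are kept that vanish at the sinks and drop by at
most one along every arc (`Valid`, phrased through closures of level sets). An unmatched `x` is
added to `I₂` if it is a sink; otherwise it hands its role to a neighbour one level lower by a swap
in `I₂` or in `I₁`; if there is no such neighbour, its label rises by one. A swap does not change
the spans of the level sets that matter (`closure_swap`), so validity survives. Each move raises
`potential`, which is `O(nK)` while labels are at most `K`; hence after `O(nK)` moves every
unmatched element has label at least `K`.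

Then a duality argument applies. For each cut `0 < k < K`, the elements of label at least `k` lie in
the `M₂`-span of the members of `I₂` of level at least `k - 1`, and the others in the `M₁`-span of
the members of `I₂` of level at most `k`. Averaging over the cuts gives `(K - 1) r ≤ (K + 1) |I₂|`
(`Valid.ncard_le`). With `K` about `2 / ε` this is the approximation. For the exact algorithm `K` is
about `√r`, which leaves a deficit of `O(√r)`; each missing element costs one breadth-first search
from the sinks, which makes the labels exact, and one walk down a shortest path (`Move.exact_pred`).
As `r` is unknown, `K` is computed from the outcome of a preliminary run with `K = 3`, which is at
least `r / 2`.

One comparison of ranks decides whether some element of a given candidate set is an exchange partner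
of `x`, so binary search over prefixes of the ground set finds a partner with `O(log n)` queries
(`halts_find`). Writing a query takes `O(n)` steps, no more than the oracle time up to a constant. A
move and a round of the search thus cost `O(log n)` oracle calls each.

In memory, arrays `0`, `1` and `2` hold `I₂`, `I₁` and the labels, register `0` holds `n` and
register `3` the bound `K`. Programs are verified by time-bounded Hoare rules for `Halts`. -/

namespace RankOracle

open Set

/-! ### Exchange and closure in a matroid. -/

section Matroid

variable {α : Type*} {M : Matroid α} {I A F : Set α} {x f : α}

/-- For subsets of an independent set, closure commutes with intersection, and `I \ A` is the
intersection of the sets `I \ {v}`. This turns a question about all candidates in `A` into a single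
rank query. -/
theorem notMem_closure_diff_iff (hI : M.Indep I) (hx : x ∈ M.closure I) :
    x ∉ M.closure (I \ A) ↔ ∃ v ∈ A, x ∉ M.closure (I \ {v}) := by
  constructor
  · intro h
    by_contra! hc
    rcases A.eq_empty_or_nonempty with rfl | hA
    · simp [hx] at h
    have key := Matroid.closure_biInter_eq_biInter_closure_of_biUnion_indep (M := M) hA
      (I := fun v : α => I \ {v}) (hI.subset (iUnion₂_subset fun v _ => sdiff_subset))
    apply h
    have h2 : I \ A = ⋂ v ∈ A, I \ {v} := by
      ext y
      simp only [mem_sdiff, mem_iInter, mem_singleton_iff]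
      refine ⟨fun hy v hv => ⟨hy.1, fun e => hy.2 (e ▸ hv)⟩, fun hy => ?_⟩
      obtain ⟨v, hv⟩ := hA
      exact ⟨(hy v hv).1, fun hyA => (hy y hyA).2 rfl⟩
    rw [h2, key]
    simpa using hc
  · rintro ⟨v, hv, hxv⟩ h
    exact hxv (M.closure_subset_closure (sdiff_subset_sdiff_right (by simpa using hv)) h)

/-- The counterpart for `x ∈ I`: if no `v ∈ A` escapes the closure of `I \ {x}`, then adding `A`
adds nothing to the span; an escaping `v` spans `x` together with `I \ {x}` by the exchange
property. -/
theorem mem_closure_union_diff_iff (hI : M.Indep I) (hx : x ∈ I) (hA : A ⊆ M.closure I)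
    (hxA : x ∉ A) :
    x ∈ M.closure ((I ∪ A) \ {x}) ↔ ∃ v ∈ A, v ∉ M.closure (I \ {x}) := by
  have hxc := hI.notMem_closure_sdiff_of_mem hx
  have hIE := hI.subset_ground
  constructor
  · intro h
    by_contra! hc
    apply hxc
    have : (I ∪ A) \ {x} ⊆ M.closure (I \ {x}) := by
      rintro y ⟨hy | hy, hyx⟩
      · exact M.subset_closure (I \ {x}) (sdiff_subset.trans hIE) ⟨hy, hyx⟩
      · exact hc y hy
    exact M.closure_subset_closure_of_subset_closure this h
  · rintro ⟨v, hv, hvc⟩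
    have h1 : v ∈ M.closure (insert x (I \ {x})) := by
      rw [insert_sdiff_singleton, insert_eq_of_mem hx]; exact hA hv
    have h2 := (M.closure_exchange ⟨h1, hvc⟩).1
    refine M.closure_subset_closure ?_ h2
    rintro y (rfl | hy)
    · exact ⟨Or.inr hv, fun e => hxA (by simpa using e ▸ hv)⟩
    · exact ⟨Or.inl hy.1, hy.2⟩

/-- This keeps labels valid under swaps: an exchange inside `I` leaves the span of a subset `F`
unchanged if `F` contains the element removed and spans the one inserted. -/
theorem closure_swap (hFI : F ⊆ I) (hf : f ∈ F) (hx : x ∈ M.closure F)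
    (hxf : x ∉ M.closure (I \ {f})) :
    M.closure (insert x (F \ {f})) = M.closure F := by
  have h1 : x ∈ M.closure (insert f (F \ {f})) \ M.closure (F \ {f}) := by
    refine ⟨?_, fun h => hxf (M.closure_subset_closure (sdiff_subset_sdiff_left hFI) h)⟩
    rwa [insert_sdiff_singleton, insert_eq_of_mem hf]
  rw [M.closure_insert_congr h1, insert_sdiff_singleton, insert_eq_of_mem hf]

theorem indep_swap (hE : M.E = univ) (hI : M.Indep I) (hxf : x ∉ M.closure (I \ {f})) :
    M.Indep (insert x (I \ {f})) :=
  ((hI.subset sdiff_subset).insert_indep_iff).2 (Or.inl ⟨by simp [hE], hxf⟩)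

/-- The link between oracle answers and closures: the gain of rank is zero or one and detects
membership in the closure. -/
theorem rank_insert {n : ℕ} (M : Matroid (Fin n)) (hE : M.E = univ) (D : Set (Fin n))
    (x : Fin n) [Decidable (x ∈ M.closure D)] :
    rank M (insert x D) = rank M D + if x ∈ M.closure D then 0 else 1 := by
  unfold rank
  have hfin : M.eRk D ≠ ⊤ := ((M.eRk_le_encard D).trans_lt (toFinite D).encard_lt_top).ne
  split_ifs with h
  · rw [← M.eRk_closure_eq (insert x D), Matroid.closure_insert_eq_of_mem_closure h, M.eRk_closure_eq]; rfl
  · rw [Matroid.eRk_insert_eq_add_one (show x ∈ M.E \ M.closure D from ⟨by simp [hE], h⟩), ENat.toNat_add hfin (by simp)]; rfl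

theorem ncard_le_of_subset_closure [Finite α] {X F : Set α} (hX : M.Indep X)
    (h : X ⊆ M.closure F) : X.ncard ≤ F.ncard := by
  have h1 : X.encard ≤ F.encard := by
    rw [← hX.eRk_eq_encard]
    exact (M.eRk_mono h).trans ((M.eRk_closure_eq F).le.trans (M.eRk_le_encard F))
  rwa [← (toFinite X).cast_ncard_eq, ← (toFinite F).cast_ncard_eq, Nat.cast_le] at h1

theorem rank_eq_ncard {n : ℕ} {M : Matroid (Fin n)} {X : Set (Fin n)} (hX : M.Indep X) :
    rank M X = X.ncard := by
  unfold rank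
  rw [hX.eRk_eq_encard]; rfl

end Matroid

/-! ### Valid labels and the duality bound. -/

/-- The members of `I` of level at least `j`. -/
def levelGE {α : Type*} (I : Set α) (p : α → ℕ) (j : ℕ) : Set α := {f ∈ I | j ≤ p f}

/-- The members of `I` of level at most `j`. -/
def levelLE {α : Type*} (I : Set α) (p : α → ℕ) (j : ℕ) : Set α := {h ∈ I | p h ≤ j}

/-- A labelling `p` of the ground set that is a lower bound for the distances to the sink in the
exchange graph of a base `I₁` of `M₁` and a set `I₂ ⊆ I₁` that is independent in `M₂`. -/
structure Valid {α : Type*} (M₁ M₂ : Matroid α) (I₁ I₂ : Set α) (p : α → ℕ) : Prop where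
  base : M₁.IsBase I₁
  indep : M₂.Indep I₂
  sub : I₂ ⊆ I₁
  snd : ∀ v ∉ I₂, p v ≠ 0 → v ∈ M₂.closure (levelGE I₂ p (p v - 1))
  fst : ∀ g ∉ I₁, g ∈ M₁.closure (levelLE I₁ p (p g + 1))

section Labels

variable {α : Type*} {M₁ M₂ : Matroid α} {I₁ I₂ I : Set α} {p : α → ℕ} {x f g : α} {j k : ℕ}

theorem levelGE_subset : levelGE I p j ⊆ I := fun _ h => h.1

theorem levelLE_subset : levelLE I p j ⊆ I := fun _ h => h.1

theorem levelGE_anti (h : k ≤ j) : levelGE I p j ⊆ levelGE I p k := fun _ hv => ⟨hv.1, h.trans hv.2⟩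

theorem levelLE_mono (h : j ≤ k) : levelLE I p j ⊆ levelLE I p k := fun _ hv => ⟨hv.1, hv.2.trans h⟩

theorem levelGE_insert (hx : j ≤ p x) :
    levelGE (insert x I) p j = insert x (levelGE I p j) := by
  ext y
  simp only [levelGE, mem_ofPred_eq, mem_insert_iff]
  constructor
  · rintro ⟨rfl | h, h2⟩
    · exact Or.inl rfl
    · exact Or.inr ⟨h, h2⟩
  · rintro (rfl | ⟨h, h2⟩)
    · exact ⟨Or.inl rfl, hx⟩
    · exact ⟨Or.inr h, h2⟩

theorem levelLE_insert (hx : p x ≤ j) :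
    levelLE (insert x I) p j = insert x (levelLE I p j) := by
  ext y
  simp only [levelLE, mem_ofPred_eq, mem_insert_iff]
  constructor
  · rintro ⟨rfl | h, h2⟩
    · exact Or.inl rfl
    · exact Or.inr ⟨h, h2⟩
  · rintro (rfl | ⟨h, h2⟩)
    · exact ⟨Or.inl rfl, hx⟩
    · exact ⟨Or.inr h, h2⟩

theorem levelGE_diff : levelGE (I \ {f}) p j = levelGE I p j \ {f} := by
  ext y; simp only [levelGE, mem_ofPred_eq, mem_sdiff]; tauto

theorem levelLE_diff : levelLE (I \ {f}) p j = levelLE I p j \ {f} := by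
  ext y; simp only [levelLE, mem_ofPred_eq, mem_sdiff]; tauto

namespace Valid

theorem mem_closure_fst (h : Valid M₁ M₂ I₁ I₂ p) (v : α) :
    v ∈ M₁.closure (levelLE I₁ p (p v + 1)) := by
  by_cases hv : v ∈ I₁
  · exact M₁.mem_closure_of_mem (show v ∈ levelLE I₁ p (p v + 1) from ⟨hv, by omega⟩) (levelLE_subset.trans h.base.subset_ground)
  · exact h.fst v hv

/-- By validity `x` is spanned by the members of level at least `p x - 1 = p f`, hence by each
larger level set, so `closure_swap` applies. -/
theorem closure_levelGE_push (h : Valid M₁ M₂ I₁ I₂ p) (hx : x ∉ I₂) (hf : f ∈ I₂)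
    (hp : p f + 1 = p x) (hxf : x ∉ M₂.closure (I₂ \ {f})) (hj : j ≤ p f) :
    M₂.closure (levelGE (insert x (I₂ \ {f})) p j) = M₂.closure (levelGE I₂ p j) := by
  rw [levelGE_insert (by omega), levelGE_diff]
  refine closure_swap levelGE_subset ⟨hf, hj⟩ ?_ hxf
  exact M₂.closure_subset_closure (levelGE_anti (by omega)) (h.snd x hx (by omega))

theorem closure_levelLE_push (h : Valid M₁ M₂ I₁ I₂ p) (hx : x ∈ I₁) (hg : g ∉ I₁)
    (hp : p g + 1 = p x) (hgx : g ∉ M₁.closure (I₁ \ {x})) (hj : p x ≤ j) :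
    M₁.closure (levelLE (insert g (I₁ \ {x})) p j) = M₁.closure (levelLE I₁ p j) := by
  rw [levelLE_insert (by omega), levelLE_diff]
  refine closure_swap levelLE_subset ⟨hx, hj⟩ ?_ hgx
  exact M₁.closure_subset_closure (levelLE_mono (by omega)) (h.fst g hg)

theorem add (h : Valid M₁ M₂ I₁ I₂ p) (hE : M₂.E = univ) (hx : x ∈ I₁)
    (hxc : x ∉ M₂.closure I₂) : Valid M₁ M₂ I₁ (insert x I₂) p where
  base := h.base
  indep := (h.indep.insert_indep_iff).2 (Or.inl ⟨by simp [hE], hxc⟩)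
  sub := insert_subset hx h.sub
  fst := h.fst
  snd := fun v hv h0 => M₂.closure_subset_closure
    (show levelGE I₂ p (p v - 1) ⊆ levelGE (insert x I₂) p (p v - 1) from
      fun _ hy => ⟨Or.inr hy.1, hy.2⟩) (h.snd v (fun h => hv (Or.inr h)) h0)

/-- Level sets at thresholds up to `p f` keep their span; above `p f` they do not contain `f`, so
they lose nothing. -/
theorem pushSnd (h : Valid M₁ M₂ I₁ I₂ p) (hE : M₂.E = univ) (hx : x ∈ I₁) (hx₂ : x ∉ I₂)
    (hf : f ∈ I₂) (hp : p f + 1 = p x) (hxf : x ∉ M₂.closure (I₂ \ {f})) :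
    Valid M₁ M₂ I₁ (insert x (I₂ \ {f})) p where
  base := h.base
  indep := indep_swap hE h.indep hxf
  sub := insert_subset hx (sdiff_subset.trans h.sub)
  fst := h.fst
  snd := by
    intro v hv h0
    have h1 : v ∈ M₂.closure (levelGE I₂ p (p v - 1)) := by
      by_cases hvI : v ∈ I₂
      · exact M₂.mem_closure_of_mem (show v ∈ levelGE I₂ p _ from ⟨hvI, by omega⟩) (levelGE_subset.trans h.indep.subset_ground)
      · exact h.snd v hvI h0
    rcases le_or_gt (p v - 1) (p f) with hj | hj
    · rwa [h.closure_levelGE_push hx₂ hf hp hxf hj]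
    · refine M₂.closure_subset_closure ?_ h1
      rintro y ⟨hy, hy2⟩
      refine ⟨Or.inr ⟨hy, ?_⟩, hy2⟩
      rintro rfl; omega

theorem pushFst (h : Valid M₁ M₂ I₁ I₂ p) (hE : M₁.E = univ) (hx : x ∈ I₁) (hx₂ : x ∉ I₂)
    (hg : g ∉ I₁) (hp : p g + 1 = p x) (hgx : g ∉ M₁.closure (I₁ \ {x})) :
    Valid M₁ M₂ (insert g (I₁ \ {x})) I₂ p where
  base := h.base.exchange_base_of_notMem_closure hx hgx (by simp [hE])
  indep := h.indep
  sub := fun y hy => Or.inr ⟨h.sub hy, by rintro rfl; exact hx₂ hy⟩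
  snd := h.snd
  fst := by
    intro v _
    have h1 := h.mem_closure_fst v
    rcases le_or_gt (p x) (p v + 1) with hj | hj
    · rwa [h.closure_levelLE_push hx hg hp hgx hj]
    · refine M₁.closure_subset_closure ?_ h1
      rintro y ⟨hy, hy2⟩
      refine ⟨Or.inr ⟨hy, ?_⟩, hy2⟩
      rintro rfl; omega

/-- Exchange partners of `x` of level below `p x - 1` are excluded by validity, those of level
exactly `p x - 1` by hypothesis; independence of `I₂` combines the exclusions. -/
theorem mem_closure_levelGE (h : Valid M₁ M₂ I₁ I₂ p) (hx₂ : x ∉ I₂) (hxc : x ∈ M₂.closure I₂)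
    (hf : ∀ f, p f + 1 = p x → x ∈ M₂.closure (I₂ \ {f})) :
    x ∈ M₂.closure (levelGE I₂ p (p x)) := by
  have h1 : levelGE I₂ p (p x) = I₂ \ {f | p f < p x} := by
    ext y; simp [levelGE]
  rw [h1]
  by_contra hc
  obtain ⟨f, hfx, hf2⟩ := (notMem_closure_diff_iff h.indep hxc).1 hc
  simp only [mem_ofPred_eq] at hfx
  rcases (Nat.succ_le_of_lt hfx).eq_or_lt with h2 | h2
  · exact hf2 (hf f h2)
  · refine hf2 (M₂.closure_subset_closure ?_ (h.snd x hx₂ (by omega)))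
    rintro y ⟨hy, hy2⟩
    refine ⟨hy, ?_⟩
    rintro rfl; omega

/-- As `x` is unmatched, its label does not affect the level sets of `I₂`. In `I₁`, raising it can
only remove `x` from level sets, which matters for `g` with `p g + 1 = p x`; there `hg` says that
`x` is not needed to span `g`. -/
theorem raise [DecidableEq α] (h : Valid M₁ M₂ I₁ I₂ p) (hx : x ∈ I₁) (hx₂ : x ∉ I₂)
    (hxc : x ∈ M₂.closure I₂) (hf : ∀ f, p f + 1 = p x → x ∈ M₂.closure (I₂ \ {f}))
    (hg : ∀ g, p g + 1 = p x → g ∈ M₁.closure (I₁ \ {x})) :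
    Valid M₁ M₂ I₁ I₂ (Function.update p x (p x + 1)) where
  base := h.base
  indep := h.indep
  sub := h.sub
  snd := by
    intro v hv h0
    have hG : ∀ j, levelGE I₂ (Function.update p x (p x + 1)) j = levelGE I₂ p j := by
      intro j
      ext y
      simp only [levelGE, mem_ofPred_eq]
      refine and_congr_right fun hy => ?_
      rw [Function.update_of_ne (by rintro rfl; exact hx₂ hy)]
    rw [hG]
    by_cases hvx : v = x
    · subst hvx
      simpa using h.mem_closure_levelGE hx₂ hxc hf
    · rw [Function.update_of_ne hvx] at h0 ⊢
      exact h.snd v hv h0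
  fst := by
    intro g hgI
    have hgx : g ≠ x := fun e => hgI (e ▸ hx)
    rw [Function.update_of_ne hgx]
    have h1 := h.fst g hgI
    by_cases hp : p g + 1 = p x
    · have h2 := hg g hp
      -- Both sets lie in the base, so the intersection of their closures is the closure of their
      -- intersection.
      have h3 : g ∈ M₁.closure (levelLE I₁ p (p g + 1) ∩ (I₁ \ {x})) := by
        rw [Matroid.Indep.closure_inter_eq_inter_closure]
        · exact ⟨h1, h2⟩
        · exact h.base.indep.subset (union_subset levelLE_subset sdiff_subset)
      refine M₁.closure_subset_closure ?_ h3
      rintro y ⟨⟨hy, hy1⟩, hy2⟩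
      refine ⟨hy, ?_⟩
      rwa [Function.update_of_ne (by simpa using hy2.2)]
    · refine M₁.closure_subset_closure ?_ h1
      rintro y ⟨hy, hy1⟩
      refine ⟨hy, ?_⟩
      by_cases hyx : y = x
      · subst hyx; simp only [Function.update_self]; omega
      · rwa [Function.update_of_ne hyx]

end Valid

/-- The two conditions `k ≤ a + 1` and `a ≤ k` overlap only in `a` and `a + 1`. So a member of `I₂`
is counted at most `(K - 1) + 2` times over the cuts `1, …, K - 1`. -/
theorem card_filter_add_card_filter_le (m a : ℕ) :
    ((Finset.Icc 1 m).filter (fun k => k - 1 ≤ a)).card +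
      ((Finset.Icc 1 m).filter (fun k => a ≤ k)).card ≤ m + 2 := by
  rw [← Finset.card_union_add_card_inter]
  have h1 : ((Finset.Icc 1 m).filter (fun k => k - 1 ≤ a) ∪
      (Finset.Icc 1 m).filter (fun k => a ≤ k)).card ≤ m := by
    calc _ ≤ (Finset.Icc 1 m).card :=
          Finset.card_le_card (Finset.union_subset (Finset.filter_subset _ _)
            (Finset.filter_subset _ _))
      _ = m := by simp
  have h2 : ((Finset.Icc 1 m).filter (fun k => k - 1 ≤ a) ∩
      (Finset.Icc 1 m).filter (fun k => a ≤ k)).card ≤ 2 := by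
    calc _ ≤ ({a, a + 1} : Finset ℕ).card := by
          apply Finset.card_le_card
          intro k hk
          simp only [Finset.mem_inter, Finset.mem_filter, Finset.mem_Icc] at hk
          simp only [Finset.mem_insert, Finset.mem_singleton]
          omega
      _ ≤ 2 := Finset.card_le_two
  omega

/-- A dual bound: `X` is split at level `k`, and each half is spanned in one matroid. Since `k < K`,
members of `I₁` of level at most `k` are matched, so only members of `I₂` occur. -/
theorem Valid.ncard_le_cut [Finite α] (h : Valid M₁ M₂ I₁ I₂ p) {K : ℕ}
    (hK : ∀ x ∈ I₁, x ∉ I₂ → K ≤ p x) {X : Set α} (hX₁ : M₁.Indep X) (hX₂ : M₂.Indep X)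
    (hk : 1 ≤ k) (hkK : k < K) :
    X.ncard ≤ (levelGE I₂ p (k - 1)).ncard + (levelLE I₂ p k).ncard := by
  have h1 : (X ∩ {v | k ≤ p v}).ncard ≤ (levelGE I₂ p (k - 1)).ncard := by
    refine ncard_le_of_subset_closure (hX₂.subset inter_subset_left) ?_
    rintro v ⟨-, hv⟩
    simp only [mem_ofPred_eq] at hv
    by_cases hvI : v ∈ I₂
    · exact M₂.mem_closure_of_mem (show v ∈ levelGE I₂ p _ from ⟨hvI, by omega⟩) (levelGE_subset.trans h.indep.subset_ground)
    · exact M₂.closure_subset_closure (levelGE_anti (by omega)) (h.snd v hvI (by omega))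
  have h2 : (X \ {v | k ≤ p v}).ncard ≤ (levelLE I₂ p k).ncard := by
    refine ncard_le_of_subset_closure (hX₁.subset sdiff_subset) ?_
    rintro v ⟨-, hv⟩
    simp only [mem_ofPred_eq, not_le] at hv
    refine M₁.closure_subset_closure ?_ (h.mem_closure_fst v)
    rintro y ⟨hy, hy2⟩
    refine ⟨?_, by omega⟩
    by_contra hc
    have := hK y hy hc
    omega
  have := ncard_inter_add_ncard_sdiff_eq_ncard X {v | k ≤ p v} (toFinite X)
  omega

/-- If every unmatched member of the base has level at least `K`, then the common independent set
`I₂` is nearly as large as any other. -/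
theorem Valid.ncard_le [Finite α] (h : Valid M₁ M₂ I₁ I₂ p) {K : ℕ}
    (hK : ∀ x ∈ I₁, x ∉ I₂ → K ≤ p x) {X : Set α} (hX₁ : M₁.Indep X) (hX₂ : M₂.Indep X) :
    (K - 1) * X.ncard ≤ (K + 1) * I₂.ncard := by
  classical
  rcases Nat.eq_zero_or_pos K with rfl | hKpos
  · simp
  have hfin : I₂.Finite := toFinite I₂
  obtain ⟨J, hJ⟩ : ∃ J : Finset α, I₂ = J := ⟨hfin.toFinset, by simp⟩
  have e1 : ∀ k, (levelGE I₂ p (k - 1)).ncard = ∑ h ∈ J, if k - 1 ≤ p h then 1 else 0 := by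
    intro k
    rw [← Finset.card_filter, ← ncard_coe_finset]
    congr 1
    ext y; simp [levelGE, hJ]
  have e2 : ∀ k, (levelLE I₂ p k).ncard = ∑ h ∈ J, if p h ≤ k then 1 else 0 := by
    intro k
    rw [← Finset.card_filter, ← ncard_coe_finset]
    congr 1
    ext y; simp [levelLE, hJ]
  calc (K - 1) * X.ncard = ∑ k ∈ Finset.Icc 1 (K - 1), X.ncard := by simp
    _ ≤ ∑ k ∈ Finset.Icc 1 (K - 1), ∑ h ∈ J,
          ((if k - 1 ≤ p h then 1 else 0) + if p h ≤ k then 1 else 0) := by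
        refine Finset.sum_le_sum fun k hk => ?_
        rw [Finset.mem_Icc] at hk
        rw [Finset.sum_add_distrib, ← e1, ← e2]
        exact h.ncard_le_cut hK hX₁ hX₂ hk.1 (by omega)
    _ = ∑ h ∈ J, ∑ k ∈ Finset.Icc 1 (K - 1),
          ((if k - 1 ≤ p h then 1 else 0) + if p h ≤ k then 1 else 0) := Finset.sum_comm
    _ ≤ ∑ h ∈ J, (K + 1) := by
        refine Finset.sum_le_sum fun h _ => ?_
        rw [Finset.sum_add_distrib, ← Finset.card_filter, ← Finset.card_filter]
        have := card_filter_add_card_filter_le (K - 1) (p h)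
        omega
    _ = (K + 1) * I₂.ncard := by
        rw [hJ, ncard_coe_finset, Finset.sum_const, smul_eq_mul, mul_comm]

end Labels

/-! ### Elementary moves, their potential and exact labels. -/

/-- Every element `v` of level at most `i` has a neighbour of level `p v - 1`, or is a sink. -/
def Exact {α : Type*} (M₁ M₂ : Matroid α) (I₁ I₂ : Set α) (p : α → ℕ) (i : ℕ) : Prop :=
  ∀ v, p v ≤ i → (v ∉ I₂ ∧ v ∉ M₂.closure (levelGE I₂ p (p v))) ∨
    (v ∈ I₁ ∧ ∃ g, g ∉ I₁ ∧ p g + 1 = p v ∧ g ∉ M₁.closure (I₁ \ {v}))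

/-- The elementary moves at an unmatched member `x` of the base `I₁`; the last index tells whether
`I₂` has grown. -/
inductive Move {α : Type*} [DecidableEq α] (M₁ M₂ : Matroid α) (I₁ I₂ : Set α) (p : α → ℕ) (x : α) :
    Set α → Set α → (α → ℕ) → Prop → Prop where
  | add (hxc : x ∉ M₂.closure I₂) : Move M₁ M₂ I₁ I₂ p x I₁ (insert x I₂) p True
  | pushSnd (f : α) (hf : f ∈ I₂) (hp : p f + 1 = p x) (hxf : x ∉ M₂.closure (I₂ \ {f})) :
      Move M₁ M₂ I₁ I₂ p x I₁ (insert x (I₂ \ {f})) p False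
  | pushFst (g : α) (hg : g ∉ I₁) (hp : p g + 1 = p x) (hgx : g ∉ M₁.closure (I₁ \ {x})) :
      Move M₁ M₂ I₁ I₂ p x (insert g (I₁ \ {x})) I₂ p False
  | raise (hxc : x ∈ M₂.closure I₂) (hf : ∀ f, p f + 1 = p x → x ∈ M₂.closure (I₂ \ {f}))
      (hg : ∀ g, p g + 1 = p x → g ∈ M₁.closure (I₁ \ {x})) :
      Move M₁ M₂ I₁ I₂ p x I₁ I₂ (Function.update p x (p x + 1)) False

open Classical in
/-- A quantity that every move increases. -/
noncomputable def potential {α : Type*} [Fintype α] (I₁ I₂ : Set α) (p : α → ℕ) : ℕ :=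
  ∑ v, ((if v ∈ I₁ then p v else 2 * p v) + if v ∈ I₂ then p v + 1 else 0)

theorem sum_lt_sum_of_pair {α : Type*} [Fintype α] [DecidableEq α] {F G : α → ℕ} {a b : α}
    (hab : a ≠ b) (h : ∀ v, v ≠ a → v ≠ b → F v = G v) (hlt : F a + F b < G a + G b) :
    ∑ v, F v < ∑ v, G v := by
  rw [← Finset.add_sum_erase _ F (Finset.mem_univ a), ← Finset.add_sum_erase _ G (Finset.mem_univ a),
    ← Finset.add_sum_erase _ F (Finset.mem_erase.2 ⟨hab.symm, Finset.mem_univ b⟩),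
    ← Finset.add_sum_erase _ G (Finset.mem_erase.2 ⟨hab.symm, Finset.mem_univ b⟩)]
  have : ∑ v ∈ (Finset.univ.erase a).erase b, F v = ∑ v ∈ (Finset.univ.erase a).erase b, G v :=
    Finset.sum_congr rfl fun v hv => by
      simp only [Finset.mem_erase] at hv
      exact h v hv.2.1 hv.1
  omega

theorem sum_lt_sum_of_single {α : Type*} [Fintype α] {F G : α → ℕ} {a : α}
    (h : ∀ v, v ≠ a → F v = G v) (hlt : F a < G a) : ∑ v, F v < ∑ v, G v := by
  refine Finset.sum_lt_sum (fun v _ => ?_) ⟨a, Finset.mem_univ a, hlt⟩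
  by_cases hv : v = a
  · exact hv ▸ hlt.le
  · exact (h v hv).le

theorem potential_le {α : Type*} [Fintype α] {I₁ I₂ : Set α} {p : α → ℕ} {K : ℕ}
    (hp : ∀ v, p v ≤ K) : potential I₁ I₂ p ≤ Fintype.card α * (3 * K + 1) := by
  unfold potential
  rw [← smul_eq_mul, ← Finset.card_univ]
  refine Finset.sum_le_card_nsmul _ _ _ fun v _ => ?_
  have := hp v
  split_ifs <;> omega

namespace Move

variable {α : Type*} [DecidableEq α] {M₁ M₂ : Matroid α} {I₁ I₂ J₁ J₂ : Set α} {p q : α → ℕ} {x : α}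
  {b : Prop}

theorem valid (hm : Move M₁ M₂ I₁ I₂ p x J₁ J₂ q b) (h : Valid M₁ M₂ I₁ I₂ p)
    (hE₁ : M₁.E = univ) (hE₂ : M₂.E = univ) (hx : x ∈ I₁) (hx₂ : x ∉ I₂) :
    Valid M₁ M₂ J₁ J₂ q := by
  cases hm with
  | add hxc => exact h.add hE₂ hx hxc
  | pushSnd f hf hp hxf => exact h.pushSnd hE₂ hx hx₂ hf hp hxf
  | pushFst g hg hp hgx => exact h.pushFst hE₁ hx hx₂ hg hp hgx
  | raise hxc hf hg => exact h.raise hx hx₂ hxc hf hg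

/-- An element counts `2p` outside `I₁`, `p` if unmatched and `2p + 1` in `I₂`. A swap between
levels `l` and `l - 1` gains exactly one: in `M₂` it gains `l + 1` and loses `l`, in `M₁` it gains
`l` and loses `l - 1`. -/
theorem potential_lt [Fintype α] (hm : Move M₁ M₂ I₁ I₂ p x J₁ J₂ q b) (hI : I₂ ⊆ I₁)
    (hx : x ∈ I₁) (hx₂ : x ∉ I₂) : potential I₁ I₂ p < potential J₁ J₂ q := by
  classical
  unfold potential
  cases hm with
  | add hxc =>
    refine sum_lt_sum_of_single (a := x) (fun v hv => ?_) ?_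
    · have : v ∈ insert x I₂ ↔ v ∈ I₂ := by simp [hv]
      simp only [this]
    · simp [hx₂]
  | pushSnd f hf hp hxf =>
    have hfx : x ≠ f := by rintro rfl; exact hx₂ hf
    refine sum_lt_sum_of_pair hfx (fun v hv hv2 => ?_) ?_
    · have : v ∈ insert x (I₂ \ {f}) ↔ v ∈ I₂ := by simp [hv, hv2]
      simp only [this]
    · simp [hx₂, hx, hf, hI hf, hfx.symm]; omega
  | pushFst g hg hp hgx =>
    have hgx : x ≠ g := by rintro rfl; exact hg hx
    refine sum_lt_sum_of_pair hgx (fun v hv hv2 => ?_) ?_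
    · have : v ∈ insert g (I₁ \ {x}) ↔ v ∈ I₁ := by simp [hv, hv2]
      simp only [this]
    · have : g ∉ I₂ := fun h => hg (hI h)
      simp [hx₂, hx, hg, this, hgx]; omega
  | raise hxc hf hg =>
    refine sum_lt_sum_of_single (a := x) (fun v hv => ?_) ?_
    · simp [hv]
    · simp [hx₂, hx]

theorem le_of_lt (hm : Move M₁ M₂ I₁ I₂ p x J₁ J₂ q b) {K : ℕ} (hp : ∀ v, p v ≤ K)
    (hx : p x < K) : ∀ v, q v ≤ K := by
  cases hm with
  | raise hxc hf hg =>
    intro v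
    by_cases hv : v = x
    · subst hv; simp; omega
    · simp [hv, hp]
  | _ => exact hp

theorem ncard_of_true [Finite α] (hm : Move M₁ M₂ I₁ I₂ p x J₁ J₂ q b) (hb : b) (hx₂ : x ∉ I₂) :
    J₂.ncard = I₂.ncard + 1 := by
  cases hm with
  | add hxc => exact ncard_insert_of_notMem hx₂ (toFinite _)
  | _ => exact hb.elim

theorem ncard_le [Finite α] (hm : Move M₁ M₂ I₁ I₂ p x J₁ J₂ q b) (hx₂ : x ∉ I₂) :
    I₂.ncard ≤ J₂.ncard := by
  cases hm with
  | add hxc => exact ncard_le_ncard (subset_insert _ _) (toFinite _)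
  | pushSnd f hf hp hxf =>
    rw [ncard_insert_of_notMem (fun h => hx₂ h.1) (toFinite _),
      ncard_sdiff_singleton_add_one hf (toFinite _)]
  | _ => exact le_rfl

/-- With exact labels a move that does not enlarge `I₂` lowers the level of the unmatched element,
and the labels of smaller level stay exact. -/
theorem exact_pred (hm : Move M₁ M₂ I₁ I₂ p x J₁ J₂ q b) (hb : ¬ b) (h : Valid M₁ M₂ I₁ I₂ p)
    (hx : x ∈ I₁) (hx₂ : x ∉ I₂) (hex : Exact M₁ M₂ I₁ I₂ p (p x))
    (hmin : ∀ y ∈ I₁, y ∉ I₂ → p x ≤ p y) :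
    ∃ y, y ∈ J₁ ∧ y ∉ J₂ ∧ q y + 1 = p x ∧ Exact M₁ M₂ J₁ J₂ q (q y) ∧
      ∀ z ∈ J₁, z ∉ J₂ → q y ≤ q z := by
  cases hm with
  | add hxc => exact (hb trivial).elim
  | pushSnd f hf hp hxf =>
    have hfx : f ≠ x := by rintro rfl; exact hx₂ hf
    refine ⟨f, h.sub hf, by simp [hfx], hp, ?_, ?_⟩
    · intro v hv
      rcases hex v (by omega) with ⟨h1, h2⟩ | h1
      · refine Or.inl ⟨?_, ?_⟩
        · rintro (rfl | h3)
          · omega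
          · exact h1 h3.1
        -- The first alternative of `Exact` depends only on the span of a level set, which this swap
        -- preserves.
        · rwa [h.closure_levelGE_push hx₂ hf hp hxf hv]
      · exact Or.inr h1
    · intro z hz hz2
      by_cases hzf : z = f
      · rw [hzf]
      · have := hmin z hz (fun h3 => hz2 (Or.inr ⟨h3, hzf⟩))
        omega
  | pushFst g hg hp hgx =>
    have hgx' : g ≠ x := by rintro rfl; exact hg hx
    refine ⟨g, Or.inl rfl, fun h1 => hg (h.sub h1), hp, ?_, ?_⟩
    · intro v hv
      rcases hex v (by omega) with h1 | ⟨h1, g', hg', hp', hgv⟩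
      · exact Or.inl h1
      · have hvx : v ≠ x := by rintro rfl; omega
        refine Or.inr ⟨Or.inr ⟨h1, hvx⟩, g', ?_, hp', ?_⟩
        · rintro (rfl | h3)
          · omega
          · exact hg' h3.1
        · intro hc
          apply hgv
          have hbase : M₁.Indep (insert g (I₁ \ {x})) := by
            have := h.base.indep.subset (sdiff_subset (t := {x}))
            refine this.insert_indep_iff.2 (Or.inl ⟨?_, hgx⟩)
            exact M₁.closure_subset_ground _ (h.fst g hg)
          -- The level set spanning `g'` stops at level `p v`, below `p x`; it avoids `x` and
          -- survives in the new base. There it can be intersected with the complement of `v`.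
          have hsub : levelLE I₁ p (p g' + 1) ⊆ insert g (I₁ \ {x}) := by
            rintro y ⟨hy, hy2⟩
            refine Or.inr ⟨hy, ?_⟩
            rintro rfl; omega
          have h3 : g' ∈ M₁.closure
              (levelLE I₁ p (p g' + 1) ∩ (insert g (I₁ \ {x}) \ {v})) := by
            rw [Matroid.Indep.closure_inter_eq_inter_closure]
            · exact ⟨h.fst g' hg', hc⟩
            · exact hbase.subset (union_subset hsub sdiff_subset)
          refine M₁.closure_subset_closure ?_ h3
          rintro y ⟨⟨hy, -⟩, -, hyv⟩
          exact ⟨hy, hyv⟩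
    · rintro z (rfl | hz) hz2
      · exact le_rfl
      · have := hmin z hz.1 hz2
        omega
  | raise hxc hf hg =>
    -- An exact label is never raised: its element is a sink or has a neighbour one level lower.
    exfalso
    rcases hex x le_rfl with ⟨-, h2⟩ | ⟨-, g, -, hp, hgx⟩
    · exact h2 (h.mem_closure_levelGE hx₂ hxc hf)
    · exact hgx (hg g hp)

end Move

/-! ### Memory updates and time-bounded Hoare rules for programs. -/

namespace Store

variable (s : Store) (x y v a b i j : ℕ)

theorem reg_setReg : (s.setReg x v).reg y = if y = x then v else s.reg y := by
  simp [setReg, Function.update_apply]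

theorem arr_setReg : (s.setReg x v).arr = s.arr := rfl

theorem reg_setArr : (s.setArr a i v).reg = s.reg := rfl

theorem arr_setArr : (s.setArr a i v).arr b j = if b = a ∧ j = i then v else s.arr b j := by
  by_cases h : b = a
  · subst h; simp [setArr, Function.update_apply]
  · simp [setArr, h]

theorem mem_set {n : ℕ} {s : Store} {a : ℕ} {v : Fin n} : v ∈ s.set n a ↔ s.arr a v ≠ 0 := Iff.rfl

theorem set_congr {n : ℕ} {s s' : Store} {a : ℕ} (h : s'.arr a = s.arr a) :
    s'.set n a = s.set n a := by
  ext v; rw [mem_set, mem_set, h]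

theorem set_setReg {n : ℕ} : (s.setReg x v).set n a = s.set n a := rfl

end Store

/-- The machine with its two matroids, whose ground set is `{0, …, n - 1}`, and oracle times. -/
structure Machine where
  n : ℕ
  M₁ : Matroid (Fin n)
  M₂ : Matroid (Fin n)
  T₁ : ℕ
  T₂ : ℕ
  ground₁ : M₁.E = univ
  ground₂ : M₂.E = univ
  le : n ≤ T₁ + T₂

namespace Machine

/-- The first matroid for `true`, the second one for `false`. -/
def mat (m : Machine) : Bool → Matroid (Fin m.n)
  | true => m.M₁
  | false => m.M₂

/-- A bound on the time of an oracle call. -/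
def unit (m : Machine) : ℕ := m.T₁ + m.T₂ + 1

theorem ground (m : Machine) (b : Bool) : (m.mat b).E = univ := by
  cases b
  · exact m.ground₂
  · exact m.ground₁

theorem n_lt_unit (m : Machine) : m.n < m.unit := by
  have := m.le
  unfold unit
  omega

end Machine

namespace Program

/-- Whether the program may write register `z`. -/
def writesReg : Program → ℕ → Bool
  | const x _, z => x == z
  | copy x _, z => x == z
  | succ x _, z => x == z
  | sub x _ _, z => x == z
  | load x _ _, z => x == z
  | store _ _ _, _ => false
  | rankFst x _, z => x == z
  | rankSnd x _, z => x == z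
  | seq P Q, z => P.writesReg z || Q.writesReg z
  | ite _ P Q, z => P.writesReg z || Q.writesReg z
  | loop _ P, z => P.writesReg z

/-- Whether the program may write array `z`. -/
def writesArr : Program → ℕ → Bool
  | store a _ _, z => a == z
  | seq P Q, z => P.writesArr z || Q.writesArr z
  | ite _ P Q, z => P.writesArr z || Q.writesArr z
  | loop _ P, z => P.writesArr z
  | _, _ => false

/-- The program has no loop. -/
def straight : Program → Bool
  | seq P Q => P.straight && Q.straight
  | ite _ P Q => P.straight && Q.straight
  | loop _ _ => false
  | _ => true

/-- A time bound for a program without loops, where an oracle call takes time at most `u`. -/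
def cost (u : ℕ) : Program → ℕ
  | seq P Q => P.cost u + Q.cost u
  | ite _ P Q => max (P.cost u) (Q.cost u) + 1
  | rankFst _ _ => u
  | rankSnd _ _ => u
  | _ => 1

/-- The final memory of a program without loops. -/
noncomputable def eval (m : Machine) : Program → Store → Store
  | const x c, s => s.setReg x c
  | copy x y, s => s.setReg x (s.reg y)
  | succ x y, s => s.setReg x (s.reg y + 1)
  | sub x y z, s => s.setReg x (s.reg y - s.reg z)
  | load x a i, s => s.setReg x (s.arr a (s.reg i))
  | store a i x, s => s.setArr a (s.reg i) (s.reg x)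
  | rankFst x a, s => s.setReg x (rank m.M₁ (s.set m.n a))
  | rankSnd x a, s => s.setReg x (rank m.M₂ (s.set m.n a))
  | seq P Q, s => Q.eval m (P.eval m s)
  | ite x P Q, s => if s.reg x ≠ 0 then P.eval m s else Q.eval m s
  -- A default value; it is irrelevant because `straight` excludes loops.
  | loop _ _, s => s

/-- `P` does not touch what differs between `s` and `s'`. -/
def Same (P : Program) (s s' : Store) : Prop :=
  (∀ z, P.writesReg z = false → s'.reg z = s.reg z) ∧
    ∀ z, P.writesArr z = false → s'.arr z = s.arr z

theorem Same.refl (P : Program) (s : Store) : P.Same s s := ⟨fun _ _ => rfl, fun _ _ => rfl⟩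

theorem Same.trans {P : Program} {s₁ s₂ s₃ : Store} (h : P.Same s₁ s₂) (h' : P.Same s₂ s₃) :
    P.Same s₁ s₃ :=
  ⟨fun z hz => (h'.1 z hz).trans (h.1 z hz), fun z hz => (h'.2 z hz).trans (h.2 z hz)⟩

theorem Same.mono {P Q : Program} {s s' : Store} (h : P.Same s s')
    (hr : ∀ z, Q.writesReg z = false → P.writesReg z = false)
    (ha : ∀ z, Q.writesArr z = false → P.writesArr z = false) : Q.Same s s' :=
  ⟨fun z hz => h.1 z (hr z hz), fun z hz => h.2 z (ha z hz)⟩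

end Program

open Program

/-- The frame rule. For concrete programs `writesReg` and `writesArr` compute, so that `rfl` shows
which registers and arrays a run preserves. -/
theorem Runs.same {n : ℕ} {M₁ M₂ : Matroid (Fin n)} {T₁ T₂ : ℕ} {P : Program} {s s' : Store}
    {t : ℕ} (h : Runs M₁ M₂ T₁ T₂ P s s' t) : P.Same s s' := by
  induction h with
  | store s a i x =>
    refine ⟨fun _ _ => rfl, fun z hz => ?_⟩
    have : z ≠ a := by rintro rfl; simp [writesArr] at hz
    simp [Store.setArr, this]
  | seq _ _ ih ih' =>
    exact (ih.mono (by simp +contextual [writesReg]) (by simp +contextual [writesArr])).trans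
      (ih'.mono (by simp +contextual [writesReg]) (by simp +contextual [writesArr]))
  | ite_true _ _ ih => exact ih.mono (by simp +contextual [writesReg]) (by simp +contextual [writesArr])
  | ite_false _ _ ih => exact ih.mono (by simp +contextual [writesReg]) (by simp +contextual [writesArr])
  | loop_true _ _ _ ih ih' =>
    exact (ih.mono (by simp +contextual [writesReg]) (by simp +contextual [writesArr])).trans ih'
  | loop_false _ => exact Same.refl _ _
  | _ =>
    refine ⟨fun z hz => ?_, fun _ _ => rfl⟩
    rw [Store.reg_setReg, if_neg]
    rintro rfl
    simp [writesReg] at hz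

/-- Started in memory `s`, the program halts within time `B` in a memory that satisfies `Φ`. -/
def Halts (m : Machine) (P : Program) (s : Store) (B : ℕ) (Φ : Store → Prop) : Prop :=
  ∃ s' t, Runs m.M₁ m.M₂ m.T₁ m.T₂ P s s' t ∧ t ≤ B ∧ Φ s'

namespace Halts

variable {m : Machine} {P Q : Program} {s : Store} {B B₁ B₂ x : ℕ} {Φ Ψ : Store → Prop}

theorem mono (h : Halts m P s B₁ Ψ) (hΦ : ∀ s', Ψ s' → P.Same s s' → Φ s') (hB : B₁ ≤ B) :
    Halts m P s B Φ := by
  obtain ⟨s', t, hr, ht, hs⟩ := h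
  exact ⟨s', t, hr, ht.trans hB, hΦ s' hs hr.same⟩

theorem seq (h : Halts m P s B₁ Ψ) (h' : ∀ s', Ψ s' → P.Same s s' → Halts m Q s' B₂ Φ)
    (hB : B₁ + B₂ ≤ B) : Halts m (.seq P Q) s B Φ := by
  obtain ⟨s', t, hr, ht, hs⟩ := h
  obtain ⟨s'', t', hr', ht', hs'⟩ := h' s' hs hr.same
  exact ⟨s'', t + t', .seq hr hr', by omega, hs'⟩

theorem ite (h : s.reg x ≠ 0 → Halts m P s B₁ Φ) (h' : s.reg x = 0 → Halts m Q s B₁ Φ)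
    (hB : B₁ + 1 ≤ B) : Halts m (.ite x P Q) s B Φ := by
  by_cases hx : s.reg x = 0
  · obtain ⟨s', t, hr, ht, hs⟩ := h' hx
    exact ⟨s', t + 1, .ite_false hx hr, by omega, hs⟩
  · obtain ⟨s', t, hr, ht, hs⟩ := h hx
    exact ⟨s', t + 1, .ite_true hx hr, by omega, hs⟩

theorem straight (hP : P.straight = true) (hΦ : Φ (P.eval m s)) (hB : P.cost m.unit ≤ B) :
    Halts m P s B Φ := by
  suffices h : ∃ t, Runs m.M₁ m.M₂ m.T₁ m.T₂ P s (P.eval m s) t ∧ t ≤ P.cost m.unit by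
    obtain ⟨t, hr, ht⟩ := h
    exact ⟨_, t, hr, ht.trans hB, hΦ⟩
  clear hΦ hB
  induction P generalizing s with
  | const x c => exact ⟨1, .const _ _ _, le_rfl⟩
  | copy x y => exact ⟨1, .copy _ _ _, le_rfl⟩
  | succ x y => exact ⟨1, .succ _ _ _, le_rfl⟩
  | sub x y z => exact ⟨1, .sub _ _ _ _, le_rfl⟩
  | load x a i => exact ⟨1, .load _ _ _ _, le_rfl⟩
  | store a i x => exact ⟨1, .store _ _ _ _, le_rfl⟩
  | rankFst x a => exact ⟨_, .rankFst _ _ _, by simp [cost, Machine.unit]⟩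
  | rankSnd x a => exact ⟨_, .rankSnd _ _ _, by simp [cost, Machine.unit]⟩
  | seq P Q ihP ihQ =>
    simp only [Program.straight, Bool.and_eq_true] at hP
    obtain ⟨t, hr, ht⟩ := ihP hP.1 (s := s)
    obtain ⟨t', hr', ht'⟩ := ihQ hP.2 (s := P.eval m s)
    exact ⟨t + t', .seq hr hr', Nat.add_le_add ht ht'⟩
  | ite x P Q ihP ihQ =>
    simp only [Program.straight, Bool.and_eq_true] at hP
    by_cases hx : s.reg x = 0
    · obtain ⟨t, hr, ht⟩ := ihQ hP.2 (s := s)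
      refine ⟨t + 1, ?_, by simp only [cost]; omega⟩
      simpa only [eval, hx, ne_eq, not_true, if_false] using Runs.ite_false hx hr
    · obtain ⟨t, hr, ht⟩ := ihP hP.1 (s := s)
      refine ⟨t + 1, ?_, by simp only [cost]; omega⟩
      simpa only [eval, hx, ne_eq, not_false_eq_true, if_true] using Runs.ite_true hx hr
  | loop x P _ => simp [Program.straight] at hP

/-- The index of `Inv` is a variant that bounds the number of remaining rounds. It may drop by more
than one; a body that ends the loop can set it to `0`. -/
theorem loop (Inv : ℕ → Store → Prop)
    (hstep : ∀ k s', Inv k s' → P.Same s s' → s'.reg x ≠ 0 →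
      Halts m P s' B₁ fun s'' => ∃ k' < k, Inv k' s'')
    {k : ℕ} (hinit : Inv k s) (hΦ : ∀ k' s', Inv k' s' → P.Same s s' → s'.reg x = 0 → Φ s')
    (hB : k * (B₁ + 1) + 1 ≤ B) : Halts m (.loop x P) s B Φ := by
  suffices h : ∀ k s', Inv k s' → P.Same s s' → Halts m (.loop x P) s' (k * (B₁ + 1) + 1) Φ from
    (h k s hinit (Same.refl _ _)).mono (fun _ h _ => h) hB
  intro k
  induction k using Nat.strong_induction_on with
  | _ k ih =>
    intro s' hs' hsame
    by_cases hx : s'.reg x = 0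
    · exact ⟨s', 1, .loop_false hx, by omega, hΦ k s' hs' hsame hx⟩
    · obtain ⟨s₁, t₁, hr₁, ht₁, k', hk', hinv⟩ := hstep k s' hs' hsame hx
      obtain ⟨s₂, t₂, hr₂, ht₂, h₂⟩ := ih k' hk' s₁ hinv (hsame.trans hr₁.same)
      refine ⟨s₂, t₁ + t₂ + 1, .loop_true hx hr₁ hr₂, ?_, h₂⟩
      have : (k' + 1) * (B₁ + 1) ≤ k * (B₁ + 1) := Nat.mul_le_mul_right _ hk'
      rw [Nat.add_mul] at this
      omega

end Halts

namespace Program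

/-- Execute a list of programs one after the other. -/
def block : List Program → Program
  | [] => .copy 30 30
  | [P] => P
  | P :: Q :: l => .seq P (block (Q :: l))

/-- Do nothing. -/
def skip : Program := .copy 30 30

/-- `for i in {0, …, n - 1}: P`, where `n` is stored in register `0`. -/
def forRange (i c : ℕ) (P : Program) : Program :=
  .seq (block [.const i 0, .copy c 0]) (.loop c (.seq P (block [.succ i i, .sub c 0 i])))

end Program

/-- The counters change after the body has run. Hence the invariant is required for arbitrary values
in registers `i` and `c`, which makes it independent of them. -/
theorem Halts.forRange {m : Machine} {P : Program} {s : Store} {B B₁ i c : ℕ} {Φ : Store → Prop}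
    (Inv : ℕ → Store → Prop) (hn : s.reg 0 = m.n) (hi : i ≠ 0) (hc : c ≠ 0) (hic : i ≠ c)
    (hP0 : P.writesReg 0 = false) (hPi : P.writesReg i = false)
    (hinit : ∀ k k', Inv 0 ((s.setReg i k).setReg c k'))
    (hstep : ∀ k s', k < m.n → Inv k s' → s'.reg i = k → s'.reg 0 = m.n →
      (Program.forRange i c P).Same s s' →
      Halts m P s' B₁ fun s'' => ∀ k' k'', Inv (k + 1) ((s''.setReg i k').setReg c k''))
    (hΦ : ∀ s', Inv m.n s' → (Program.forRange i c P).Same s s' → Φ s')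
    (hB : m.n * (B₁ + 3) + 3 ≤ B) : Halts m (Program.forRange i c P) s B Φ := by
  unfold Program.forRange
  refine Halts.seq (Ψ := fun s' => s' = (s.setReg i 0).setReg c m.n) (B₁ := 2)
    (B₂ := m.n * (B₁ + 3) + 1) (Halts.straight rfl ?_ le_rfl) ?_ (by omega)
  · simp [block, eval, Store.reg_setReg, hi.symm, hn]
  rintro s₁ rfl -
  set s₁ := (s.setReg i 0).setReg c m.n
  have hsub : ∀ s', (Program.seq P (block [.succ i i, .sub c 0 i])).Same s₁ s' →
      (Program.forRange i c P).Same s s' := by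
    refine fun s' h => Same.trans (s₂ := s₁) ?_ (h.mono ?_ ?_)
    · refine ⟨fun z hz => ?_, fun z hz => rfl⟩
      simp only [writesReg, Program.forRange, block, Bool.or_eq_false_iff,
        beq_eq_false_iff_ne] at hz
      simp [s₁, Store.reg_setReg, hz.1.1.symm, hz.1.2.symm]
    · simp only [writesReg, Program.forRange, block, Bool.or_eq_false_iff]; tauto
    · simp only [writesArr, Program.forRange, block, Bool.or_eq_false_iff]; tauto
  refine Halts.loop (B₁ := B₁ + 2) (k := m.n) (fun k s' => k ≤ m.n ∧ Inv (m.n - k) s' ∧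
    s'.reg i = m.n - k ∧ s'.reg c = k) ?_ ?_ ?_ le_rfl
  · rintro k s' ⟨hk, hinv, hri, hrc⟩ hsame hne
    have h0 : s'.reg 0 = m.n := by
      rw [hsame.1 0 (by simp [writesReg, block, hP0, hi, hc])]
      simp [s₁, Store.reg_setReg, hi.symm, hc.symm, hn]
    refine Halts.seq (hstep (m.n - k) s' (by omega) hinv hri h0 (hsub s' hsame)) ?_ le_rfl
    intro s₂ h₂ hs₂
    refine Halts.straight rfl ?_ le_rfl
    have e0 : s₂.reg 0 = m.n := by rw [hs₂.1 0 hP0, h0]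
    have ei : s₂.reg i = m.n - k := by rw [hs₂.1 i hPi, hri]
    refine ⟨k - 1, by omega, by omega, ?_, ?_, ?_⟩
    · have : m.n - (k - 1) = m.n - k + 1 := by omega
      rw [this]
      simpa [block, eval] using h₂ _ _
    · simp [block, eval, Store.reg_setReg, ei, hic]; omega
    · simp [block, eval, Store.reg_setReg, ei, e0, hi.symm]; omega
  · refine ⟨le_rfl, by simpa using hinit _ _, ?_, ?_⟩ <;> simp [s₁, Store.reg_setReg, hic]
  · rintro k s' ⟨hk, hinv, hri, hrc⟩ hsame h0
    rw [h0] at hrc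
    subst hrc
    exact hΦ s' (by simpa using hinv) (hsub s' hsame)

/-! ### Binary search for an exchange partner. -/

/-- `M.Exch I x v`: the element `v` can replace `x` in `I`, or conversely, whichever of the two
belongs to `I`. -/
def Exch {α : Type*} (M : Matroid α) (I : Set α) (x v : α) : Prop :=
  (x ∈ I ∧ v ∉ M.closure (I \ {x})) ∨ (x ∉ I ∧ x ∉ M.closure (I \ {v}))

namespace Store

theorem set_setArr_insert {n : ℕ} (s : Store) (a : ℕ) (v : Fin n) {w : ℕ} (hw : w ≠ 0) :
    (s.setArr a v w).set n a = insert v (s.set n a) := by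
  ext u
  simp only [mem_set, arr_setArr, true_and, mem_insert_iff, Fin.ext_iff]
  split_ifs with h <;> simp [h, hw]

theorem set_setArr_diff {n : ℕ} (s : Store) (a : ℕ) (v : Fin n) :
    (s.setArr a v 0).set n a = s.set n a \ {v} := by
  ext u
  simp only [mem_set, arr_setArr, true_and, mem_sdiff, mem_singleton_iff, Fin.ext_iff]
  split_ifs with h <;> simp [h]

theorem set_setArr_of_ne {n : ℕ} (s : Store) {a b : ℕ} (h : b ≠ a) (i w : ℕ) :
    (s.setArr a i w).set n b = s.set n b := by
  ext u
  simp [mem_set, arr_setArr, h]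

theorem setArr_setArr_self (s : Store) (a i v w : ℕ) (h : s.arr a i = w) :
    ((s.setArr a i v).setArr a i w).arr = s.arr := by
  funext b j
  simp only [arr_setArr]
  split_ifs with h1
  · rw [h1.1, h1.2, h]
  · rfl

end Store

namespace Program

/-- Query the first oracle for `true`, the second one for `false`. -/
def oracle (b : Bool) (x a : ℕ) : Program := match b with
  | true => .rankFst x a
  | false => .rankSnd x a

theorem eval_oracle (m : Machine) (b : Bool) (x a : ℕ) (s : Store) :
    (oracle b x a).eval m s = s.setReg x (rank (m.mat b) (s.set m.n a)) := by
  cases b <;> rfl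

/-- Register `o` receives the gain of rank when the element in register `x` is added to array `a`. -/
def gain (b : Bool) (a x o : ℕ) : Program :=
  block [oracle b 13 a, .const 14 1, .store a x 14, oracle b 15 a, .const 14 0, .store a x 14,
    .sub o 15 13]

end Program

theorem halts_gain (m : Machine) (b : Bool) {a x o : ℕ} {s : Store} (v : Fin m.n)
    (hv : s.reg x = v) (ha : s.arr a v = 0) (hx : x ≠ 13) (hx' : x ≠ 14) (hx'' : x ≠ 15) :
    Halts m (gain b a x o) s (2 * m.unit + 5) fun s' => s'.arr = s.arr ∧
      (s'.reg o ≠ 0 ↔ v ∉ (m.mat b).closure (s.set m.n a)) := by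
  classical
  refine Halts.straight (by cases b <;> rfl) ?_ (by cases b <;> simp [gain, block, oracle, cost] <;> omega)
  simp only [gain, block, eval, eval_oracle]
  constructor
  · simp only [Store.arr_setReg, Store.reg_setArr, Store.reg_setReg, hx, hx', hx'', if_false, hv]
    simp only [if_true]
    exact Store.setArr_setArr_self s a v 1 0 ha
  · have h1 := rank_insert (m.mat b) (m.ground b) (s.set m.n a) v
    simp [Store.reg_setReg, Store.reg_setArr, hx, hx', hx'', hv, Store.set_setReg,
      Store.set_setArr_insert, h1]

namespace Program

/-- The array that holds the independent set of the first or second matroid. -/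
def idx : Bool → ℕ
  | true => 1
  | false => 0


/-- Cell `i` of the query set, for `i` in register `11`. -/
def queryCell (b : Bool) : Program :=
  block [.load 13 (idx b) 11, .load 14 2 11, .succ 14 14, .sub 15 14 19, .sub 18 19 14,
    .ite 15 skip (.ite 18 skip (block [.sub 15 10 11, .ite 15 (.copy 13 17) skip])),
    .store 4 11 13]

/-- Test whether the element `x` in register `4` can be exchanged with an element that lies below
register `10` and whose level plus one is in register `19`. The answer goes to register `16`. -/
def testPrefix (b : Bool) : Program :=
  .seq (.load 17 (idx b) 4) (.seq (forRange 11 12 (queryCell b))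
    (.seq (block [.const 13 0, .store 4 4 13]) (.seq (gain b 4 4 16)
      (.ite 17 (block [.const 13 1, .sub 16 13 16]) skip))))

/-- One round of the binary search between registers `8` and `9`. -/
def findRound (b : Bool) : Program :=
  .seq (block [.copy 10 8, .copy 21 20, .const 13 2])
    (.seq (.loop 21 (block [.succ 10 10, .sub 21 21 13]))
      (.seq (testPrefix b)
        (block [.ite 16 (.copy 9 10) (.copy 8 10), .const 13 1, .sub 20 9 8, .sub 20 20 13])))

/-- Search for an element that can be exchanged with the element in register `4` and whose level
plus one is in register `19`. The answer goes to register `5`; it is `n` if there is none. -/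
def find (b : Bool) : Program :=
  .seq (block [.const 8 0, .succ 9 0, .copy 20 0]) (.seq (.loop 20 (findRound b)) (.copy 5 8))

end Program

/-- The conditions under which an exchange partner of `x` can be sought among the elements of `A`. -/
structure CanSearch {α : Type*} (M : Matroid α) (I A : Set α) (x : α) : Prop where
  indep : M.Indep I
  mem : x ∈ M.closure I
  sub : x ∈ I → A ⊆ M.closure I
  notMem : x ∉ A

theorem CanSearch.mono {α : Type*} {M : Matroid α} {I A A' : Set α} {x : α}
    (h : CanSearch M I A x) (hA : A' ⊆ A) : CanSearch M I A' x :=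
  ⟨h.indep, h.mem, fun hx => hA.trans (h.sub hx), fun hx => h.notMem (hA hx)⟩

/-- The elements below `k` whose level plus one is `l`. -/
def levelBelow {n : ℕ} (p : ℕ → ℕ) (l k : ℕ) : Set (Fin n) := {v | (v : ℕ) < k ∧ p v + 1 = l}

/-- Each candidate cell of the query receives the membership bit of `x` itself. So the query is `I ∪
A` if `x ∈ I` and `I \ A` otherwise, and after erasing `x` one gain of rank decides both cases. -/
theorem halts_testPrefix (m : Machine) (b : Bool) {s : Store} (hn : s.reg 0 = m.n) (x : Fin m.n)
    (hx : s.reg 4 = x)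
    (hs : CanSearch (m.mat b) (s.set m.n (idx b)) (levelBelow (s.arr 2) (s.reg 19) (s.reg 10)) x) :
    Halts m (testPrefix b) s (25 * m.unit) fun s' => s'.reg 16 ≠ 0 ↔
      ∃ v ∈ levelBelow (s.arr 2) (s.reg 19) (s.reg 10),
        Exch (m.mat b) (s.set m.n (idx b)) x v := by
  have hU := m.n_lt_unit
  refine Halts.seq (B₁ := 1) (B₂ := 25 * m.unit - 1)
    (Ψ := fun s' => s'.arr = s.arr ∧ s'.reg 17 = s.arr (idx b) x) (Halts.straight rfl ?_ le_rfl) ?_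
    (by omega)
  · simp [eval, Store.arr_setReg, Store.reg_setReg, hx]
  rintro s₁ ⟨h₁a, h₁r⟩ hs₁
  refine Halts.seq (B₁ := m.n * (17 + 3) + 3) (B₂ := 2 * m.unit + 10) (Ψ := fun s' => ∀ i < m.n,
    s'.arr 4 i = if i < s.reg 10 ∧ s.arr 2 i + 1 = s.reg 19 then s.arr (idx b) x
      else s.arr (idx b) i) ?_ ?_ (by omega)
  · refine Halts.forRange (B₁ := 17) (fun k s' => ∀ i < k,
      s'.arr 4 i = if i < s.reg 10 ∧ s.arr 2 i + 1 = s.reg 19 then s.arr (idx b) x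
        else s.arr (idx b) i) (by rw [hs₁.1 0 rfl, hn]) (by norm_num) (by norm_num) (by norm_num)
      rfl rfl (by simp) ?_ (fun s' h _ => h) le_rfl
    intro k s' hk hinv hri hr0 hsame
    refine Halts.straight (by cases b <;> rfl) ?_ (by simp [queryCell, block, skip, cost])
    intro _ _
    simp only [Store.arr_setReg]
    have e10 : s'.reg 10 = s.reg 10 := by rw [hsame.1 10 rfl, hs₁.1 10 rfl]
    have e19 : s'.reg 19 = s.reg 19 := by rw [hsame.1 19 rfl, hs₁.1 19 rfl]
    have e17 : s'.reg 17 = s.arr (idx b) x := by rw [hsame.1 17 rfl, h₁r]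
    have a2 : s'.arr 2 = s.arr 2 := by rw [hsame.2 2 rfl, h₁a]
    have aI : s'.arr (idx b) = s.arr (idx b) := by rw [hsame.2 (idx b) (by cases b <;> rfl), h₁a]
    -- Two truncated subtractions vanish together exactly when the level plus one equals the number
    -- sought.
    have key : ((queryCell b).eval m s').arr 4 = Function.update (s'.arr 4) k
        (if k < s.reg 10 ∧ s.arr 2 k + 1 = s.reg 19 then s.arr (idx b) x else s.arr (idx b) k) := by
      funext j
      by_cases h1 : s.arr 2 k + 1 - s.reg 19 = 0 <;> by_cases h2 : s.reg 19 - (s.arr 2 k + 1) = 0 <;>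
        by_cases h3 : s.reg 10 - k = 0 <;>
        simp [queryCell, block, skip, eval, Store.reg_setReg, Store.arr_setReg, Store.arr_setArr,
          Function.update_apply, h1, h2, h3, e10, e19, e17, a2, aI, hri] <;>
        congr 1 <;> rw [eq_comm] <;> first | rw [if_neg (by omega)] | rw [if_pos (by omega)]
    intro i hi
    rw [key, Function.update_apply]
    by_cases h : i = k
    · rw [if_pos h, h]
    · rw [if_neg h, hinv i (by omega)]
  intro s₂ hW hs₂
  have e4 : s₂.reg 4 = x := by rw [hs₂.1 4 rfl, hs₁.1 4 rfl, hx]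
  have e17 : s₂.reg 17 = s.arr (idx b) x := by rw [hs₂.1 17 rfl, h₁r]
  refine Halts.seq (B₁ := 2) (B₂ := 2 * m.unit + 8)
    (Ψ := fun s' => s'.arr 4 x = 0 ∧ s'.set m.n 4 = s₂.set m.n 4 \ {x}) (Halts.straight rfl ?_ le_rfl)
    ?_ (by omega)
  · constructor
    · simp [block, eval, Store.reg_setReg, Store.arr_setArr, e4]
    · simp [block, eval, Store.reg_setReg, e4, Store.set_setArr_diff, Store.set_setReg]
  rintro s₃ ⟨h₃x, h₃W⟩ hs₃
  refine Halts.seq (B₂ := 3) (halts_gain m b (a := 4) (x := 4) (o := 16) x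
    (by rw [hs₃.1 4 rfl, e4]) h₃x (by norm_num) (by norm_num) (by norm_num)) ?_ (by omega)
  rintro s₄ ⟨-, h₄⟩ hs₄
  have e17' : s₄.reg 17 = s.arr (idx b) x := by
    rw [hs₄.1 17 (by cases b <;> rfl), hs₃.1 17 rfl, e17]
  rw [h₃W] at h₄
  refine Halts.straight rfl ?_ le_rfl
  set I := s.set m.n (idx b) with hI
  set A : Set (Fin m.n) := levelBelow (s.arr 2) (s.reg 19) (s.reg 10) with hA
  by_cases hxI : x ∈ I
  · have hD : s₂.set m.n 4 \ {x} = (I ∪ A) \ {x} := by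
      ext v
      simp only [mem_sdiff, Store.mem_set, mem_union, hI, hA, levelBelow, mem_ofPred_eq]
      rw [hW v v.2]
      rw [hI, Store.mem_set] at hxI
      split_ifs with h
      · simp [h, hxI]
      · simp [h]
    rw [hD, mem_closure_union_diff_iff hs.indep hxI (hs.sub hxI) hs.notMem] at h₄
    -- For `x ∈ I` a partner exists when the gain is zero, so the program negates the answer.
    have hne : s₄.reg 17 ≠ 0 := by rw [e17']; exact hxI
    simp only [Exch, hxI, true_and, not_true, false_and, or_false]
    rw [← not_iff_not, not_not, ← h₄]
    simp [eval, block, hne, Store.reg_setReg]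
    omega
  · have hD : s₂.set m.n 4 \ {x} = I \ A := by
      ext v
      simp only [mem_sdiff, Store.mem_set, hI, hA, levelBelow, mem_ofPred_eq, mem_singleton_iff]
      rw [hW v v.2]
      rw [hI, Store.mem_set, not_not] at hxI
      split_ifs with h
      · simp [h, hxI]
      · simp only [h, not_false_eq_true, and_true, and_iff_left_iff_imp]
        rintro h' rfl
        exact h' hxI
    rw [hD, notMem_closure_diff_iff hs.indep hs.mem] at h₄
    have hne : s₄.reg 17 = 0 := by rw [e17']; exact not_not.1 hxI
    simp only [Exch, hxI, true_and, not_false_eq_true, false_and, false_or]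
    rw [← h₄]
    simp [eval, skip, hne, Store.reg_setReg]

theorem levelBelow_succ_subset {n : ℕ} {p : ℕ → ℕ} {l k : ℕ} {v : Fin n}
    (hv : v ∈ levelBelow p l (k + 1)) : v ∈ levelBelow p l k ∨ (v : ℕ) = k := by
  rcases hv with ⟨h1, h2⟩
  rcases Nat.lt_succ_iff_lt_or_eq.1 h1 with h | h
  · exact Or.inl ⟨h, h2⟩
  · exact Or.inr h

/-- The number of rounds of a binary search, and one more. -/
def Machine.log (m : Machine) : ℕ := Nat.log 2 m.n + 2

/-- Some exchange partner of `x` with level plus one equal to `l` lies below `k`. -/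
def HasPartner {n : ℕ} (M : Matroid (Fin n)) (I : Set (Fin n)) (x : Fin n) (p : ℕ → ℕ) (l k : ℕ) :
    Prop :=
  ∃ v ∈ levelBelow p l k, Exch M I x v

theorem halts_findRound (m : Machine) (b : Bool) {s : Store} (hn : s.reg 0 = m.n) (x : Fin m.n)
    (hx : s.reg 4 = x) (h9 : s.reg 9 ≤ m.n + 1) (h20 : s.reg 20 = s.reg 9 - s.reg 8 - 1)
    (hpos : s.reg 20 ≠ 0)
    (hs : CanSearch (m.mat b) (s.set m.n (idx b)) {v | s.arr 2 v + 1 = s.reg 19} x)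
    {Good : ℕ → Prop}
    (hGood : Good = HasPartner (m.mat b) (s.set m.n (idx b)) x (s.arr 2) (s.reg 19)) :
    Halts m (findRound b) s (38 * m.unit) fun s' => ∃ k, s.reg 8 < k ∧ k < s.reg 9 ∧
      s'.reg 20 ≤ s.reg 20 / 2 ∧ s'.reg 20 = s'.reg 9 - s'.reg 8 - 1 ∧
      ((Good k ∧ s'.reg 8 = s.reg 8 ∧ s'.reg 9 = k) ∨
        (¬ Good k ∧ s'.reg 8 = k ∧ s'.reg 9 = s.reg 9)) := by
  subst hGood
  have hU := m.n_lt_unit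
  refine Halts.seq (B₁ := 3) (B₂ := 38 * m.unit - 3) (Ψ := fun s' => s'.reg 10 = s.reg 8 ∧
    s'.reg 21 = s.reg 20 ∧ s'.reg 13 = 2 ∧ s'.arr = s.arr) (Halts.straight rfl ?_ le_rfl) ?_
    (by omega)
  · simp [block, eval, Store.reg_setReg, Store.arr_setReg]
  rintro s₁ ⟨h10, h21, h13, ha⟩ hs₁
  refine Halts.seq (B₁ := m.n * 3 + 1) (B₂ := 30 * m.unit)
    (Ψ := fun s' => s'.reg 10 = s.reg 8 + (s.reg 20 + 1) / 2) ?_ ?_ (by omega)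
  -- Half of the gap is computed by subtracting `2` repeatedly; these `O(n)` steps cost no more than
  -- an oracle call, up to a constant.
  · refine Halts.loop (B₁ := 2) (k := (s.reg 20 + 1) / 2) (fun k s' => (s'.reg 21 + 1) / 2 = k ∧
      s'.reg 10 + k = s.reg 8 + (s.reg 20 + 1) / 2) ?_ ?_ ?_ ?_
    · rintro k s' ⟨h1, h2⟩ hsame hne
      refine Halts.straight rfl ?_ le_rfl
      have e13 : s'.reg 13 = 2 := by rw [hsame.1 13 rfl, h13]
      refine ⟨k - 1, by omega, ?_, ?_⟩ <;> simp [block, eval, Store.reg_setReg, e13] <;> omega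
    · rw [h21, h10]; simp
    · rintro k s' ⟨h1, h2⟩ - h0
      rw [h0] at h1
      omega
    · have : (s.reg 20 + 1) / 2 ≤ m.n := by omega
      omega
  intro s₂ h₂ hs₂
  have e4 : s₂.reg 4 = x := by rw [hs₂.1 4 rfl, hs₁.1 4 rfl, hx]
  have e19 : s₂.reg 19 = s.reg 19 := by rw [hs₂.1 19 rfl, hs₁.1 19 rfl]
  have e8 : s₂.reg 8 = s.reg 8 := by rw [hs₂.1 8 rfl, hs₁.1 8 rfl]
  have e9 : s₂.reg 9 = s.reg 9 := by rw [hs₂.1 9 rfl, hs₁.1 9 rfl]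
  have ea : ∀ a, s₂.arr a = s.arr a := fun a => by rw [hs₂.2 a rfl, ha]
  have eI : s₂.set m.n (idx b) = s.set m.n (idx b) := Store.set_congr (ea _)
  refine Halts.seq (B₂ := 5) (halts_testPrefix m b (s := s₂) ?_ x e4 ?_) ?_ (by omega)
  · rw [hs₂.1 0 rfl, hs₁.1 0 rfl, hn]
  · rw [eI, ea, e19]
    exact hs.mono fun v hv => hv.2
  intro s₃ h₃ hs₃
  rw [eI, ea, e19, h₂] at h₃
  have f8 : s₃.reg 8 = s.reg 8 := by rw [hs₃.1 8 (by cases b <;> rfl), e8]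
  have f9 : s₃.reg 9 = s.reg 9 := by rw [hs₃.1 9 (by cases b <;> rfl), e9]
  have f10 : s₃.reg 10 = s.reg 8 + (s.reg 20 + 1) / 2 := by rw [hs₃.1 10 (by cases b <;> rfl), h₂]
  refine Halts.straight rfl ⟨s.reg 8 + (s.reg 20 + 1) / 2, by omega, by omega, ?_⟩ le_rfl
  by_cases h16 : s₃.reg 16 = 0
  · have hG : ¬ HasPartner (m.mat b) (s.set m.n (idx b)) x (s.arr 2) (s.reg 19)
        (s.reg 8 + (s.reg 20 + 1) / 2) := fun h => h₃.2 h h16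
    simp [block, eval, Store.reg_setReg, h16, hG, f9, f10]
    omega
  · have hG := h₃.1 h16
    change HasPartner (m.mat b) (s.set m.n (idx b)) x (s.arr 2) (s.reg 19)
        (s.reg 8 + (s.reg 20 + 1) / 2) at hG
    simp [block, eval, Store.reg_setReg, h16, hG, f8, f10]
    omega

theorem halts_find (m : Machine) (b : Bool) {s : Store} (hn : s.reg 0 = m.n) (x : Fin m.n)
    (hx : s.reg 4 = x)
    (hs : CanSearch (m.mat b) (s.set m.n (idx b)) {v | s.arr 2 v + 1 = s.reg 19} x) :
    Halts m (find b) s (40 * m.unit * m.log) fun s' =>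
      (s'.reg 5 = m.n ∧ ∀ v : Fin m.n, s.arr 2 v + 1 = s.reg 19 →
        ¬ Exch (m.mat b) (s.set m.n (idx b)) x v) ∨
      ∃ v : Fin m.n, s'.reg 5 = v ∧ s.arr 2 v + 1 = s.reg 19 ∧
        Exch (m.mat b) (s.set m.n (idx b)) x v := by
  have hU := m.n_lt_unit
  obtain ⟨Good, hGood⟩ : ∃ Good, Good =
    HasPartner (m.mat b) (s.set m.n (idx b)) x (s.arr 2) (s.reg 19) := ⟨_, rfl⟩
  refine Halts.seq (B₁ := 3) (B₂ := (Nat.log 2 m.n + 1) * (38 * m.unit + 1) + 2)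
    (Ψ := fun s' => s'.reg 8 = 0 ∧ s'.reg 9 = m.n + 1 ∧ s'.reg 20 = m.n ∧ s'.arr = s.arr)
    (Halts.straight rfl ?_ le_rfl) ?_ ?_
  · simp [block, eval, Store.reg_setReg, Store.arr_setReg, hn]
  · rintro s₁ ⟨h8, h9, h20, ha⟩ hs₁
    refine Halts.seq (B₁ := (Nat.log 2 m.n + 1) * (38 * m.unit + 1) + 1) (B₂ := 1)
      (Ψ := fun s' => (s'.reg 8 = m.n ∨ Good (s'.reg 8 + 1)) ∧ ¬ Good (s'.reg 8)) ?_ ?_ le_rfl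
    -- No partner lies below the lower end, and one lies below the upper end unless that is still
    -- the sentinel `n + 1`. The gap between them is below `2 ^ k`.
    · refine Halts.loop (k := Nat.log 2 m.n + 1) (B₁ := 38 * m.unit) (fun k s' => s'.reg 8 < s'.reg 9 ∧
        s'.reg 9 ≤ m.n + 1 ∧ s'.reg 20 = s'.reg 9 - s'.reg 8 - 1 ∧ s'.reg 20 < 2 ^ k ∧
        ¬ Good (s'.reg 8) ∧ (s'.reg 9 = m.n + 1 ∨ Good (s'.reg 9))) ?_ ?_ ?_ le_rfl
      · rintro k s' ⟨i1, i2, i3, i4, i5, i6⟩ hsame hne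
        have e19 : s'.reg 19 = s.reg 19 := by
          rw [hsame.1 19 (by cases b <;> rfl), hs₁.1 19 (by cases b <;> rfl)]
        have e2 : s'.arr 2 = s.arr 2 := by rw [hsame.2 2 (by cases b <;> rfl), ha]
        have eI : s'.set m.n (idx b) = s.set m.n (idx b) :=
          Store.set_congr (by rw [hsame.2 (idx b) (by cases b <;> rfl), ha])
        refine (halts_findRound m b (s := s') ?_ x ?_ i2 i3 hne ?_ (Good := Good) ?_).mono ?_ le_rfl
        · rw [hsame.1 0 (by cases b <;> rfl), hs₁.1 0 rfl, hn]
        · rw [hsame.1 4 (by cases b <;> rfl), hs₁.1 4 rfl, hx]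
        · rwa [eI, e2, e19]
        · rw [eI, e2, e19, hGood]
        · rintro s'' ⟨j, j1, j2, j3, j4, j5⟩ -
          have hk : k ≠ 0 := by rintro rfl; simp at i4; omega
          obtain ⟨k, rfl⟩ := Nat.exists_eq_succ_of_ne_zero hk
          have hlt : s''.reg 20 < 2 ^ k := by rw [Nat.pow_succ] at i4; omega
          refine ⟨k, by omega, ?_⟩
          rcases j5 with ⟨g, r8, r9⟩ | ⟨g, r8, r9⟩
          · exact ⟨by omega, by omega, j4, hlt, by rwa [r8], Or.inr (by rwa [r9])⟩
          · exact ⟨by omega, by omega, j4, hlt, by rwa [r8], by rwa [r9]⟩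
      · refine ⟨by omega, by omega, by omega, ?_, ?_, Or.inl h9⟩
        · rw [h20]; exact Nat.lt_pow_succ_log_self (by norm_num) _
        · rw [h8, hGood]
          rintro ⟨v, hv, -⟩
          exact absurd hv.1 (by omega)
      · rintro k s' ⟨i1, i2, i3, i4, i5, i6⟩ - h0
        have : s'.reg 9 = s'.reg 8 + 1 := by omega
        rw [this] at i6
        exact ⟨i6.imp_left (by omega), i5⟩
    · rintro s₂ ⟨h1, h2⟩ -
      refine Halts.straight rfl ?_ le_rfl
      have e5 : (Program.eval m (.copy 5 8) s₂).reg 5 = s₂.reg 8 := by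
        simp [eval, Store.reg_setReg]
      rw [e5]
      rw [hGood] at h1 h2
      rcases h1 with h1 | h1
      · refine Or.inl ⟨h1, fun v hv hex => h2 ⟨v, ⟨?_, hv⟩, hex⟩⟩
        rw [h1]; exact v.2
      · obtain ⟨v, hv, hex⟩ := h1
        rcases levelBelow_succ_subset hv with h | h
        · exact absurd ⟨v, h, hex⟩ h2
        · exact Or.inr ⟨v, h.symm, hv.2, hex⟩
  · unfold Machine.log
    nlinarith [Nat.zero_le (Nat.log 2 m.n), Nat.zero_le m.n]

/-! ### Selecting an unmatched element and moving. -/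

namespace Program

/-- Update of the minimum in `select`. -/
def selectCell (a a' : ℕ) : Program :=
  block [.load 13 a 11, .load 14 a' 11, .load 15 2 11, .sub 16 18 15,
    .ite 13 (.ite 14 skip (.ite 16 (block [.copy 18 15, .copy 4 11]) skip)) skip]

/-- Register `4` receives an element of least level among those in array `a` and not in array `a'`
whose level is below the bound in register `3`; it is `n` if there is none. -/
def select (a a' : ℕ) : Program :=
  .seq (block [.copy 18 3, .copy 4 0]) (forRange 11 12 (selectCell a a'))

/-- A move at the element in register `4`. Register `7` tells whether `I₂` has not grown. -/
def move : Program :=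
  .seq (gain false 0 4 16) (.ite 16 (block [.const 7 0, .const 13 1, .store 0 4 13])
    (.seq (block [.const 7 1, .load 19 2 4]) (.seq (find false) (.seq (.sub 20 0 5)
      (.ite 20 (block [.const 13 0, .store 0 5 13, .const 13 1, .store 0 4 13])
        (.seq (find true) (.seq (.sub 20 0 5)
          (.ite 20 (block [.const 13 0, .store 1 4 13, .const 13 1, .store 1 5 13])
            (block [.load 13 2 4, .succ 13 13, .store 2 4 13])))))))))

/-- A move at an unmatched element of least level, if there is one below the bound in register `3`.
Register `6` tells whether there is one, and register `7` whether the move has not enlarged `I₂`. -/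
def step : Program :=
  .seq (select 1 0) (.seq (block [.sub 6 0 4, .const 7 0]) (.ite 6 move skip))

end Program

theorem halts_select (m : Machine) {a a' : ℕ} {s : Store} (hn : s.reg 0 = m.n) :
    Halts m (select a a') s (16 * m.unit) fun s' =>
      (s'.reg 4 = m.n ∧ ∀ v ∈ s.set m.n a, v ∉ s.set m.n a' → s.reg 3 ≤ s.arr 2 v) ∨
      ∃ x : Fin m.n, s'.reg 4 = x ∧ x ∈ s.set m.n a ∧ x ∉ s.set m.n a' ∧ s.arr 2 x < s.reg 3 ∧
        ∀ v ∈ s.set m.n a, v ∉ s.set m.n a' → s.arr 2 x ≤ s.arr 2 v := by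
  have hU := m.n_lt_unit
  refine Halts.seq (B₁ := 2) (B₂ := m.n * (10 + 3) + 3)
    (Ψ := fun s' => s'.arr = s.arr ∧ s'.reg 18 = s.reg 3 ∧ s'.reg 4 = m.n)
    (Halts.straight rfl ?_ le_rfl) ?_ (by omega)
  · simp [block, eval, Store.arr_setReg, Store.reg_setReg, hn]
  rintro s₁ ⟨ha, h18, h4⟩ hs₁
  refine Halts.forRange (B₁ := 10) (fun k s' =>
      (s'.reg 4 = m.n ∧ s'.reg 18 = s.reg 3 ∧
        ∀ v < k, s.arr a v ≠ 0 → s.arr a' v = 0 → s.reg 3 ≤ s.arr 2 v) ∨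
      ∃ x < k, s'.reg 4 = x ∧ s'.reg 18 = s.arr 2 x ∧ s.arr a x ≠ 0 ∧ s.arr a' x = 0 ∧
        s.arr 2 x < s.reg 3 ∧ ∀ v < k, s.arr a v ≠ 0 → s.arr a' v = 0 → s.arr 2 x ≤ s.arr 2 v)
    (by rw [hs₁.1 0 rfl, hn]) (by norm_num) (by norm_num) (by norm_num) rfl rfl ?_ ?_ ?_ le_rfl
  · intro k k'
    simp [Store.reg_setReg, h18, h4]
  · intro k s' hk hinv hri hr0 hsame
    refine Halts.straight rfl ?_ (by simp [selectCell, block, skip, cost])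
    intro _ _
    have ea : s'.arr = s.arr := by
      funext b
      rw [hsame.2 b rfl, ha]
    have key : (((selectCell a a').eval m s').reg 4 = s'.reg 4 ∧
          ((selectCell a a').eval m s').reg 18 = s'.reg 18 ∧
          (s.arr a k ≠ 0 → s.arr a' k = 0 → s'.reg 18 ≤ s.arr 2 k)) ∨
        (((selectCell a a').eval m s').reg 4 = k ∧
          ((selectCell a a').eval m s').reg 18 = s.arr 2 k ∧
          s.arr a k ≠ 0 ∧ s.arr a' k = 0 ∧ s.arr 2 k < s'.reg 18) := by
      by_cases h1 : s.arr a k = 0 <;> by_cases h2 : s.arr a' k = 0 <;>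
        by_cases h3 : s'.reg 18 - s.arr 2 k = 0 <;>
        simp [selectCell, block, skip, eval, Store.reg_setReg, Store.arr_setReg, h1, h2, h3, ea,
          hri] <;> omega
    simp only [Store.reg_setReg, show ¬ (4 = 12) by norm_num, show ¬ (4 = 11) by norm_num,
      show ¬ (18 = 12) by norm_num, show ¬ (18 = 11) by norm_num, if_false]
    rcases key with ⟨e4, e18, hk'⟩ | ⟨e4, e18, k1, k2, k3⟩
    · rw [e4, e18]
      rcases hinv with ⟨i1, i2, i3⟩ | ⟨x, hx, i1, i2, i3, i4, i5, i6⟩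
      · refine Or.inl ⟨i1, i2, fun v hv v1 v2 => ?_⟩
        rcases Nat.lt_succ_iff_lt_or_eq.1 hv with h | rfl
        · exact i3 v h v1 v2
        · rw [← i2]; exact hk' v1 v2
      · refine Or.inr ⟨x, by omega, i1, i2, i3, i4, i5, fun v hv v1 v2 => ?_⟩
        rcases Nat.lt_succ_iff_lt_or_eq.1 hv with h | rfl
        · exact i6 v h v1 v2
        · rw [← i2]; exact hk' v1 v2
    · rw [e4, e18]
      refine Or.inr ⟨k, by omega, rfl, rfl, k1, k2, ?_, fun v hv v1 v2 => ?_⟩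
      · rcases hinv with ⟨i1, i2, i3⟩ | ⟨x, hx, i1, i2, i3, i4, i5, i6⟩ <;> omega
      · rcases Nat.lt_succ_iff_lt_or_eq.1 hv with h | rfl
        · rcases hinv with ⟨i1, i2, i3⟩ | ⟨x, hx, i1, i2, i3, i4, i5, i6⟩
          · have := i3 v h v1 v2; omega
          · have := i6 v h v1 v2; omega
        · exact le_rfl
  · rintro s' (⟨i1, i2, i3⟩ | ⟨x, hx, i1, i2, i3, i4, i5, i6⟩) -
    · exact Or.inl ⟨i1, fun v v1 v2 => i3 v v.2 v1 (not_not.1 v2)⟩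
    · exact Or.inr ⟨⟨x, hx⟩, i1, i3, not_not.2 i4, i5, fun v v1 v2 => i6 v v.2 v1 (not_not.1 v2)⟩

/-- The levels stored in array `2`. -/
def Store.level (s : Store) (n : ℕ) : Fin n → ℕ := fun v => s.arr 2 v

/-- The memory holds a base, a common independent set and valid levels. -/
structure Ready (m : Machine) (s : Store) : Prop where
  reg : s.reg 0 = m.n
  valid : Valid m.M₁ m.M₂ (s.set m.n 1) (s.set m.n 0) (s.level m.n)

/-- The options are tried in the order add, swap in `M₂`, swap in `M₁`. The failures of the
preceding tests are precisely the hypotheses of a raise. -/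
theorem halts_move (m : Machine) {s : Store} (h : Ready m s) (x : Fin m.n) (hx : s.reg 4 = x)
    (hx₁ : x ∈ s.set m.n 1) (hx₂ : x ∉ s.set m.n 0) :
    Halts m move s (90 * m.unit * m.log) fun s' => ∃ b,
      Move m.M₁ m.M₂ (s.set m.n 1) (s.set m.n 0) (s.level m.n) x
        (s'.set m.n 1) (s'.set m.n 0) (s'.level m.n) b ∧ (s'.reg 7 = 0 ↔ b) := by
  have hU := m.n_lt_unit
  have hUL : m.unit * 2 ≤ m.unit * m.log := Nat.mul_le_mul_left _ (by unfold Machine.log; omega)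
  have hB : 40 * m.unit * m.log = 40 * (m.unit * m.log) := by ring
  refine Halts.seq (B₂ := 80 * (m.unit * m.log) + 30)
    (halts_gain m false (a := 0) (x := 4) (o := 16) x hx (not_not.1 hx₂)
    (by norm_num) (by norm_num) (by norm_num)) ?_ (by rw [Nat.mul_assoc]; omega)
  rintro s₁ ⟨ha₁, h16⟩ hs₁
  have e4 : s₁.reg 4 = x := by rw [hs₁.1 4 rfl, hx]
  refine Halts.ite (B₁ := 80 * (m.unit * m.log) + 29) ?_ ?_ le_rfl
  · intro hne
    refine Halts.straight rfl ?_ (by simp [block, cost])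
    have eI : s₁.set m.n 0 = s.set m.n 0 := Store.set_congr (by rw [ha₁])
    have eI1 : s₁.set m.n 1 = s.set m.n 1 := Store.set_congr (by rw [ha₁])
    refine ⟨True, ?_, by simp [block, eval, Store.reg_setReg, Store.reg_setArr]⟩
    have := Move.add (I₁ := s.set m.n 1) (p := s.level m.n) (M₁ := m.M₁)
      (show x ∉ m.M₂.closure _ from h16.1 hne)
    convert this using 1
    · simp [block, eval, Store.set_setReg, Store.set_setArr_of_ne, eI1]
    · simp [block, eval, Store.reg_setReg, Store.set_setReg, e4, Store.set_setArr_insert, eI]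
    · funext v
      simp [block, eval, Store.level, Store.arr_setReg, Store.arr_setArr, ha₁]
  intro h0
  have hxc : x ∈ m.M₂.closure (s.set m.n 0) := by
    by_contra hc
    exact h16.2 hc h0
  refine Halts.seq (B₁ := 2) (B₂ := 80 * (m.unit * m.log) + 20) (Ψ := fun s' => s'.arr = s.arr ∧
    s'.reg 19 = s.level m.n x ∧ s'.reg 7 = 1) (Halts.straight rfl ?_ le_rfl) ?_ (by omega)
  · simp [block, eval, Store.arr_setReg, Store.reg_setReg, ha₁, e4, Store.level]
  rintro s₂ ⟨ha₂, h19, h7⟩ hs₂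
  have eS : ∀ a, s₂.set m.n a = s.set m.n a := fun a => Store.set_congr (by rw [ha₂])
  have e0 : s₂.reg 0 = m.n := by rw [hs₂.1 0 rfl, hs₁.1 0 rfl, h.reg]
  have e4' : s₂.reg 4 = x := by rw [hs₂.1 4 rfl, e4]
  refine Halts.seq (B₂ := 40 * (m.unit * m.log) + 20) (halts_find m false e0 x e4' ?_) ?_ (by omega)
  · rw [show idx false = 0 from rfl, eS, h19, ha₂]
    refine ⟨h.valid.indep, hxc, fun hc => absurd hc hx₂, ?_⟩
    simp [Store.level]
  rw [show idx false = 0 from rfl, eS, h19, ha₂]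
  intro s₃ h₃ hs₃
  have f0 : s₃.reg 0 = m.n := by rw [hs₃.1 0 rfl, e0]
  have f7 : s₃.reg 7 = 1 := by rw [hs₃.1 7 rfl, h7]
  have f4 : s₃.reg 4 = x := by rw [hs₃.1 4 rfl, e4']
  have a0 : s₃.arr 0 = s.arr 0 := by rw [hs₃.2 0 rfl, ha₂]
  have a1 : s₃.arr 1 = s.arr 1 := by rw [hs₃.2 1 rfl, ha₂]
  have a2 : s₃.arr 2 = s.arr 2 := by rw [hs₃.2 2 rfl, ha₂]
  refine Halts.seq (B₁ := 1) (B₂ := 40 * (m.unit * m.log) + 19) (Ψ := fun s' => s'.arr = s₃.arr ∧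
    s'.reg 20 = m.n - s₃.reg 5) (Halts.straight rfl ?_ le_rfl) ?_ (by omega)
  · simp [eval, Store.arr_setReg, Store.reg_setReg, f0]
  rintro s₄ ⟨ha₄, h20⟩ hs₄
  have g4 : s₄.reg 4 = x := by rw [hs₄.1 4 rfl, f4]
  have g7 : s₄.reg 7 = 1 := by rw [hs₄.1 7 rfl, f7]
  have gS : s₄.set m.n 0 = s.set m.n 0 := Store.set_congr (by rw [ha₄, a0])
  have gS1 : s₄.set m.n 1 = s.set m.n 1 := Store.set_congr (by rw [ha₄, a1])
  refine Halts.ite (B₁ := 40 * (m.unit * m.log) + 18) ?_ ?_ le_rfl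
  · intro hne
    refine Halts.straight rfl ?_ (by simp [block, cost])
    rcases h₃ with ⟨h5, -⟩ | ⟨f, h5, hp, hex⟩
    · exact absurd h20 (by omega)
    have g5 : s₄.reg 5 = f := by rw [hs₄.1 5 rfl, h5]
    have hxf : x ∉ m.M₂.closure (s.set m.n 0 \ {f}) := by
      rcases hex with hex | hex
      · exact absurd hex.1 hx₂
      · exact hex.2
    -- The search ranges over all elements of the right level; one outside `I₂` is no partner, since
    -- removing it changes nothing and `x` is spanned by `I₂`.
    have hf : f ∈ s.set m.n 0 := by
      by_contra hc
      rw [sdiff_singleton_eq_self hc] at hxf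
      exact hxf hxc
    refine ⟨False, ?_, by simp [block, eval, Store.reg_setReg, Store.reg_setArr, g7]⟩
    have := Move.pushSnd (I₁ := s.set m.n 1) (p := s.level m.n) (M₁ := m.M₁) f hf hp hxf
    convert this using 1
    · simp [block, eval, Store.set_setReg, Store.set_setArr_of_ne, gS1]
    · simp [block, eval, Store.reg_setReg, Store.reg_setArr, Store.set_setReg, g4, g5,
        Store.set_setArr_insert, Store.set_setArr_diff, gS]
    · funext v
      simp [block, eval, Store.level, Store.arr_setReg, Store.arr_setArr, ha₄, a2]
  intro hz
  have hf : ∀ f, s.level m.n f + 1 = s.level m.n x → x ∈ m.M₂.closure (s.set m.n 0 \ {f}) := by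
    intro f hf
    rcases h₃ with ⟨-, h5⟩ | ⟨f, h5, hp, hex⟩
    · by_contra hc
      exact h5 f hf (Or.inr ⟨hx₂, hc⟩)
    · have := f.2; omega
  have g0 : s₄.reg 0 = m.n := by rw [hs₄.1 0 rfl, f0]
  have g19 : s₄.reg 19 = s.level m.n x := by rw [hs₄.1 19 rfl, hs₃.1 19 rfl, h19]
  have g2 : s₄.arr 2 = s.arr 2 := by rw [ha₄, a2]
  refine Halts.seq (B₂ := 18) (halts_find m true g0 x g4 ?_) ?_ (by omega)
  · rw [show idx true = 1 from rfl, gS1, g19, g2]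
    have hcl : m.M₁.closure (s.set m.n 1) = univ := by rw [h.valid.base.closure_eq, m.ground₁]
    refine ⟨h.valid.base.indep, ?_, fun _ => ?_, ?_⟩
    · change x ∈ m.M₁.closure _
      rw [hcl]; trivial
    · change _ ⊆ m.M₁.closure _
      rw [hcl]; exact subset_univ _
    · simp [Store.level]
  rw [show idx true = 1 from rfl, gS1, g19, g2]
  intro s₅ h₅ hs₅
  have k0 : s₅.reg 0 = m.n := by rw [hs₅.1 0 rfl, g0]
  have k7 : s₅.reg 7 = 1 := by rw [hs₅.1 7 rfl, g7]
  have k4 : s₅.reg 4 = x := by rw [hs₅.1 4 rfl, g4]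
  have b0 : s₅.arr 0 = s.arr 0 := by rw [hs₅.2 0 rfl, ha₄, a0]
  have b1 : s₅.arr 1 = s.arr 1 := by rw [hs₅.2 1 rfl, ha₄, a1]
  have b2 : s₅.arr 2 = s.arr 2 := by rw [hs₅.2 2 rfl, g2]
  refine Halts.seq (B₁ := 1) (B₂ := 10) (Ψ := fun s' => s'.arr = s₅.arr ∧
    s'.reg 20 = m.n - s₅.reg 5) (Halts.straight rfl ?_ le_rfl) ?_ (by omega)
  · simp [eval, Store.arr_setReg, Store.reg_setReg, k0]
  rintro s₆ ⟨ha₆, h20'⟩ hs₆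
  have l4 : s₆.reg 4 = x := by rw [hs₆.1 4 rfl, k4]
  have l7 : s₆.reg 7 = 1 := by rw [hs₆.1 7 rfl, k7]
  have lS : s₆.set m.n 0 = s.set m.n 0 := Store.set_congr (by rw [ha₆, b0])
  have lS1 : s₆.set m.n 1 = s.set m.n 1 := Store.set_congr (by rw [ha₆, b1])
  refine Halts.ite (B₁ := 5) ?_ ?_ (by omega)
  · intro hne
    refine Halts.straight rfl ?_ (by simp [block, cost])
    rcases h₅ with ⟨h5, -⟩ | ⟨g, h5, hp, hex⟩
    · exact absurd h20' (by omega)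
    have l5 : s₆.reg 5 = g := by rw [hs₆.1 5 rfl, h5]
    have hgx : g ∉ m.M₁.closure (s.set m.n 1 \ {x}) := by
      rcases hex with hex | hex
      · exact hex.2
      · exact absurd hx₁ hex.1
    have hg : g ∉ s.set m.n 1 := by
      intro hc
      refine hgx (m.M₁.mem_closure_of_mem ⟨hc, ?_⟩
        (sdiff_subset.trans h.valid.base.subset_ground))
      rintro rfl
      simp [Store.level] at hp
    refine ⟨False, ?_, by simp [block, eval, Store.reg_setReg, Store.reg_setArr, l7]⟩
    have := Move.pushFst (I₂ := s.set m.n 0) (p := s.level m.n) (M₂ := m.M₂) g hg hp hgx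
    convert this using 1
    · simp [block, eval, Store.reg_setReg, Store.reg_setArr, Store.set_setReg, l4, l5,
        Store.set_setArr_insert, Store.set_setArr_diff, lS1]
    · simp [block, eval, Store.set_setReg, Store.set_setArr_of_ne, lS]
    · funext v
      simp [block, eval, Store.level, Store.arr_setReg, Store.arr_setArr, ha₆, b2]
  · intro hz'
    refine Halts.straight rfl ?_ (by simp [block, cost])
    have hg : ∀ g, s.level m.n g + 1 = s.level m.n x → g ∈ m.M₁.closure (s.set m.n 1 \ {x}) := by
      intro g hg
      rcases h₅ with ⟨-, h5⟩ | ⟨g, h5, hp, hex⟩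
      · by_contra hc
        exact h5 g hg (Or.inl ⟨hx₁, hc⟩)
      · have := g.2; omega
    refine ⟨False, ?_, by simp [block, eval, Store.reg_setReg, Store.reg_setArr, l7]⟩
    have := Move.raise hxc hf hg
    convert this using 1
    · simp [block, eval, Store.set_setReg, Store.set_setArr_of_ne, lS1]
    · simp [block, eval, Store.set_setReg, Store.set_setArr_of_ne, lS]
    · funext v
      simp [block, eval, Store.level, Store.arr_setReg, Store.reg_setReg, Store.arr_setArr, ha₆, b2,
        l4, Function.update_apply, Fin.ext_iff]

theorem halts_step (m : Machine) {s : Store} (h : Ready m s) :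
    Halts m step s (110 * m.unit * m.log) fun s' =>
      (s'.reg 6 = 0 ∧ s'.reg 7 = 0 ∧ s'.set m.n 1 = s.set m.n 1 ∧ s'.set m.n 0 = s.set m.n 0 ∧
        s'.level m.n = s.level m.n ∧
        ∀ x ∈ s.set m.n 1, x ∉ s.set m.n 0 → s.reg 3 ≤ s.level m.n x) ∨
      (s'.reg 6 ≠ 0 ∧ ∃ x ∈ s.set m.n 1, x ∉ s.set m.n 0 ∧ s.level m.n x < s.reg 3 ∧
        (∀ y ∈ s.set m.n 1, y ∉ s.set m.n 0 → s.level m.n x ≤ s.level m.n y) ∧ ∃ b,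
        Move m.M₁ m.M₂ (s.set m.n 1) (s.set m.n 0) (s.level m.n) x
          (s'.set m.n 1) (s'.set m.n 0) (s'.level m.n) b ∧ (s'.reg 7 = 0 ↔ b)) := by
  have hU := m.n_lt_unit
  have hUL : m.unit * 2 ≤ m.unit * m.log := Nat.mul_le_mul_left _ (by unfold Machine.log; omega)
  refine Halts.seq (B₂ := 90 * m.unit * m.log + 3) (halts_select m h.reg) ?_
    (by rw [Nat.mul_assoc, Nat.mul_assoc]; omega)
  intro s₁ h₁ hs₁
  have e0 : s₁.reg 0 = m.n := by rw [hs₁.1 0 rfl, h.reg]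
  have e3 : s₁.reg 3 = s.reg 3 := hs₁.1 3 rfl
  refine Halts.seq (B₁ := 2) (B₂ := 90 * m.unit * m.log + 1) (Ψ := fun s' => s'.arr = s.arr ∧
    s'.reg 6 = m.n - s₁.reg 4 ∧ s'.reg 7 = 0) (Halts.straight rfl ?_ le_rfl) ?_ (by omega)
  · simp [block, eval, Store.arr_setReg, Store.reg_setReg, e0]
    funext a
    exact hs₁.2 a rfl
  rintro s₂ ⟨ha₂, h6, h7⟩ hs₂
  have eS : ∀ a, s₂.set m.n a = s.set m.n a := fun a => Store.set_congr (by rw [ha₂])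
  have eL : s₂.level m.n = s.level m.n := by unfold Store.level; rw [ha₂]
  refine Halts.ite (B₁ := 90 * m.unit * m.log) ?_ ?_ le_rfl
  · intro hne
    rcases h₁ with ⟨h4, -⟩ | ⟨x, h4, hx₁, hx₂, hxK, hmin⟩
    · omega
    have hr : Ready m s₂ := ⟨by rw [hs₂.1 0 rfl, e0], by rw [eS, eS, eL]; exact h.valid⟩
    refine (halts_move m hr x (by rw [hs₂.1 4 rfl, h4]) (by rwa [eS]) (by rwa [eS])).mono ?_ le_rfl
    rintro s₃ ⟨b, hm, hb⟩ hs₃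
    rw [eS, eS, eL] at hm
    exact Or.inr ⟨by rwa [hs₃.1 6 rfl], x, hx₁, hx₂, hxK, hmin, b, hm, hb⟩
  · intro hz
    rcases h₁ with ⟨h4, hK⟩ | ⟨x, h4, hx₁, hx₂, hxK, hmin⟩
    · refine Halts.straight rfl (Or.inl ⟨?_, ?_, ?_, ?_, ?_, hK⟩) (by simp only [skip, cost]; rw [Nat.mul_assoc]; omega)
      · simpa [skip, eval, Store.reg_setReg] using hz
      · simpa [skip, eval, Store.reg_setReg] using h7
      · exact eS 1
      · exact eS 0
      · exact eL
    · have := x.2; omega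

/-! ### Breadth-first search from the sinks. -/

/-- The state of a breadth-first search from the sinks: `K` is the label of the elements that have
not been reached, and `U` contains the elements that have not been processed. -/
structure Search {α : Type*} (M₁ M₂ : Matroid α) (I₁ I₂ : Set α) (K : ℕ) (p : α → ℕ) (U : Set α) :
    Prop where
  le : ∀ v, p v ≤ K
  sink : ∀ v, v ∉ M₂.closure I₂ → p v = 0
  parent : ∀ v, p v < K → (p v = 0 ∧ v ∉ M₂.closure I₂) ∨ ∃ x, p x + 1 = p v ∧
    ((v ∉ I₂ ∧ v ∉ M₂.closure (I₂ \ {x})) ∨ (v ∈ I₁ ∧ x ∉ I₁ ∧ x ∉ M₁.closure (I₁ \ {v})))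
  doneSnd : ∀ x ∉ U, x ∈ I₂ → ∀ v ∉ I₂, v ∉ M₂.closure (I₂ \ {x}) → p v ≤ p x + 1
  doneFst : ∀ x ∉ U, x ∉ I₁ → ∀ v ∈ I₁, x ∉ M₁.closure (I₁ \ {v}) → p v ≤ p x + 1
  done : ∀ x ∉ U, p x < K
  front : ∀ u ∈ U, p u < K → ∀ v, p v < K → p v ≤ p u + 1

namespace Search

variable {α : Type*} {M₁ M₂ : Matroid α} {I₁ I₂ : Set α} {K : ℕ} {p : α → ℕ} {U : Set α} {x v : α}

theorem init (h : ∀ v, v ∈ M₂.closure I₂ → p v = K) (h' : ∀ v, v ∉ M₂.closure I₂ → p v = 0) :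
    Search M₁ M₂ I₁ I₂ K p univ := by
  have hp : ∀ v, p v < K → p v = 0 ∧ v ∉ M₂.closure I₂ := by
    intro v hv
    by_cases hc : v ∈ M₂.closure I₂
    · have := h v hc; omega
    · exact ⟨h' v hc, hc⟩
  refine ⟨fun v => ?_, h', fun v hv => Or.inl (hp v hv), by simp, by simp, by simp, ?_⟩
  · by_cases hc : v ∈ M₂.closure I₂
    · exact (h v hc).le
    · have := h' v hc; omega
  · intro u _ _ v hv
    have := (hp v hv).1
    omega

theorem exists_level (h : Search M₁ M₂ I₁ I₂ K p U) {k : ℕ} (hv : p v < K) (hk : k ≤ p v) :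
    ∃ u, p u = k := by
  obtain ⟨d, hd⟩ := Nat.exists_eq_add_of_le hk
  induction d generalizing v with
  | zero => exact ⟨v, hd⟩
  | succ d ih =>
    rcases h.parent v hv with ⟨h0, -⟩ | ⟨x, hx, -⟩
    · omega
    · exact ih (v := x) (by omega) (by omega) (by omega)

/-- Following parents, every level below a reached one is occupied, so there are at least `p v + 1`
elements. -/
theorem lt_card [Fintype α] (h : Search M₁ M₂ I₁ I₂ K p U) (hv : p v < K) :
    p v < Fintype.card α := by
  classical
  have hsub : Finset.range (p v + 1) ⊆ Finset.univ.image p := by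
    intro k hk
    obtain ⟨u, hu⟩ := h.exists_level hv (Nat.lt_succ_iff.1 (Finset.mem_range.1 hk))
    exact Finset.mem_image.2 ⟨u, Finset.mem_univ u, hu⟩
  have h1 := Finset.card_le_card hsub
  rw [Finset.card_range] at h1
  exact h1.trans Finset.card_image_le

/-- The arc makes `x` the parent of `v`. Processed elements are reached, so their labels stay while
other labels only fall; minimality of `p x` among the unprocessed elements preserves `front`. -/
theorem label [DecidableEq α] (h : Search M₁ M₂ I₁ I₂ K p U)
    (hx : p x < K) (hmin : ∀ u ∈ U, p x ≤ p u) (hxU : x ∈ U)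
    (hv : p v = K) (harc : (v ∉ I₂ ∧ v ∉ M₂.closure (I₂ \ {x})) ∨
      (v ∈ I₁ ∧ x ∉ I₁ ∧ x ∉ M₁.closure (I₁ \ {v}))) :
    Search M₁ M₂ I₁ I₂ K (Function.update p v (p x + 1)) U := by
  have hvx : x ≠ v := by rintro rfl; omega
  have hle : ∀ u, Function.update p v (p x + 1) u ≤ p u := by
    intro u
    by_cases huv : u = v
    · subst huv; simp; omega
    · simp [huv]
  have hdone : ∀ u ∉ U, u ≠ v := by
    rintro u hu rfl
    have := h.done u hu; omega
  refine ⟨fun u => (hle u).trans (h.le u), fun u hu => ?_, fun u hu => ?_, ?_, ?_, ?_, ?_⟩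
  · have := h.sink u hu
    have := hle u
    omega
  · by_cases huv : u = v
    · subst huv
      exact Or.inr ⟨x, by simp [hvx], harc⟩
    · rw [Function.update_of_ne huv] at hu ⊢
      rcases h.parent u hu with h1 | ⟨y, hy, h1⟩
      · exact Or.inl h1
      · have hyv : y ≠ v := by rintro rfl; omega
        exact Or.inr ⟨y, by rwa [Function.update_of_ne hyv], h1⟩
  · intro y hy hyI u hu hyu
    rw [Function.update_of_ne (hdone y hy)]
    exact (hle u).trans (h.doneSnd y hy hyI u hu hyu)
  · intro y hy hyI u hu hyu
    rw [Function.update_of_ne (hdone y hy)]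
    exact (hle u).trans (h.doneFst y hy hyI u hu hyu)
  · intro y hy
    exact (hle y).trans_lt (h.done y hy)
  · intro u hu huK w hw
    have hw' : Function.update p v (p x + 1) w ≤ p x + 1 := by
      by_cases hwv : w = v
      · simp [hwv]
      · rw [Function.update_of_ne hwv] at hw ⊢
        exact h.front x hxU hx w hw
    have hu' : p x ≤ Function.update p v (p x + 1) u := by
      by_cases huv : u = v
      · simp [huv]
      · rw [Function.update_of_ne huv]
        exact hmin u hu
    omega

/-- Once no unreached element has an arc to `x`, every tail of such an arc is reached, and `front`
bounds its label by `p x + 1`. -/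
theorem mark (h : Search M₁ M₂ I₁ I₂ K p U) (hx : p x < K) (hxU : x ∈ U)
    (h₂ : x ∈ I₂ → ∀ v ∉ I₂, p v = K → v ∈ M₂.closure (I₂ \ {x}))
    (h₁ : x ∉ I₁ → ∀ v ∈ I₁, p v = K → x ∈ M₁.closure (I₁ \ {v})) :
    Search M₁ M₂ I₁ I₂ K p (U \ {x}) := by
  have hor : ∀ y ∉ U \ {x}, y ∉ U ∨ y = x := by
    intro y hy
    simp only [mem_sdiff, mem_singleton_iff] at hy
    tauto
  refine ⟨h.le, h.sink, h.parent, ?_, ?_, ?_, fun u hu => h.front u hu.1⟩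
  · intro y hy hyI v hv hyv
    rcases hor y hy with hy' | rfl
    · exact h.doneSnd y hy' hyI v hv hyv
    · rcases (h.le v).lt_or_eq with hvK | hvK
      · exact h.front y hxU hx v hvK
      · exact absurd (h₂ hyI v hv hvK) hyv
  · intro y hy hyI v hv hyv
    rcases hor y hy with hy' | rfl
    · exact h.doneFst y hy' hyI v hv hyv
    · rcases (h.le v).lt_or_eq with hvK | hvK
      · exact h.front y hxU hx v hvK
      · exact absurd (h₁ hyI v hv hvK) hyv
  · intro y hy
    rcases hor y hy with hy' | rfl
    · exact h.done y hy'
    · exact hx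

/-- At the end every element of label below `K` is processed. A member of a circuit violating
validity would be such an element, and its arc would bound the other label. -/
theorem valid (h : Search M₁ M₂ I₁ I₂ K p U) (hE₁ : M₁.E = univ) (hbase : M₁.IsBase I₁)
    (hindep : M₂.Indep I₂) (hsub : I₂ ⊆ I₁) (hU : ∀ u ∈ U, K ≤ p u) :
    Valid M₁ M₂ I₁ I₂ p := by
  have hdone : ∀ u, p u < K → u ∉ U := fun u hu hc => absurd (hU u hc) (by omega)
  refine ⟨hbase, hindep, hsub, fun v hv h0 => ?_, fun g hg => ?_⟩
  · have hvc : v ∈ M₂.closure I₂ := by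
      by_contra hc
      exact h0 (h.sink v hc)
    have e : levelGE I₂ p (p v - 1) = I₂ \ {f | p f < p v - 1} := by
      ext y; simp [levelGE]
    rw [e]
    by_contra hc
    obtain ⟨f, hf, hvf⟩ := (notMem_closure_diff_iff hindep hvc).1 hc
    have hfI : f ∈ I₂ := by
      by_contra hc'
      rw [sdiff_singleton_eq_self hc'] at hvf
      exact hvf hvc
    have hf' : p f < p v - 1 := hf
    have hle := h.le v
    have := h.doneSnd f (hdone f (by omega)) hfI v hv hvf
    omega
  · have hgc : g ∈ M₁.closure I₁ := by rw [hbase.closure_eq, hE₁]; trivial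
    have e : levelLE I₁ p (p g + 1) = I₁ \ {k | p g + 1 < p k} := by
      ext y; simp [levelLE]
    rw [e]
    by_contra hc
    obtain ⟨k, hk, hgk⟩ := (notMem_closure_diff_iff hbase.indep hgc).1 hc
    have hkI : k ∈ I₁ := by
      by_contra hc'
      rw [sdiff_singleton_eq_self hc'] at hgk
      exact hgk hgc
    have hk' : p g + 1 < p k := hk
    have hle := h.le k
    have := h.doneFst g (hdone g (by omega)) hg k hkI hgk
    omega

theorem exact (h : Search M₁ M₂ I₁ I₂ K p U) (hindep : M₂.Indep I₂) {i : ℕ} (hi : i < K) :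
    Exact M₁ M₂ I₁ I₂ p i := by
  intro v hv
  rcases h.parent v (by omega) with ⟨h0, hvc⟩ | ⟨x, hx, ⟨h1, h2⟩ | ⟨h1, h2, h3⟩⟩
  · refine Or.inl ⟨fun hc => hvc (M₂.mem_closure_of_mem hc hindep.subset_ground), fun hc => hvc ?_⟩
    exact M₂.closure_subset_closure levelGE_subset hc
  · refine Or.inl ⟨h1, fun hc => h2 (M₂.closure_subset_closure ?_ hc)⟩
    rintro y ⟨hy, hy'⟩
    refine ⟨hy, ?_⟩
    rintro rfl
    omega
  · exact Or.inr ⟨h1, x, h2, hx, h3⟩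

end Search

open Classical in
/-- The number of elements that have not been reached plus the number of those that have not been
processed. -/
noncomputable def searchWork {α : Type*} [Fintype α] (K : ℕ) (p : α → ℕ) (U : Set α) : ℕ :=
  ∑ v, ((if p v = K then 1 else 0) + if v ∈ U then 1 else 0)

theorem searchWork_le {α : Type*} [Fintype α] (K : ℕ) (p : α → ℕ) (U : Set α) :
    searchWork K p U ≤ 2 * Fintype.card α := by
  unfold searchWork
  rw [mul_comm, ← smul_eq_mul, ← Finset.card_univ]
  refine Finset.sum_le_card_nsmul _ _ _ fun v _ => ?_
  split_ifs <;> omega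

theorem searchWork_label {α : Type*} [Fintype α] [DecidableEq α] {K k : ℕ} {p : α → ℕ} {U : Set α}
    {v : α} (hv : p v = K) (hk : k ≠ K) :
    searchWork K (Function.update p v k) U < searchWork K p U := by
  refine sum_lt_sum_of_single (a := v) (fun u hu => ?_) ?_
  · simp [hu]
  · simp [hv, hk]

theorem searchWork_mark {α : Type*} [Fintype α] {K : ℕ} {p : α → ℕ} {U : Set α} {x : α}
    (hx : x ∈ U) : searchWork K p (U \ {x}) < searchWork K p U := by
  classical
  refine sum_lt_sum_of_single (a := x) (fun u hu => ?_) ?_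
  · have : u ∈ U \ {x} ↔ u ∈ U := by simp [hu]
    simp only [this]
  · simp [hx]

namespace Program

/-- Label the sinks by `0` and the other elements by the number in register `3`. -/
def searchInit : Program :=
  forRange 11 12 (.seq (block [.store 2 11 3, .const 14 1, .store 5 11 14, .load 13 0 11])
    (.ite 13 skip (.seq (gain false 0 11 16) (.ite 16 (block [.const 13 0, .store 2 11 13]) skip))))

/-- Find an element that has not been reached and has an arc to the element in register `4`. -/
def searchPick : Program :=
  .seq (block [.succ 19 3, .load 13 0 4]) (.ite 13 (find false)
    (.seq (.load 13 1 4) (.ite 13 (.copy 5 0) (find true))))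

/-- One step of the breadth-first search; register `22` tells whether it has to go on. -/
def searchRound : Program :=
  .seq (select 5 6) (.seq (.sub 22 0 4) (.ite 22
    (.seq searchPick (.seq (.sub 20 0 5) (.ite 20 (block [.load 13 2 4, .succ 13 13, .store 2 5 13])
      (block [.const 13 0, .store 5 4 13])))) skip))

/-- Breadth-first search from the sinks, which makes all labels below the bound exact. -/
def search : Program := .seq searchInit (.seq (.const 22 1) (.loop 22 searchRound))

end Program

theorem halts_searchInit (m : Machine) {s : Store} (hn : s.reg 0 = m.n)
    (hI : m.M₂.Indep (s.set m.n 0)) :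
    Halts m searchInit s (22 * (m.n + 1) * m.unit) fun s' => s'.arr 0 = s.arr 0 ∧ s'.set m.n 5 = univ ∧
      ∀ v : Fin m.n, (v ∈ m.M₂.closure (s.set m.n 0) → s'.level m.n v = s.reg 3) ∧
        (v ∉ m.M₂.closure (s.set m.n 0) → s'.level m.n v = 0) := by
  have hU := m.n_lt_unit
  refine Halts.forRange (B₁ := 2 * m.unit + 15) (fun k s' => s'.arr 0 = s.arr 0 ∧ ∀ v : Fin m.n, (v : ℕ) < k →
    s'.arr 5 v ≠ 0 ∧ (v ∈ m.M₂.closure (s.set m.n 0) → s'.arr 2 v = s.reg 3) ∧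
        (v ∉ m.M₂.closure (s.set m.n 0) → s'.arr 2 v = 0))
    hn (by norm_num) (by norm_num) (by norm_num) rfl rfl (by simp [Store.arr_setReg]) ?_ ?_ (by nlinarith)
  · rintro k s₁ hk ⟨ha, hinv⟩ hri hr0 hsame
    have e3 : s₁.reg 3 = s.reg 3 := hsame.1 3 rfl
    have eS : s₁.set m.n 0 = s.set m.n 0 := Store.set_congr ha
    refine Halts.seq (B₁ := 4) (B₂ := 2 * m.unit + 11) (Ψ := fun s' => s'.reg 13 = s₁.arr 0 k ∧
      s'.arr 0 = s.arr 0 ∧ s'.arr 5 k ≠ 0 ∧ s'.arr 2 k = s.reg 3 ∧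
      (∀ v < k, s'.arr 5 v = s₁.arr 5 v ∧ s'.arr 2 v = s₁.arr 2 v)) (Halts.straight rfl ?_ le_rfl)
      ?_ (by omega)
    · simp [block, eval, Store.reg_setReg, Store.reg_setArr, Store.arr_setReg, Store.arr_setArr, hri,
        e3, ← ha]
      refine ⟨?_, fun v hv => ?_⟩
      · funext j
        simp [Store.arr_setArr, Store.arr_setReg]
      simp [hv.ne]
    rintro s₂ ⟨h13, a0, h5, h2, hlt⟩ hs₂
    have h0 : s₂.set m.n 0 = s.set m.n 0 := Store.set_congr a0
    have close : ∀ s₃ : Store, s₃.arr 0 = s₂.arr 0 → (∀ v, s₃.arr 5 v = s₂.arr 5 v) → (∀ v < k, s₃.arr 2 v = s₂.arr 2 v) →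
        ((⟨k, hk⟩ : Fin m.n) ∈ m.M₂.closure (s.set m.n 0) → s₃.arr 2 k = s.reg 3) →
        ((⟨k, hk⟩ : Fin m.n) ∉ m.M₂.closure (s.set m.n 0) → s₃.arr 2 k = 0) →
        s₃.arr 0 = s.arr 0 ∧ ∀ v : Fin m.n, (v : ℕ) < k + 1 →
          s₃.arr 5 v ≠ 0 ∧ (v ∈ m.M₂.closure (s.set m.n 0) → s₃.arr 2 v = s.reg 3) ∧
          (v ∉ m.M₂.closure (s.set m.n 0) → s₃.arr 2 v = 0) := by
      refine fun s₃ a0' a5 a2 ac ac' => ⟨a0'.trans a0, fun v hv => ?_⟩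
      rcases Nat.lt_succ_iff_lt_or_eq.1 hv with h | h
      · rw [a5, a2 v h, (hlt v h).1, (hlt v h).2]
        exact hinv v h
      · obtain rfl : v = ⟨k, hk⟩ := Fin.ext h
        exact ⟨by rw [a5]; exact h5, ac, ac'⟩
    simp only [Store.arr_setReg]
    refine Halts.ite (B₁ := 2 * m.unit + 10) ?_ ?_ le_rfl
    · intro hne
      refine Halts.straight rfl ?_ (by simp [skip, cost])
      intro _ _
      have hmem : (⟨k, hk⟩ : Fin m.n) ∈ m.M₂.closure (s.set m.n 0) := by
        refine m.M₂.mem_closure_of_mem ?_ hI.subset_ground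
        rw [← eS, Store.mem_set, ← h13]
        exact hne
      exact close _ rfl (fun v => rfl) (fun v _ => rfl) (fun _ => h2) (fun h => absurd hmem h)
    · intro hz
      have e11 : s₂.reg 11 = k := by rw [hs₂.1 11 rfl, hri]
      refine Halts.seq (B₂ := 4) (halts_gain m false (a := 0) (x := 11) (o := 16) ⟨k, hk⟩ e11 ?_
        (by norm_num) (by norm_num) (by norm_num)) ?_ (by omega)
      · have : (⟨k, hk⟩ : Fin m.n) ∉ s₂.set m.n 0 := by
          rw [h0, ← eS, Store.mem_set, ← h13, not_not]
          exact hz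
        exact not_not.1 this
      rintro s₃ ⟨ha₃, h16⟩ hs₃
      rw [h0] at h16
      have f11 : s₃.reg 11 = k := by rw [hs₃.1 11 rfl, e11]
      refine Halts.ite (B₁ := 3) ?_ ?_ le_rfl
      · intro hne
        refine Halts.straight rfl ?_ (by simp [block, cost])
        intro _ _
        refine close _ ?_ (fun v => ?_) (fun v hv => ?_) (fun h => absurd h (h16.1 hne)) (fun _ => ?_)
        · funext j
          simp [block, eval, Store.arr_setArr, Store.arr_setReg, ha₃]
        · simp [block, eval, Store.arr_setArr, Store.arr_setReg, ha₃]
        · simp [block, eval, Store.arr_setArr, Store.arr_setReg, Store.reg_setReg, ha₃, f11, hv.ne]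
        · simp [block, eval, Store.arr_setArr, Store.reg_setReg, f11]
      · intro hz'
        refine Halts.straight rfl ?_ (by simp [skip, cost])
        intro _ _
        have hc : (⟨k, hk⟩ : Fin m.n) ∈ m.M₂.closure (s.set m.n 0) := by
          by_contra hc
          exact h16.2 hc hz'
        refine close _ ?_ (fun v => ?_) (fun v hv => ?_) (fun _ => ?_) (fun h => absurd hc h)
        · simp [skip, eval, Store.arr_setReg, ha₃]
        · simp [skip, eval, Store.arr_setReg, ha₃]
        · simp [skip, eval, Store.arr_setReg, ha₃]
        · simp [skip, eval, Store.arr_setReg, ha₃, h2]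
  · rintro s' ⟨ha, h⟩ -
    exact ⟨ha, eq_univ_of_forall fun v => (h v v.2).1, fun v => (h v v.2).2⟩

/-- The matroids, sets and labels in memory form a state of the breadth-first search. -/
structure Searching (m : Machine) (s : Store) : Prop where
  reg : s.reg 0 = m.n
  bound : m.n < s.reg 3
  zero : ∀ v : Fin m.n, v ∉ s.set m.n 6
  base : m.M₁.IsBase (s.set m.n 1)
  indep : m.M₂.Indep (s.set m.n 0)
  sub : s.set m.n 0 ⊆ s.set m.n 1
  search : Search m.M₁ m.M₂ (s.set m.n 1) (s.set m.n 0) (s.reg 3) (s.level m.n) (s.set m.n 5)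

theorem halts_searchPick (m : Machine) {s : Store} (h : Searching m s) (x : Fin m.n)
    (hx : s.reg 4 = x) (hxK : s.level m.n x < s.reg 3) :
    Halts m searchPick s (40 * m.unit * m.log + 5) fun s' =>
      (s'.reg 5 = m.n ∧
        (x ∈ s.set m.n 0 → ∀ v ∉ s.set m.n 0, s.level m.n v = s.reg 3 →
          v ∈ m.M₂.closure (s.set m.n 0 \ {x})) ∧
        (x ∉ s.set m.n 1 → ∀ v ∈ s.set m.n 1, s.level m.n v = s.reg 3 →
          x ∈ m.M₁.closure (s.set m.n 1 \ {v}))) ∨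
      ∃ v : Fin m.n, s'.reg 5 = v ∧ s.level m.n v = s.reg 3 ∧
        ((v ∉ s.set m.n 0 ∧ v ∉ m.M₂.closure (s.set m.n 0 \ {x})) ∨
          (v ∈ s.set m.n 1 ∧ x ∉ s.set m.n 1 ∧ x ∉ m.M₁.closure (s.set m.n 1 \ {v}))) := by
  have hset : {v : Fin m.n | s.arr 2 v + 1 = s.reg 3 + 1} = {v | s.level m.n v = s.reg 3} := by
    ext v; simp [Store.level]
  have hxA : x ∉ {v | s.level m.n v = s.reg 3} := by
    simp only [mem_ofPred_eq]; omega
  refine Halts.seq (B₁ := 2) (B₂ := 40 * m.unit * m.log + 3) (Ψ := fun s' => s'.arr = s.arr ∧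
    s'.reg 19 = s.reg 3 + 1 ∧ s'.reg 13 = s.arr 0 x) (Halts.straight rfl ?_ le_rfl) ?_ (by omega)
  · simp [block, eval, Store.arr_setReg, Store.reg_setReg, hx]
  rintro s₁ ⟨ha₁, h19, h13⟩ hs₁
  have e0 : s₁.reg 0 = m.n := by rw [hs₁.1 0 rfl, h.reg]
  have e4 : s₁.reg 4 = x := by rw [hs₁.1 4 rfl, hx]
  have eS : ∀ a, s₁.set m.n a = s.set m.n a := fun a => Store.set_congr (by rw [ha₁])
  refine Halts.ite (B₁ := 40 * m.unit * m.log + 2) ?_ ?_ le_rfl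
  · intro hne
    have hx₂ : x ∈ s.set m.n 0 := by rw [Store.mem_set, ← h13]; exact hne
    have hx₁ := h.sub hx₂
    refine (halts_find m false e0 x e4 ?_).mono ?_ (by omega)
    · rw [show idx false = 0 from rfl, eS, h19, ha₁, hset]
      refine ⟨h.indep, m.M₂.mem_closure_of_mem hx₂ h.indep.subset_ground, fun _ v hv => ?_, hxA⟩
      -- An unreached candidate is no sink, since sinks carry label `0`; hence it lies in the
      -- closure, as `CanSearch` requires.
      by_contra hc
      have := h.search.sink v hc
      have hv' : s.level m.n v = s.reg 3 := hv
      omega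
    · rw [show idx false = 0 from rfl, eS, h19, ha₁]
      rintro s₂ (⟨h5, hno⟩ | ⟨v, h5, hv, hex⟩) -
      · refine Or.inl ⟨h5, fun _ v hv hvK => ?_, fun hc => absurd hx₁ hc⟩
        by_contra hc
        exact hno v (congrArg (· + 1) hvK) (Or.inl ⟨hx₂, hc⟩)
      · have hv' : s.level m.n v = s.reg 3 := Nat.succ_injective hv
        rcases hex with ⟨-, hex⟩ | ⟨hc, -⟩
        · refine Or.inr ⟨v, h5, hv', Or.inl ⟨fun hvI => hex ?_, hex⟩⟩
          refine m.M₂.mem_closure_of_mem ⟨hvI, ?_⟩ (sdiff_subset.trans h.indep.subset_ground)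
          rintro rfl
          exact hxA hv'
        · exact absurd hx₂ hc
  · intro hz
    have hx₂ : x ∉ s.set m.n 0 := by rw [Store.mem_set, ← h13]; exact not_not.2 hz
    refine Halts.seq (B₁ := 1) (B₂ := 40 * m.unit * m.log + 1) (Ψ := fun s' => s'.arr = s.arr ∧
      s'.reg 13 = s.arr 1 x) (Halts.straight rfl ?_ le_rfl) ?_ (by omega)
    · simp [eval, Store.arr_setReg, Store.reg_setReg, ha₁, e4]
    rintro s₂ ⟨ha₂, h13'⟩ hs₂
    have f0 : s₂.reg 0 = m.n := by rw [hs₂.1 0 rfl, e0]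
    have f4 : s₂.reg 4 = x := by rw [hs₂.1 4 rfl, e4]
    have f19 : s₂.reg 19 = s.reg 3 + 1 := by rw [hs₂.1 19 rfl, h19]
    have fS : ∀ a, s₂.set m.n a = s.set m.n a := fun a => Store.set_congr (by rw [ha₂])
    have hlog : 1 ≤ 40 * m.unit * m.log := by
      have : 0 < m.unit := Nat.succ_pos _
      have : 0 < m.log := Nat.succ_pos _
      exact Nat.succ_le_of_lt (by positivity)
    refine Halts.ite (B₁ := 40 * m.unit * m.log) ?_ ?_ le_rfl
    · intro hne
      have hx₁ : x ∈ s.set m.n 1 := by rw [Store.mem_set, ← h13']; exact hne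
      refine Halts.straight rfl (Or.inl ⟨?_, fun hc => absurd hc hx₂, fun hc => absurd hx₁ hc⟩) hlog
      simp [eval, Store.reg_setReg, f0]
    · intro hz'
      have hx₁ : x ∉ s.set m.n 1 := by rw [Store.mem_set, ← h13']; exact not_not.2 hz'
      have hcl : x ∈ m.M₁.closure (s.set m.n 1) := by
        rw [h.base.closure_eq, m.ground₁]; trivial
      refine (halts_find m true f0 x f4 ?_).mono ?_ le_rfl
      · rw [show idx true = 1 from rfl, fS, f19, ha₂, hset]
        exact ⟨h.base.indep, hcl, fun hc => absurd hc hx₁, hxA⟩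
      · rw [show idx true = 1 from rfl, fS, f19, ha₂]
        rintro s₃ (⟨h5, hno⟩ | ⟨v, h5, hv, hex⟩) -
        · refine Or.inl ⟨h5, fun hc => absurd hc hx₂, fun _ v hv hvK => ?_⟩
          by_contra hc
          exact hno v (congrArg (· + 1) hvK) (Or.inr ⟨hx₁, hc⟩)
        · have hv' : s.level m.n v = s.reg 3 := Nat.succ_injective hv
          rcases hex with ⟨hc, -⟩ | ⟨-, hex⟩
          · exact absurd hc hx₁
          · refine Or.inr ⟨v, h5, hv', Or.inr ⟨?_, hx₁, hex⟩⟩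
            by_contra hvI
            rw [sdiff_singleton_eq_self hvI] at hex
            exact hex hcl

theorem halts_searchRound (m : Machine) {s : Store} (h : Searching m s) :
    Halts m searchRound s (60 * m.unit * m.log) fun s' => Searching m s' ∧
      ((s'.reg 22 ≠ 0 ∧ searchWork (s.reg 3) (s'.level m.n) (s'.set m.n 5) <
          searchWork (s.reg 3) (s.level m.n) (s.set m.n 5)) ∨
        (s'.reg 22 = 0 ∧ ∀ u ∈ s'.set m.n 5, s.reg 3 ≤ s'.level m.n u)) := by
  have hU := m.n_lt_unit
  have hUL : m.unit * 2 ≤ m.unit * m.log := Nat.mul_le_mul_left _ (by unfold Machine.log; omega)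
  -- Array `6` is empty, so the selection runs over all unprocessed elements of label below `K`.
  refine Halts.seq (B₂ := 40 * m.unit * m.log + 13) (halts_select m h.reg) ?_
    (by rw [Nat.mul_assoc, Nat.mul_assoc]; omega)
  intro s₁ h₁ hs₁
  have ha₁ : s₁.arr = s.arr := funext fun a => hs₁.2 a rfl
  have e0 : s₁.reg 0 = m.n := by rw [hs₁.1 0 rfl, h.reg]
  refine Halts.seq (B₁ := 1) (B₂ := 40 * m.unit * m.log + 12) (Ψ := fun s' => s'.arr = s.arr ∧
    s'.reg 22 = m.n - s₁.reg 4) (Halts.straight rfl ?_ le_rfl) ?_ (by omega)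
  · simp [eval, Store.arr_setReg, Store.reg_setReg, e0, ha₁]
  rintro s₂ ⟨ha₂, h22⟩ hs₂
  have f0 : s₂.reg 0 = m.n := by rw [hs₂.1 0 rfl, e0]
  have f3 : s₂.reg 3 = s.reg 3 := by rw [hs₂.1 3 rfl, hs₁.1 3 rfl]
  have fS : ∀ a, s₂.set m.n a = s.set m.n a := fun a => Store.set_congr (by rw [ha₂])
  have fL : s₂.level m.n = s.level m.n := by unfold Store.level; rw [ha₂]
  have hr : Searching m s₂ := by
    refine ⟨f0, by rw [f3]; exact h.bound, ?_, ?_, ?_, ?_, ?_⟩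
    · rw [fS]; exact h.zero
    · rw [fS]; exact h.base
    · rw [fS]; exact h.indep
    · rw [fS, fS]; exact h.sub
    · rw [fS, fS, fS, fL, f3]; exact h.search
  refine Halts.ite (B₁ := 40 * m.unit * m.log + 11) ?_ ?_ le_rfl
  · intro hne
    rcases h₁ with ⟨h4, -⟩ | ⟨x, h4, hxU, -, hxK, hmin⟩
    · omega
    replace hmin : ∀ v ∈ s.set m.n 5, s.level m.n x ≤ s.level m.n v := fun v hv =>
      hmin v hv (h.zero v)
    replace hxK : s.level m.n x < s.reg 3 := hxK
    have f4 : s₂.reg 4 = x := by rw [hs₂.1 4 rfl, h4]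
    refine Halts.seq (B₂ := 6) (halts_searchPick m hr x f4 (by rwa [fL, f3])) ?_ (by omega)
    rw [fS, fS, fL, f3]
    intro s₃ h₃ hs₃
    have g0 : s₃.reg 0 = m.n := by rw [hs₃.1 0 rfl, f0]
    refine Halts.seq (B₁ := 1) (B₂ := 5) (Ψ := fun s' => s'.arr = s₃.arr ∧
      s'.reg 20 = m.n - s₃.reg 5) (Halts.straight rfl ?_ le_rfl) ?_ le_rfl
    · simp [eval, Store.arr_setReg, Store.reg_setReg, g0]
    rintro s₄ ⟨ha₄, h20⟩ hs₄
    have k0 : s₄.reg 0 = m.n := by rw [hs₄.1 0 rfl, g0]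
    have k3 : s₄.reg 3 = s.reg 3 := by rw [hs₄.1 3 rfl, hs₃.1 3 rfl, f3]
    have k4 : s₄.reg 4 = x := by rw [hs₄.1 4 rfl, hs₃.1 4 rfl, f4]
    have k22 : s₄.reg 22 ≠ 0 := by rw [hs₄.1 22 rfl, hs₃.1 22 rfl]; exact hne
    have ka : ∀ a, a ≠ 4 → s₄.arr a = s.arr a := by
      intro a ha
      rw [ha₄, hs₃.2 a (by
        simp [searchPick, find, findRound, testPrefix, queryCell, forRange, block, gain, oracle, skip,
          writesArr, ha.symm]), ha₂]
    refine Halts.ite (B₁ := 3) ?_ ?_ (by omega)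
    · intro hne'
      rcases h₃ with ⟨h5, -⟩ | ⟨v, h5, hvK, harc⟩
      · exact absurd h20 (by omega)
      have k5 : s₄.reg 5 = v := by rw [hs₄.1 5 rfl, h5]
      refine Halts.straight rfl ?_ (by simp [block, cost])
      set s₅ := (block [load 13 2 4, succ 13 13, Program.store 2 5 13]).eval m s₄ with hs₅
      have aS : ∀ a, a ≠ 2 → a ≠ 4 → s₅.set m.n a = s.set m.n a := by
        intro a h2 h4
        rw [hs₅]
        refine (?_ : _ = s₄.set m.n a).trans (Store.set_congr (ka a h4))
        simp [block, eval, Store.set_setReg, Store.set_setArr_of_ne, h2]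
      have aL : s₅.level m.n = Function.update (s.level m.n) v (s.level m.n x + 1) := by
        funext u
        simp [hs₅, block, eval, Store.level, Store.arr_setReg, Store.reg_setReg, Store.arr_setArr, k4,
          k5, ka, Function.update_apply, Fin.ext_iff]
      have a3 : s₅.reg 3 = s.reg 3 := by
        simp [hs₅, block, eval, Store.reg_setReg, Store.reg_setArr, k3]
      have hcard := h.search.lt_card hxK
      rw [Fintype.card_fin] at hcard
      have hb := h.bound
      refine ⟨⟨?_, ?_, ?_, ?_, ?_, ?_, ?_⟩, Or.inl ⟨?_, ?_⟩⟩
      · simp [hs₅, block, eval, Store.reg_setReg, Store.reg_setArr, k0]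
      · rw [a3]; exact h.bound
      · rw [aS 6 (by norm_num) (by norm_num)]; exact h.zero
      · rw [aS 1 (by norm_num) (by norm_num)]; exact h.base
      · rw [aS 0 (by norm_num) (by norm_num)]; exact h.indep
      · rw [aS 1 (by norm_num) (by norm_num), aS 0 (by norm_num) (by norm_num)]; exact h.sub
      · rw [aS 1 (by norm_num) (by norm_num), aS 0 (by norm_num) (by norm_num),
          aS 5 (by norm_num) (by norm_num), aL, a3]
        exact h.search.label hxK hmin hxU hvK harc
      · simpa [hs₅, block, eval, Store.reg_setReg, Store.reg_setArr] using k22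
      · rw [aS 5 (by norm_num) (by norm_num), aL]
        -- The new label is at most `n`, below the bound, so it differs from the mark for unreached
        -- elements.
        exact searchWork_label hvK (by omega)
    · intro hz
      rcases h₃ with ⟨h5, hno₂, hno₁⟩ | ⟨v, h5, -⟩
      swap
      · have := v.2; omega
      refine Halts.straight rfl ?_ (by simp [block, cost])
      set s₅ := (block [const 13 0, Program.store 5 4 13]).eval m s₄ with hs₅
      have aS : ∀ a, a ≠ 5 → a ≠ 4 → s₅.set m.n a = s.set m.n a := by
        intro a h2 h4
        rw [hs₅]
        refine (?_ : _ = s₄.set m.n a).trans (Store.set_congr (ka a h4))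
        simp [block, eval, Store.set_setReg, Store.set_setArr_of_ne, h2]
      have aU : s₅.set m.n 5 = s.set m.n 5 \ {x} := by
        rw [← Store.set_congr (ka 5 (by norm_num))]
        simp [hs₅, block, eval, Store.reg_setReg, k4, Store.set_setArr_diff, Store.set_setReg]
      have aL : s₅.level m.n = s.level m.n := by
        funext u
        simp [hs₅, block, eval, Store.level, Store.arr_setReg, Store.arr_setArr, ka]
      have a3 : s₅.reg 3 = s.reg 3 := by
        simp [hs₅, block, eval, Store.reg_setReg, Store.reg_setArr, k3]
      refine ⟨⟨?_, ?_, ?_, ?_, ?_, ?_, ?_⟩, Or.inl ⟨?_, ?_⟩⟩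
      · simp [hs₅, block, eval, Store.reg_setReg, Store.reg_setArr, k0]
      · rw [a3]; exact h.bound
      · rw [aS 6 (by norm_num) (by norm_num)]; exact h.zero
      · rw [aS 1 (by norm_num) (by norm_num)]; exact h.base
      · rw [aS 0 (by norm_num) (by norm_num)]; exact h.indep
      · rw [aS 1 (by norm_num) (by norm_num), aS 0 (by norm_num) (by norm_num)]; exact h.sub
      · rw [aS 1 (by norm_num) (by norm_num), aS 0 (by norm_num) (by norm_num), aU, aL, a3]
        exact h.search.mark hxK hxU hno₂ hno₁
      · simpa [hs₅, block, eval, Store.reg_setReg, Store.reg_setArr] using k22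
      · rw [aU, aL]
        exact searchWork_mark hxU
  · intro hz
    rcases h₁ with ⟨h4, hK⟩ | ⟨x, h4, -⟩
    swap
    · have := x.2; omega
    refine Halts.straight rfl ⟨⟨?_, ?_, hr.zero, hr.base, hr.indep, hr.sub, ?_⟩,
      Or.inr ⟨?_, ?_⟩⟩ (by simp [skip, cost])
    · simpa [skip, eval, Store.reg_setReg] using hr.reg
    · simpa [skip, eval, Store.reg_setReg] using hr.bound
    · have e : (Program.eval m skip s₂).reg 3 = s₂.reg 3 := by simp [skip, eval, Store.reg_setReg]
      rw [e]
      exact hr.search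
    · simpa [skip, eval, Store.reg_setReg] using hz
    · intro u hu
      change u ∈ s₂.set m.n 5 at hu
      change s.reg 3 ≤ s₂.level m.n u
      rw [fS] at hu
      rw [fL]
      exact hK u hu (h.zero u)

theorem halts_search (m : Machine) {s : Store} (h : Ready m s) (hb : m.n < s.reg 3)
    (hzero : ∀ v : Fin m.n, v ∉ s.set m.n 6) :
    Halts m search s (200 * (m.n + 1) * (m.unit * m.log)) fun s' => s'.set m.n 0 = s.set m.n 0 ∧
      Ready m s' ∧ (∀ i < s.reg 3, Exact m.M₁ m.M₂ (s'.set m.n 1) (s'.set m.n 0) (s'.level m.n) i) ∧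
      ∀ v, s'.level m.n v ≤ s.reg 3 := by
  have hU := m.n_lt_unit
  have hUL : m.unit * 2 ≤ m.unit * m.log := Nat.mul_le_mul_left _ (by unfold Machine.log; omega)
  refine Halts.seq (B₂ := (2 * m.n + 1) * (60 * m.unit * m.log + 1) + 2)
    (halts_searchInit m h.reg h.valid.indep) ?_ (by nlinarith)
  rintro s₁ ⟨ha0, hs5, hlev⟩ hs₁
  have e3 : s₁.reg 3 = s.reg 3 := hs₁.1 3 rfl
  have e0 : s₁.set m.n 0 = s.set m.n 0 := Store.set_congr ha0
  have e1 : s₁.set m.n 1 = s.set m.n 1 := Store.set_congr (hs₁.2 1 rfl)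
  have hr : Searching m s₁ := by
    refine ⟨by rw [hs₁.1 0 rfl, h.reg], by rw [e3]; exact hb, ?_, ?_, ?_, ?_, ?_⟩
    · rw [Store.set_congr (hs₁.2 6 rfl)]; exact hzero
    · rw [e1]; exact h.valid.base
    · rw [e0]; exact h.valid.indep
    · rw [e0, e1]; exact h.valid.sub
    · rw [e0, e1, e3, hs5]
      exact Search.init (fun v hv => (hlev v).1 hv) (fun v hv => (hlev v).2 hv)
  refine Halts.seq (B₁ := 1) (B₂ := (2 * m.n + 1) * (60 * m.unit * m.log + 1) + 1)
    (Ψ := fun s' => s' = s₁.setReg 22 1) (Halts.straight rfl rfl le_rfl) ?_ (by omega)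
  rintro s₂ rfl -
  refine Halts.loop (B₁ := 60 * m.unit * m.log) (k := 2 * m.n + 1) (fun k s' => Searching m s' ∧
    ((s'.reg 22 ≠ 0 ∧ searchWork (s.reg 3) (s'.level m.n) (s'.set m.n 5) < k) ∨
      (s'.reg 22 = 0 ∧ ∀ u ∈ s'.set m.n 5, s.reg 3 ≤ s'.level m.n u))) ?_ ?_ ?_ le_rfl
  · rintro k s' ⟨hsr, hk⟩ hsame hne
    rcases hk with ⟨-, hk⟩ | ⟨hc, -⟩
    swap
    · exact absurd hc hne
    have e3' : s'.reg 3 = s.reg 3 := by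
      rw [hsame.1 3 rfl]; simpa [Store.reg_setReg] using e3
    refine (halts_searchRound m hsr).mono ?_ le_rfl
    rw [e3']
    rintro s'' ⟨hsr', h'⟩ -
    exact ⟨_, hk, hsr', h'⟩
  · refine ⟨⟨?_, ?_, hr.zero, hr.base, hr.indep, hr.sub, ?_⟩, Or.inl ⟨?_, ?_⟩⟩
    · simpa [Store.reg_setReg] using hr.reg
    · simpa [Store.reg_setReg] using hr.bound
    · have e : (s₁.setReg 22 1).reg 3 = s₁.reg 3 := by simp [Store.reg_setReg]
      rw [e]
      exact hr.search
    · simp [Store.reg_setReg]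
    · have := searchWork_le (s.reg 3) ((s₁.setReg 22 1).level m.n) ((s₁.setReg 22 1).set m.n 5)
      rw [Fintype.card_fin] at this
      omega
  · rintro k s' ⟨hsr, hk⟩ hsame hz
    rcases hk with ⟨hc, -⟩ | ⟨-, hk⟩
    · exact absurd hz hc
    have e3' : s'.reg 3 = s.reg 3 := by
      rw [hsame.1 3 rfl]; simpa [Store.reg_setReg] using e3
    have hse := hsr.search
    rw [e3'] at hse
    refine ⟨?_, ⟨hsr.reg, ?_⟩, fun i hi => hse.exact hsr.indep hi, hse.le⟩
    · rw [← e0]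
      exact Store.set_congr (hsame.2 0 rfl)
    · exact hse.valid m.ground₁ hsr.base hsr.indep hsr.sub hk

/-! ### The approximation and the exact algorithm. -/

namespace Program

/-- Make moves at unmatched elements below the bound in register `3` as long as there are any. -/
def auction : Program := .seq (.const 6 1) (.loop 6 step)

/-- Make moves until the common independent set has grown. -/
def chain : Program := .seq (.const 7 1) (.loop 7 step)

/-- Augment along shortest paths until the common independent set is a largest one. -/
def augment : Program := .seq (.const 6 1) (.loop 6 (.seq search chain))

/-- Greedily put a base of the first matroid into array `1`. -/
def greedyBase : Program :=
  forRange 11 12 (.seq (gain true 1 11 16) (.ite 16 (block [.const 13 1, .store 1 11 13]) skip))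

/-- Put `3 + 2 ⌈q / p⌉` into register `3`, where `p` and `q` are in registers `1` and `2`. -/
def quotientBound : Program :=
  .seq (block [.const 3 3, .copy 22 2]) (.loop 22 (block [.sub 22 22 1, .succ 3 3, .succ 3 3]))

/-- Increase register `3` to about the square root of twice the size of the common independent
set. -/
def sqrtBound : Program :=
  .seq (.rankSnd 22 0) (.loop 22 (block [.sub 22 22 3, .succ 3 3]))

/-- The approximation algorithm. -/
def approximate : Program := .seq greedyBase (.seq quotientBound auction)

/-- The exact algorithm. -/
def solve : Program :=
  .seq greedyBase (.seq (.const 3 3) (.seq auction (.seq sqrtBound (.seq auction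
    (.seq (block [.const 1 1, .copy 2 0]) (.seq quotientBound augment))))))

end Program

/-- No unmatched element has a label below the bound in register `3`. -/
def Settled (m : Machine) (s : Store) : Prop :=
  ∀ x ∈ s.set m.n 1, x ∉ s.set m.n 0 → s.reg 3 ≤ s.level m.n x

theorem halts_auction (m : Machine) {s : Store} (h : Ready m s)
    (hp : ∀ v, s.level m.n v ≤ s.reg 3) :
    Halts m auction s ((m.n * (3 * s.reg 3 + 1) + 1) * (111 * (m.unit * m.log)) + 2) fun s' =>
      Ready m s' ∧ (∀ v, s'.level m.n v ≤ s.reg 3) ∧ Settled m s' := by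
  have hpos : 0 < m.unit * m.log := Nat.mul_pos (Nat.succ_pos _) (Nat.succ_pos _)
  refine Halts.seq (B₁ := 1) (Ψ := fun s' => s' = s.setReg 6 1)
    (B₂ := (m.n * (3 * s.reg 3 + 1) + 1) * (110 * m.unit * m.log + 1) + 1)
    (Halts.straight rfl rfl le_rfl) ?_ (by nlinarith [Nat.zero_le (m.n * (3 * s.reg 3 + 1))])
  rintro s₁ rfl -
  -- The variant is one more than the distance of the potential from its maximum.
  refine Halts.loop (B₁ := 110 * m.unit * m.log) (k := m.n * (3 * s.reg 3 + 1) + 1)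
    (fun k s' => Ready m s' ∧ (∀ v, s'.level m.n v ≤ s.reg 3) ∧
      ((s'.reg 6 ≠ 0 ∧ m.n * (3 * s.reg 3 + 1) <
          k + potential (s'.set m.n 1) (s'.set m.n 0) (s'.level m.n)) ∨
        (s'.reg 6 = 0 ∧ Settled m s'))) ?_ ?_ ?_ le_rfl
  · rintro k s' ⟨hr, hle, hk⟩ hsame hne
    rcases hk with ⟨-, hk⟩ | ⟨hc, -⟩
    swap
    · exact absurd hc hne
    have e3 : s'.reg 3 = s.reg 3 := by rw [hsame.1 3 rfl]; simp [Store.reg_setReg]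
    have hpot := potential_le (I₁ := s'.set m.n 1) (I₂ := s'.set m.n 0) hle
    rw [Fintype.card_fin] at hpot
    refine (halts_step m hr).mono ?_ le_rfl
    rintro s₂ (⟨h6, -, hs1, hs0, hl, hset⟩ | ⟨h6, x, hx₁, hx₂, hxK, hmin, b, hm, hb⟩) hs₂
    · refine ⟨0, by omega, ⟨?_, ?_⟩, by rwa [hl], Or.inr ⟨h6, ?_⟩⟩
      · rw [hs₂.1 0 rfl, hr.reg]
      · rw [hs1, hs0, hl]; exact hr.valid
      · unfold Settled
        rw [hs1, hs0, hl, hs₂.1 3 rfl]; exact hset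
    · rw [e3] at hxK
      have hlt := hm.potential_lt hr.valid.sub hx₁ hx₂
      refine ⟨k - 1, by omega, ⟨?_, hm.valid hr.valid m.ground₁ m.ground₂ hx₁ hx₂⟩,
        hm.le_of_lt hle hxK, Or.inl ⟨h6, by omega⟩⟩
      rw [hs₂.1 0 rfl, hr.reg]
  · refine ⟨⟨?_, h.valid⟩, hp, Or.inl ⟨by simp [Store.reg_setReg], by omega⟩⟩
    simpa [Store.reg_setReg] using h.reg
  · rintro k s' ⟨hr, hle, hk⟩ - hz
    rcases hk with ⟨hc, -⟩ | ⟨-, hk⟩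
    · exact absurd hz hc
    · exact ⟨hr, hle, hk⟩

theorem halts_chain (m : Machine) {s : Store} (h : Ready m s)
    (hex : ∀ i < s.reg 3, Exact m.M₁ m.M₂ (s.set m.n 1) (s.set m.n 0) (s.level m.n) i) :
    Halts m chain s ((s.reg 3 + 1) * (111 * (m.unit * m.log)) + 2) fun s' => Ready m s' ∧
      ((s'.reg 6 ≠ 0 ∧ (s.set m.n 0).ncard < (s'.set m.n 0).ncard) ∨
        (s'.reg 6 = 0 ∧ Settled m s')) := by
  have hpos : 0 < m.unit * m.log := Nat.mul_pos (Nat.succ_pos _) (Nat.succ_pos _)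
  refine Halts.seq (B₁ := 1) (Ψ := fun s' => s' = s.setReg 7 1)
    (B₂ := (s.reg 3 + 1) * (110 * m.unit * m.log + 1) + 1)
    (Halts.straight rfl rfl le_rfl) ?_ (by nlinarith [Nat.zero_le (s.reg 3)])
  rintro s₁ rfl -
  -- With exact labels each move that does not enlarge `I₂` lowers the least unmatched level by one,
  -- so the variant exceeds that level by at least two.
  refine Halts.loop (B₁ := 110 * m.unit * m.log) (k := s.reg 3 + 1)
    (fun k s' => Ready m s' ∧
      ((s'.reg 7 ≠ 0 ∧ (s.set m.n 0).ncard ≤ (s'.set m.n 0).ncard ∧ 1 ≤ k ∧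
          ∀ x ∈ s'.set m.n 1, x ∉ s'.set m.n 0 → s'.level m.n x < s.reg 3 →
            (∀ y ∈ s'.set m.n 1, y ∉ s'.set m.n 0 → s'.level m.n x ≤ s'.level m.n y) →
            Exact m.M₁ m.M₂ (s'.set m.n 1) (s'.set m.n 0) (s'.level m.n) (s'.level m.n x) ∧
              s'.level m.n x + 2 ≤ k) ∨
        (s'.reg 7 = 0 ∧ ((s'.reg 6 ≠ 0 ∧ (s.set m.n 0).ncard < (s'.set m.n 0).ncard) ∨
          (s'.reg 6 = 0 ∧ Settled m s'))))) ?_ ?_ ?_ le_rfl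
  · rintro k s' ⟨hr, hk⟩ hsame hne
    rcases hk with ⟨-, hcard, hk1, hk⟩ | ⟨hc, -⟩
    swap
    · exact absurd hc hne
    have e3 : s'.reg 3 = s.reg 3 := by rw [hsame.1 3 rfl]; simp [Store.reg_setReg]
    refine (halts_step m hr).mono ?_ le_rfl
    rintro s₂ (⟨h6, h7, hs1, hs0, hl, hset⟩ | ⟨h6, x, hx₁, hx₂, hxK, hmin, b, hm, hb⟩) hs₂
    · refine ⟨0, by omega, ⟨?_, ?_⟩, Or.inr ⟨h7, Or.inr ⟨h6, ?_⟩⟩⟩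
      · rw [hs₂.1 0 rfl, hr.reg]
      · rw [hs1, hs0, hl]; exact hr.valid
      · unfold Settled
        rw [hs1, hs0, hl, hs₂.1 3 rfl]; exact hset
    · rw [e3] at hxK
      obtain ⟨hexx, hxk⟩ := hk x hx₁ hx₂ hxK hmin
      have hr₂ : Ready m s₂ := by
        refine ⟨?_, hm.valid hr.valid m.ground₁ m.ground₂ hx₁ hx₂⟩
        rw [hs₂.1 0 rfl, hr.reg]
      by_cases hb' : b
      · refine ⟨0, by omega, hr₂, Or.inr ⟨hb.2 hb', Or.inl ⟨h6, ?_⟩⟩⟩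
        have := hm.ncard_of_true hb' hx₂
        omega
      · obtain ⟨y, hy₁, hy₂, hyp, hyex, hymin⟩ := hm.exact_pred hb' hr.valid hx₁ hx₂ hexx hmin
        refine ⟨k - 1, by omega, hr₂, Or.inl ⟨fun hc => hb' (hb.1 hc),
          hcard.trans (hm.ncard_le hx₂), by omega, fun z hz₁ hz₂ _ hzmin => ?_⟩⟩
        have e : s₂.level m.n z = s₂.level m.n y :=
          le_antisymm (hzmin y hy₁ hy₂) (hymin z hz₁ hz₂)
        rw [e]
        exact ⟨hyex, by omega⟩
  · refine ⟨⟨?_, h.valid⟩, Or.inl ⟨by simp [Store.reg_setReg], le_rfl, by omega,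
      fun x _ _ hxK _ => ⟨hex _ hxK, ?_⟩⟩⟩
    · simpa [Store.reg_setReg] using h.reg
    · omega
  · rintro k s' ⟨hr, hk⟩ - hz
    rcases hk with ⟨hc, -⟩ | ⟨-, hk⟩
    · exact absurd hz hc
    · exact ⟨hr, hk⟩

theorem Ready.ncard_le {m : Machine} {s : Store} (h : Ready m s) {r : ℕ}
    (hr : IsMaxCommonSize m.M₁ m.M₂ r) : (s.set m.n 0).ncard ≤ r :=
  hr.2 ⟨_, ⟨h.valid.base.indep.subset h.valid.sub, h.valid.indep⟩, rfl⟩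

theorem Settled.le {m : Machine} {s : Store} (hs : Settled m s) (h : Ready m s) {r : ℕ}
    (hr : IsMaxCommonSize m.M₁ m.M₂ r) :
    (s.reg 3 - 1) * r ≤ (s.reg 3 + 1) * (s.set m.n 0).ncard := by
  obtain ⟨X, ⟨hX₁, hX₂⟩, rfl⟩ := hr.1
  exact h.valid.ncard_le hs hX₁ hX₂

theorem halts_augment (m : Machine) {s : Store} (h : Ready m s) {r d : ℕ}
    (hr : IsMaxCommonSize m.M₁ m.M₂ r) (hd : r ≤ (s.set m.n 0).ncard + d)
    (h3 : s.reg 3 = 2 * m.n + 3) (hzero : ∀ v : Fin m.n, v ∉ s.set m.n 6) :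
    Halts m augment s ((d + 1) * (1000 * (m.n + 1) * (m.unit * m.log))) fun s' => Ready m s' ∧
      (s'.set m.n 0).ncard = r := by
  have hpos : 0 < m.unit * m.log := Nat.mul_pos (Nat.succ_pos _) (Nat.succ_pos _)
  have hround : 200 * (m.n + 1) * (m.unit * m.log) +
      ((2 * m.n + 3 + 1) * (111 * (m.unit * m.log)) + 2) ≤ 700 * (m.n + 1) * (m.unit * m.log) := by
    nlinarith
  refine Halts.seq (B₁ := 1) (Ψ := fun s' => s' = s.setReg 6 1)
    (B₂ := (d + 1) * (700 * (m.n + 1) * (m.unit * m.log) + 1) + 1)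
    (Halts.straight rfl rfl le_rfl) ?_ ?_
  swap
  · have : 3 ≤ 300 * (m.n + 1) * (m.unit * m.log) := by nlinarith
    nlinarith [Nat.zero_le d]
  rintro s₁ rfl -
  -- There are at most `d` augmenting rounds, and one more that finds no unmatched element below the
  -- bound.
  refine Halts.loop (B₁ := 700 * (m.n + 1) * (m.unit * m.log)) (k := d + 1)
    (fun k s' => Ready m s' ∧
      ((s'.reg 6 ≠ 0 ∧ r < (s'.set m.n 0).ncard + k) ∨ (s'.reg 6 = 0 ∧ Settled m s'))) ?_ ?_ ?_ le_rfl
  · rintro k s' ⟨hrd, hk⟩ hsame hne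
    rcases hk with ⟨-, hk⟩ | ⟨hc, -⟩
    swap
    · exact absurd hc hne
    have e3 : s'.reg 3 = 2 * m.n + 3 := by rw [hsame.1 3 rfl]; simpa [Store.reg_setReg] using h3
    have e6 : s'.set m.n 6 = s.set m.n 6 := Store.set_congr (hsame.2 6 rfl)
    refine Halts.seq (halts_search m hrd (by omega) (by rwa [e6])) ?_ hround
    rintro s₂ ⟨hs0, hr₂, hex, -⟩ hs₂
    have f3 : s₂.reg 3 = s'.reg 3 := hs₂.1 3 rfl
    refine (halts_chain m hr₂ (by rwa [f3])).mono ?_ (by rw [f3, e3])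
    rw [hs0]
    rintro s₃ ⟨hr₃, hc⟩ -
    have h1 := hrd.ncard_le hr
    rcases hc with ⟨h6, hlt⟩ | ⟨h6, hset⟩
    · exact ⟨k - 1, by omega, hr₃, Or.inl ⟨h6, by omega⟩⟩
    · exact ⟨0, by omega, hr₃, Or.inr ⟨h6, hset⟩⟩
  · refine ⟨⟨?_, h.valid⟩, Or.inl ⟨by simp [Store.reg_setReg], ?_⟩⟩
    · simpa [Store.reg_setReg] using h.reg
    · rw [Store.set_setReg]; omega
  · rintro k s' ⟨hrd, hk⟩ hsame hz
    rcases hk with ⟨hc, -⟩ | ⟨-, hset⟩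
    · exact absurd hz hc
    have e3 : s'.reg 3 = 2 * m.n + 3 := by rw [hsame.1 3 rfl]; simpa [Store.reg_setReg] using h3
    have h1 := hrd.ncard_le hr
    have h2 := hset.le hrd hr
    have h4 : (s'.set m.n 0).ncard ≤ m.n := by
      simpa using Set.ncard_le_card (s'.set m.n 0)
    rw [e3] at h2
    refine ⟨hrd, le_antisymm h1 ?_⟩
    -- With `K = 2n + 3` and `|I₂| ≤ n` the duality bound has no room for a deficit of one: it would
    -- give `2n + 2 ≤ 2 |I₂|`.
    by_contra hlt
    have h5 : (s'.set m.n 0).ncard + 1 ≤ r := by omega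
    have h6 : (2 * m.n + 3 - 1) * ((s'.set m.n 0).ncard + 1) ≤ (2 * m.n + 3 - 1) * r :=
      Nat.mul_le_mul_left _ h5
    have h7 : 2 * m.n + 3 - 1 = 2 * m.n + 2 := by omega
    rw [h7] at h6 h2
    nlinarith

theorem halts_greedyBase (m : Machine) {s : Store} (hn : s.reg 0 = m.n) (hz : s.arr = fun _ _ => 0) :
    Halts m greedyBase s (20 * (m.n + 1) * m.unit) fun s' => Ready m s' ∧
      ∀ v, s'.level m.n v = 0 := by
  have hU := m.n_lt_unit
  refine Halts.forRange (B₁ := 2 * m.unit + 8) (fun k s' => (∀ i, k ≤ i → s'.arr 1 i = 0) ∧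
    m.M₁.Indep (s'.set m.n 1) ∧
      ∀ v : Fin m.n, (v : ℕ) < k → v ∈ m.M₁.closure (s'.set m.n 1)) hn (by norm_num) (by norm_num)
    (by norm_num) rfl rfl ?_ ?_ ?_ (by nlinarith)
  · intro _ _
    have : s.set m.n 1 = ∅ := by
      ext v; simp [Store.mem_set, hz]
    simp only [Store.set_setReg, Store.arr_setReg, this, hz]
    simp
  · rintro k s₁ hk ⟨h0, hI, hcl⟩ hri - hsame
    refine Halts.seq (B₂ := 3) (halts_gain m true (a := 1) (x := 11) (o := 16) ⟨k, hk⟩ hri (h0 k le_rfl)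
      (by norm_num) (by norm_num) (by norm_num)) ?_ le_rfl
    rintro s₂ ⟨ha₂, h16⟩ hs₂
    have e1 : s₂.set m.n 1 = s₁.set m.n 1 := Store.set_congr (by rw [ha₂])
    have e11 : s₂.reg 11 = k := by rw [hs₂.1 11 rfl, hri]
    simp only [Store.arr_setReg, Store.set_setReg]
    refine Halts.ite (B₁ := 2) ?_ ?_ le_rfl
    · intro hne
      refine Halts.straight rfl ?_ (by simp [block, cost])
      have hset : ((block [const 13 1, Program.store 1 11 13]).eval m s₂).set m.n 1 =
          insert ⟨k, hk⟩ (s₁.set m.n 1) := by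
        rw [← e1]
        have := Store.set_setArr_insert (s₂.setReg 13 1) 1 (⟨k, hk⟩ : Fin m.n) one_ne_zero
        simpa [block, eval, Store.reg_setReg, e11, Store.set_setReg] using this
      have hkc : (⟨k, hk⟩ : Fin m.n) ∉ m.M₁.closure (s₁.set m.n 1) := h16.1 hne
      have hind : m.M₁.Indep (insert ⟨k, hk⟩ (s₁.set m.n 1)) :=
        hI.insert_indep_iff.2 (Or.inl ⟨by simp [m.ground₁], hkc⟩)
      intro _ _
      rw [hset]
      refine ⟨fun i hi => ?_, hind, fun v hv => ?_⟩
      · have : i ≠ k := by omega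
        simp [block, eval, Store.arr_setArr, Store.reg_setReg, Store.arr_setReg, e11, this, ha₂,
          h0 i (by omega)]
      · rcases Nat.lt_succ_iff_lt_or_eq.1 hv with hv | hv
        · exact m.M₁.closure_subset_closure (subset_insert _ _) (hcl v hv)
        · obtain rfl : v = ⟨k, hk⟩ := Fin.ext hv
          exact m.M₁.mem_closure_of_mem (mem_insert _ _) hind.subset_ground
    · intro hz'
      refine Halts.straight rfl ?_ (by simp [skip, cost])
      intro _ _
      have hset : (skip.eval m s₂).set m.n 1 = s₁.set m.n 1 := e1
      have hkc : (⟨k, hk⟩ : Fin m.n) ∈ m.M₁.closure (s₁.set m.n 1) := by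
        by_contra hc
        exact h16.2 hc hz'
      rw [hset]
      refine ⟨fun i hi => ?_, hI, fun v hv => ?_⟩
      · simp [skip, eval, Store.arr_setReg, ha₂, h0 i (by omega)]
      · rcases Nat.lt_succ_iff_lt_or_eq.1 hv with hv | hv
        · exact hcl v hv
        · obtain rfl : v = ⟨k, hk⟩ := Fin.ext hv
          exact hkc
  · rintro s' ⟨-, hI, hcl⟩ hsame
    have hl : ∀ v, s'.level m.n v = 0 := by
      intro v
      unfold Store.level
      rw [hsame.2 2 rfl, hz]
    have h0 : s'.set m.n 0 = ∅ := by
      ext v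
      rw [Store.mem_set, hsame.2 0 rfl, hz]; simp
    have hspan : ∀ v, v ∈ m.M₁.closure (s'.set m.n 1) := fun v => hcl v v.2
    refine ⟨⟨by rw [hsame.1 0 rfl, hn], ?_⟩, hl⟩
    refine ⟨hI.isBase_of_ground_subset_closure (fun v _ => hspan v), ?_, ?_, ?_, ?_⟩
    · rw [h0]; exact m.M₂.empty_indep
    · rw [h0]; exact empty_subset _
    · intro v _ hv
      exact absurd (hl v) hv
    · intro g _
      have : levelLE (s'.set m.n 1) (s'.level m.n) (s'.level m.n g + 1) = s'.set m.n 1 := by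
        ext v; simp [levelLE, hl]
      rw [this]
      exact hspan g

/-- The hypothesis `hJ` says that `J` is `q / p` rounded up, the number of times `p` can be
subtracted before `q` is exhausted. -/
theorem halts_quotientBound (m : Machine) {s : Store} {p q J : ℕ} (h1 : s.reg 1 = p)
    (h2 : s.reg 2 = q) (hJ : ∀ j, j < J ↔ j * p < q) :
    Halts m quotientBound s (4 * J + 3) fun s' => s'.reg 3 = 3 + 2 * J := by
  refine Halts.seq (B₁ := 2) (B₂ := 4 * J + 1) (Ψ := fun s' => s'.reg 3 = 3 ∧ s'.reg 22 = q)
    (Halts.straight rfl ?_ le_rfl) ?_ (by omega)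
  · simp [block, eval, Store.reg_setReg, h2]
  rintro s₁ ⟨e3, e22⟩ hs₁
  refine Halts.loop (B₁ := 3) (k := J) (fun k s' => k ≤ J ∧ s'.reg 3 = 3 + 2 * (J - k) ∧
    s'.reg 22 = q - (J - k) * p) ?_ ?_ ?_ (by omega)
  · rintro k s' ⟨hk, i3, i22⟩ hsame hne
    have e1 : s'.reg 1 = p := by rw [hsame.1 1 rfl, hs₁.1 1 rfl, h1]
    have hlt := (hJ (J - k)).2 (by omega)
    refine Halts.straight rfl ⟨k - 1, by omega, by omega, ?_, ?_⟩ le_rfl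
    · simp [block, eval, Store.reg_setReg, i3]; omega
    · have : J - (k - 1) = J - k + 1 := by omega
      rw [this, Nat.add_mul, one_mul]
      simp [block, eval, Store.reg_setReg, i22, e1]; omega
  · simp [e3, e22]
  · rintro k s' ⟨hk, i3, i22⟩ - hz
    rcases Nat.eq_zero_or_pos k with rfl | hpos
    · simpa using i3
    · exfalso
      rw [hz] at i22
      have := (hJ (J - k)).1 (by omega)
      omega

theorem halts_sqrtBound (m : Machine) {s : Store} (h : Ready m s) (h3 : s.reg 3 = 3) {r : ℕ}
    (hr : (s.set m.n 0).ncard ≤ r) :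
    Halts m sqrtBound s (4 * m.unit) fun s' => ∃ K, s'.reg 3 = K ∧ 3 ≤ K ∧
      2 * (s.set m.n 0).ncard + 6 ≤ K * (K - 1) ∧ (K - 1) * (K - 2) ≤ 2 * r + 6 := by
  have hU := m.n_lt_unit
  have hle : (s.set m.n 0).ncard ≤ m.n := by simpa using Set.ncard_le_card (s.set m.n 0)
  have hrk := rank_eq_ncard h.valid.indep
  set c := (s.set m.n 0).ncard
  refine Halts.seq (B₁ := m.unit) (B₂ := c * 3 + 1) (Ψ := fun s' => s'.reg 3 = 3 ∧ s'.reg 22 = c)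
    (Halts.straight rfl ?_ le_rfl) ?_ (by omega)
  · simp [eval, Store.reg_setReg, h3, hrk]
  rintro s₁ ⟨e3, e22⟩ -
  -- The numbers `3, 4, 5, …` are subtracted from `c`, and `3 + ⋯ + (d + 2) = ((d + 3)(d + 2) - 6) /
  -- 2`. Equality is lost only when the last subtraction is truncated.
  refine Halts.loop (B₁ := 2) (k := c) (fun k s' => s'.reg 22 = k ∧ ∃ d, s'.reg 3 = d + 3 ∧
    2 * c + 6 ≤ (d + 3) * (d + 2) + 2 * k ∧ (k ≠ 0 → (d + 3) * (d + 2) + 2 * k = 2 * c + 6) ∧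
    (d + 2) * (d + 1) ≤ 2 * c + 6) ?_ ?_ ?_ le_rfl
  · rintro k s' ⟨i22, d, i3, j1, j2, j3⟩ - hne
    have hk : k ≠ 0 := by rwa [← i22]
    have j2 := j2 hk
    refine Halts.straight rfl ⟨k - (d + 3), by omega, ?_, d + 1, ?_, ?_, ?_, ?_⟩ le_rfl
    · simp [block, eval, Store.reg_setReg, i22, i3]
    · simp [block, eval, Store.reg_setReg, i3]
    · have : (d + 1 + 3) * (d + 1 + 2) = (d + 3) * (d + 2) + 2 * (d + 3) := by ring
      omega
    · have : (d + 1 + 3) * (d + 1 + 2) = (d + 3) * (d + 2) + 2 * (d + 3) := by ring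
      omega
    · have : (d + 1 + 2) * (d + 1 + 1) = (d + 3) * (d + 2) := by ring
      omega
  · exact ⟨e22, 0, e3, by omega, by omega, by omega⟩
  · rintro k s' ⟨i22, d, i3, j1, j2, j3⟩ - hz
    refine ⟨d + 3, i3, by omega, ?_, ?_⟩
    · rw [show d + 3 - 1 = d + 2 by omega]; omega
    · rw [show d + 3 - 1 = d + 2 by omega, show d + 3 - 2 = d + 1 by omega]; omega

theorem halts_approximate (m : Machine) {s : Store} {p q J r : ℕ} (h0 : s.reg 0 = m.n)
    (h1 : s.reg 1 = p) (h2 : s.reg 2 = q) (hz : s.arr = fun _ _ => 0)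
    (hJ : ∀ j, j < J ↔ j * p < q) (hr : IsMaxCommonSize m.M₁ m.M₂ r) :
    Halts m approximate s (3000 * ((m.n + 1) * (J + 1) * (m.unit * m.log))) fun s' => Ready m s' ∧
      (2 * J + 2) * r ≤ (2 * J + 4) * (s'.set m.n 0).ncard := by
  have hpos : 0 < m.unit * m.log := Nat.mul_pos (Nat.succ_pos _) (Nat.succ_pos _)
  have hle : m.unit ≤ m.unit * m.log := Nat.le_mul_of_pos_right _ (Nat.succ_pos _)
  refine Halts.seq (B₂ := 4 * J + 3 +
    ((m.n * (3 * (3 + 2 * J) + 1) + 1) * (111 * (m.unit * m.log)) + 2))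
    (halts_greedyBase m h0 hz) ?_ ?_
  swap
  · have e1 : 20 * (m.n + 1) * m.unit ≤ 20 * ((m.n + 1) * (J + 1) * (m.unit * m.log)) := by
      calc 20 * (m.n + 1) * m.unit ≤ 20 * (m.n + 1) * (m.unit * m.log) := Nat.mul_le_mul_left _ hle
        _ ≤ _ := by nlinarith [Nat.zero_le ((m.n + 1) * J * (m.unit * m.log))]
    have e2 : 4 * J + 5 ≤ 5 * ((m.n + 1) * (J + 1) * (m.unit * m.log)) := by
      have : 1 * (J + 1) * 1 ≤ (m.n + 1) * (J + 1) * (m.unit * m.log) :=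
        Nat.mul_le_mul (Nat.mul_le_mul_right _ (by omega)) hpos
      omega
    have e3 : (m.n * (3 * (3 + 2 * J) + 1) + 1) * (111 * (m.unit * m.log)) ≤
        1110 * ((m.n + 1) * (J + 1) * (m.unit * m.log)) := by
      have : m.n * (3 * (3 + 2 * J) + 1) + 1 ≤ 10 * ((m.n + 1) * (J + 1)) := by nlinarith
      calc _ ≤ 10 * ((m.n + 1) * (J + 1)) * (111 * (m.unit * m.log)) := Nat.mul_le_mul_right _ this
        _ = _ := by ring
    omega
  rintro s₁ ⟨hr₁, hl₁⟩ hs₁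
  refine Halts.seq (halts_quotientBound m (by rw [hs₁.1 1 rfl, h1]) (by rw [hs₁.1 2 rfl, h2]) hJ) ?_
    le_rfl
  intro s₂ e3 hs₂
  have f0 : s₂.set m.n 0 = s₁.set m.n 0 := Store.set_congr (hs₂.2 0 rfl)
  have f1 : s₂.set m.n 1 = s₁.set m.n 1 := Store.set_congr (hs₂.2 1 rfl)
  have fl : s₂.level m.n = s₁.level m.n := by unfold Store.level; rw [hs₂.2 2 rfl]
  have hr₂ : Ready m s₂ := ⟨by rw [hs₂.1 0 rfl, hr₁.reg], by rw [f0, f1, fl]; exact hr₁.valid⟩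
  rw [← e3]
  refine (halts_auction m hr₂ (fun v => ?_)).mono ?_ le_rfl
  · rw [fl, hl₁]; exact Nat.zero_le _
  · rintro s₃ ⟨hr₃, -, hset⟩ hs₃
    have := hset.le hr₃ hr
    rw [hs₃.1 3 rfl, e3, show 3 + 2 * J - 1 = 2 * J + 2 by omega,
      show 3 + 2 * J + 1 = 2 * J + 4 by omega] at this
    exact ⟨hr₃, this⟩

theorem halts_solve (m : Machine) {s : Store} {r N : ℕ} (h0 : s.reg 0 = m.n)
    (hz : s.arr = fun _ _ => 0) (hr : IsMaxCommonSize m.M₁ m.M₂ r)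
    (hN : ∀ K, (K - 1) * (K - 2) ≤ 2 * r + 6 → K ≤ N) :
    Halts m solve s (10000 * ((m.n + 1) * (N + 1) * (m.unit * m.log))) fun s' => Ready m s' ∧
      (s'.set m.n 0).ncard = r := by
  have hpos : 0 < m.unit * m.log := Nat.mul_pos (Nat.succ_pos _) (Nat.succ_pos _)
  have hle : m.unit ≤ m.unit * m.log := Nat.le_mul_of_pos_right _ (Nat.succ_pos _)
  set V := m.unit * m.log
  refine Halts.seq (B₂ := 1 + (((m.n * (3 * 3 + 1) + 1) * (111 * V) + 2) + (4 * m.unit +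
    (((m.n * (3 * N + 1) + 1) * (111 * V) + 2) + (2 + ((4 * m.n + 3) +
      (2 * N + 1) * (1000 * (m.n + 1) * V)))))))
    (halts_greedyBase m h0 hz) ?_ ?_
  swap
  · have e1 : 20 * (m.n + 1) * m.unit ≤ 20 * ((m.n + 1) * (N + 1) * V) := by
      calc 20 * (m.n + 1) * m.unit ≤ 20 * (m.n + 1) * V := Nat.mul_le_mul_left _ hle
        _ ≤ _ := by nlinarith [Nat.zero_le ((m.n + 1) * N * V)]
    have e2 : m.n + 1 ≤ (m.n + 1) * (N + 1) * V := by
      have : (m.n + 1) * 1 * 1 ≤ (m.n + 1) * (N + 1) * V :=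
        Nat.mul_le_mul (Nat.mul_le_mul_left _ (by omega)) hpos
      omega
    have e2' : V ≤ (m.n + 1) * (N + 1) * V := Nat.le_mul_of_pos_left _ (by positivity)
    have e3 : (m.n * (3 * 3 + 1) + 1) * (111 * V) ≤ 1110 * ((m.n + 1) * (N + 1) * V) := by
      have : m.n * (3 * 3 + 1) + 1 ≤ 10 * ((m.n + 1) * (N + 1)) := by
        nlinarith [Nat.zero_le (m.n * N)]
      calc _ ≤ 10 * ((m.n + 1) * (N + 1)) * (111 * V) := Nat.mul_le_mul_right _ this
        _ = _ := by ring
    have e4 : (m.n * (3 * N + 1) + 1) * (111 * V) ≤ 333 * ((m.n + 1) * (N + 1) * V) := by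
      have : m.n * (3 * N + 1) + 1 ≤ 3 * ((m.n + 1) * (N + 1)) := by
        nlinarith [Nat.zero_le (m.n * N)]
      calc _ ≤ 3 * ((m.n + 1) * (N + 1)) * (111 * V) := Nat.mul_le_mul_right _ this
        _ = _ := by ring
    have e5 : (2 * N + 1) * (1000 * (m.n + 1) * V) ≤ 2000 * ((m.n + 1) * (N + 1) * V) := by
      calc _ ≤ (2 * (N + 1)) * (1000 * (m.n + 1) * V) := Nat.mul_le_mul_right _ (by omega)
        _ = _ := by ring
    omega
  rintro s₁ ⟨hr₁, hl₁⟩ hs₁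
  refine Halts.seq (B₁ := 1) (Ψ := fun s' => s' = s₁.setReg 3 3) (Halts.straight rfl rfl le_rfl) ?_
    le_rfl
  rintro s₂ rfl -
  have hr₂ : Ready m (s₁.setReg 3 3) := ⟨by simpa [Store.reg_setReg] using hr₁.reg, hr₁.valid⟩
  have e3 : (s₁.setReg 3 3).reg 3 = 3 := by simp [Store.reg_setReg]
  have hauc := halts_auction m hr₂ (fun v => by
    change s₁.level m.n v ≤ _
    rw [hl₁]; exact Nat.zero_le _)
  rw [e3] at hauc
  refine Halts.seq hauc ?_ le_rfl
  rintro s₃ ⟨hr₃, hl₃, hset₃⟩ hs₃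
  have f3 : s₃.reg 3 = 3 := by rw [hs₃.1 3 rfl, e3]
  -- The duality bound for `K = 3` reads `2 r ≤ 4 |I₂|`.
  have hhalf : r ≤ 2 * (s₃.set m.n 0).ncard := by
    have := hset₃.le hr₃ hr
    rw [f3] at this
    omega
  refine Halts.seq (halts_sqrtBound m hr₃ f3 (hr₃.ncard_le hr)) ?_ le_rfl
  rintro s₄ ⟨K, k3, hK3, hK, hK'⟩ hs₄
  have hKN := hN K hK'
  have f0 : s₄.set m.n 0 = s₃.set m.n 0 := Store.set_congr (hs₄.2 0 rfl)
  have f1 : s₄.set m.n 1 = s₃.set m.n 1 := Store.set_congr (hs₄.2 1 rfl)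
  have fl : s₄.level m.n = s₃.level m.n := by unfold Store.level; rw [hs₄.2 2 rfl]
  have hr₄ : Ready m s₄ := ⟨by rw [hs₄.1 0 rfl, hr₃.reg], by rw [f0, f1, fl]; exact hr₃.valid⟩
  -- The second run continues with the sets and labels of the first, which are at most `3 ≤ K`.
  have hauc' : Halts m auction s₄ ((m.n * (3 * N + 1) + 1) * (111 * V) + 2) _ :=
    (halts_auction m hr₄ (fun v => by rw [fl, k3]; exact (hl₃ v).trans hK3)).mono
      (fun _ h _ => h) (by
        rw [k3]
        gcongr)
  refine Halts.seq hauc' ?_ le_rfl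
  rintro s₅ ⟨hr₅, -, hset₅⟩ hs₅
  have g3 : s₅.reg 3 = K := by rw [hs₅.1 3 rfl, k3]
  -- The deficit `t` satisfies `(K - 1) t ≤ 2 |I₂| ≤ 2 r`, and `2 r` is at most four times the size
  -- after the first run, hence at most `2 K (K - 1)`.
  have hdef : r ≤ (s₅.set m.n 0).ncard + 2 * K := by
    have h1 := hset₅.le hr₅ hr
    have h2 := hr₅.ncard_le hr
    rw [g3] at h1
    obtain ⟨d, rfl⟩ := Nat.exists_eq_add_of_le hK3
    obtain ⟨t, ht⟩ := Nat.exists_eq_add_of_le h2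
    rw [show 3 + d - 1 = d + 2 by omega] at h1 hK
    have h3 : (d + 2) * t ≤ 2 * (s₅.set m.n 0).ncard := by
      rw [ht] at h1
      nlinarith
    have h4 : (d + 2) * t ≤ (d + 2) * (2 * (3 + d)) := by nlinarith
    have h5 : t ≤ 2 * (3 + d) := Nat.le_of_mul_le_mul_left h4 (by omega)
    omega
  refine Halts.seq (B₁ := 2) (Ψ := fun s' => s'.reg 0 = m.n ∧ s'.reg 1 = 1 ∧ s'.reg 2 = m.n ∧
    s'.arr = s₅.arr) (Halts.straight rfl ?_ le_rfl) ?_ le_rfl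
  · simp [block, eval, Store.reg_setReg, Store.arr_setReg, hr₅.reg]
  rintro s₆ ⟨g0, g1, g2, ga⟩ hs₆
  -- The quotient `n / 1` gives the bound `2n + 3`, above every label that the search can assign to
  -- a reached element.
  refine Halts.seq (halts_quotientBound m (J := m.n) g1 g2 (fun j => by simp)) ?_ le_rfl
  intro s₇ l3 hs₇
  have hr₇ : Ready m s₇ := by
    refine ⟨by rw [hs₇.1 0 rfl, g0], ?_⟩
    have l0 : s₇.set m.n 0 = s₅.set m.n 0 := Store.set_congr (by rw [hs₇.2 0 rfl, ga])
    have l1 : s₇.set m.n 1 = s₅.set m.n 1 := Store.set_congr (by rw [hs₇.2 1 rfl, ga])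
    have ll : s₇.level m.n = s₅.level m.n := by unfold Store.level; rw [hs₇.2 2 rfl, ga]
    rw [l0, l1, ll]
    exact hr₅.valid
  refine (halts_augment m hr₇ (d := 2 * K) hr ?_ (by omega) ?_).mono (fun _ h _ => h) ?_
  · rw [Store.set_congr (s' := s₇) (s := s₅) (by rw [hs₇.2 0 rfl, ga])]
    exact hdef
  · intro v
    rw [Store.mem_set, hs₇.2 6 rfl, ga, hs₅.2 6 rfl, hs₄.2 6 rfl, hs₃.2 6 rfl]
    change ¬ s₁.arr 6 v ≠ 0
    rw [hs₁.2 6 rfl, hz]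
    simp
  · gcongr

/-! ### Conversion to real time bounds. -/

theorem Machine.log_le (m : Machine) (hn : 2 ≤ m.n) : (m.log : ℝ) ≤ 5 * Real.log m.n := by
  have h2 : (0.69 : ℝ) < Real.log 2 := by have := Real.log_two_gt_d9; linarith
  have h3 : Real.log 2 ≤ Real.log m.n :=
    Real.log_le_log (by norm_num) (by exact_mod_cast hn)
  have h1 : (Nat.log 2 m.n : ℝ) * Real.log 2 ≤ Real.log m.n := by
    rw [← Real.log_pow]
    refine Real.log_le_log (by positivity) ?_
    exact_mod_cast Nat.pow_log_le_self 2 (by omega)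
  have h4 : (m.log : ℝ) = Nat.log 2 m.n + 2 := by simp [Machine.log]
  rw [h4]
  nlinarith

/-- A time bound in the units of the machine, expressed by the input length and the oracle times. -/
theorem Machine.time_le (m : Machine) (hn : 2 ≤ m.n) {t c A' : ℕ} {A y : ℝ}
    (ht : t ≤ c * ((m.n + 1) * A' * (m.unit * m.log))) (hA : (A' : ℝ) ≤ A * y) (hy : 0 ≤ A * y) :
    (t : ℝ) ≤ (20 * c * A) * (m.n * y * Real.log m.n * ((m.T₁ : ℝ) + m.T₂)) := by
  have hlog := m.log_le hn
  have hlog0 : 0 ≤ Real.log m.n := Real.log_natCast_nonneg _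
  have hn' : (2 : ℝ) ≤ m.n := by exact_mod_cast hn
  have hU : (m.unit : ℝ) ≤ 2 * ((m.T₁ : ℝ) + m.T₂) := by
    have := m.le
    have h : m.unit ≤ 2 * (m.T₁ + m.T₂) := by unfold Machine.unit; omega
    exact_mod_cast h
  -- The factor `20 = 2 · 2 · 5` comes from `n + 1 ≤ 2n`, from `unit ≤ 2 (T₁ + T₂)` and from
  -- `Machine.log_le`.
  calc (t : ℝ) ≤ c * ((m.n + 1) * A' * (m.unit * m.log)) := by exact_mod_cast ht
    _ ≤ c * ((2 * m.n) * (A * y) * ((2 * ((m.T₁ : ℝ) + m.T₂)) * (5 * Real.log m.n))) := by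
        gcongr
        linarith
    _ = _ := by ring

end RankOracle

theorem theorem4 :
    -- exact algorithm: input `n`, output in array `0`
    (∃ (P : RankOracle.Program) (C : ℝ),
      ∀ (n : ℕ) (M₁ M₂ : Matroid (Fin n)), M₁.E = Set.univ → M₂.E = Set.univ →
      ∀ r : ℕ, RankOracle.IsMaxCommonSize M₁ M₂ r →
      ∀ T₁ T₂ : ℕ, n ≤ T₁ + T₂ →
      ∃ (s : RankOracle.Store) (t : ℕ),
        RankOracle.Runs M₁ M₂ T₁ T₂ P (RankOracle.Store.init [n]) s t ∧
        RankOracle.CommonIndep M₁ M₂ (s.set n 0) ∧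
        (s.set n 0).ncard = r ∧
        (2 ≤ n → (t : ℝ) ≤
          C * ((n : ℝ) * Real.sqrt ((max r 1 : ℕ) : ℝ) * Real.log (n : ℝ)
            * ((T₁ : ℝ) + (T₂ : ℝ))))) ∧
    -- approximation algorithm: input `n, p, q` with `ε = p / q`, output in array `0`
    (∃ (P : RankOracle.Program) (C : ℝ),
      ∀ (n : ℕ) (M₁ M₂ : Matroid (Fin n)), M₁.E = Set.univ → M₂.E = Set.univ →
      ∀ r : ℕ, RankOracle.IsMaxCommonSize M₁ M₂ r →
      ∀ T₁ T₂ : ℕ, n ≤ T₁ + T₂ →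
      ∀ (ε : ℝ) (p q : ℕ), 0 < ε → ε ≤ 1 → 0 < q → ε = (p : ℝ) / (q : ℝ) →
      ∃ (s : RankOracle.Store) (t : ℕ),
        RankOracle.Runs M₁ M₂ T₁ T₂ P (RankOracle.Store.init [n, p, q]) s t ∧
        RankOracle.CommonIndep M₁ M₂ (s.set n 0) ∧
        (1 - ε) * (r : ℝ) ≤ ((s.set n 0).ncard : ℝ) ∧
        (2 ≤ n → (t : ℝ) ≤
          C * ((n : ℝ) * ε⁻¹ * Real.log (n : ℝ) * ((T₁ : ℝ) + (T₂ : ℝ))))) := by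
  constructor
  · refine ⟨RankOracle.Program.solve, 20 * (10000 : ℕ) * 7, ?_⟩
    intro n M₁ M₂ hE₁ hE₂ r hr T₁ T₂ hT
    let m : RankOracle.Machine := ⟨n, M₁, M₂, T₁, T₂, hE₁, hE₂, hT⟩
    obtain ⟨s, t, hrun, ht, hready, hcard⟩ := RankOracle.halts_solve m
      (s := RankOracle.Store.init [n]) (r := r) (N := Nat.sqrt (2 * r + 6) + 2) rfl rfl hr
      (fun K hK => by
        have : K - 2 ≤ Nat.sqrt (2 * r + 6) :=
          Nat.le_sqrt.2 ((Nat.mul_le_mul_right _ (by omega)).trans hK)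
        omega)
    refine ⟨s, t, hrun, ⟨hready.valid.base.indep.subset hready.valid.sub, hready.valid.indep⟩, hcard,
      fun hn => ?_⟩
    refine m.time_le hn ht ?_ (by positivity)
    have h1 : (1 : ℝ) ≤ ((max r 1 : ℕ) : ℝ) := by exact_mod_cast le_max_right r 1
    have h2 : (r : ℝ) ≤ ((max r 1 : ℕ) : ℝ) := by exact_mod_cast le_max_left r 1
    have h3 : (Nat.sqrt (2 * r + 6) : ℝ) ≤ 3 * Real.sqrt ((max r 1 : ℕ) : ℝ) := by
      refine Real.nat_sqrt_le_real_sqrt.trans ?_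
      refine Real.sqrt_le_iff.2 ⟨by positivity, ?_⟩
      rw [mul_pow, Real.sq_sqrt (by positivity)]
      push_cast at h1 h2 ⊢
      linarith
    have h4 : 1 ≤ Real.sqrt ((max r 1 : ℕ) : ℝ) := Real.one_le_sqrt.2 h1
    push_cast at h3 h4 ⊢
    linarith
  · refine ⟨RankOracle.Program.approximate, 20 * (3000 : ℕ) * 3, ?_⟩
    intro n M₁ M₂ hE₁ hE₂ r hr T₁ T₂ hT ε p q hε hε1 hq hpq
    let m : RankOracle.Machine := ⟨n, M₁, M₂, T₁, T₂, hE₁, hE₂, hT⟩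
    have hq' : (0 : ℝ) < q := by exact_mod_cast hq
    have hp' : (0 : ℝ) < p := by
      by_contra hc
      have : ε ≤ 0 := hpq ▸ div_nonpos_of_nonpos_of_nonneg (not_lt.1 hc) hq'.le
      linarith
    have hinv : ε⁻¹ = (q : ℝ) / p := by rw [hpq, inv_div]
    obtain ⟨s, t, hrun, ht, hready, hcard⟩ := RankOracle.halts_approximate m
      (s := RankOracle.Store.init [n, p, q]) (r := r) (J := ⌈ε⁻¹⌉₊) rfl rfl rfl rfl
      (fun j => by
        rw [Nat.lt_ceil, hinv, lt_div_iff₀ hp']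
        exact_mod_cast Iff.rfl) hr
    refine ⟨s, t, hrun, ⟨hready.valid.base.indep.subset hready.valid.sub, hready.valid.indep⟩, ?_,
      fun hn => ?_⟩
    · have hJ : ε⁻¹ ≤ (⌈ε⁻¹⌉₊ : ℝ) := Nat.le_ceil _
      have hle : ((s.set n 0).ncard : ℝ) ≤ r := by exact_mod_cast hready.ncard_le hr
      have hcard' : (2 * (⌈ε⁻¹⌉₊ : ℝ) + 2) * r ≤ (2 * (⌈ε⁻¹⌉₊ : ℝ) + 4) * (s.set n 0).ncard := by
        exact_mod_cast hcard
      have hεJ : 1 ≤ ε * (⌈ε⁻¹⌉₊ : ℝ) := by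
        calc (1 : ℝ) = ε * ε⁻¹ := (mul_inv_cancel₀ hε.ne').symm
          _ ≤ _ := by gcongr
      have hr0 : (0 : ℝ) ≤ r := Nat.cast_nonneg r
      set J : ℝ := (⌈ε⁻¹⌉₊ : ℝ)
      set c : ℝ := ((s.set n 0).ncard : ℝ)
      have hJ0 : 0 ≤ J := Nat.cast_nonneg _
      -- The bound `K = 2J + 3` leaves a relative deficit of at most `1 / (J + 1)`, which is below
      -- `ε` since `J ≥ 1 / ε`.
      have key : (2 * J + 2) * (r - c) ≤ 2 * r := by linarith
      by_contra hc
      have h5 : ε * r < r - c := by linarith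
      have h6 : (2 * J + 2) * (ε * r) < (2 * J + 2) * (r - c) :=
        mul_lt_mul_of_pos_left h5 (by linarith)
      have h7 : 2 * r ≤ (2 * J + 2) * (ε * r) := by
        have : r * 1 ≤ r * (ε * J) := mul_le_mul_of_nonneg_left hεJ hr0
        have : 0 ≤ ε * r := by positivity
        nlinarith
      linarith
    · refine m.time_le hn ht ?_ (by positivity)
      have h1 : 1 ≤ ε⁻¹ := one_le_inv_iff₀.2 ⟨hε, hε1⟩
      have h2 := (Nat.ceil_lt_add_one (a := ε⁻¹) (by positivity)).le
      push_cast
      linarith
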